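/- Let $p,q\ge 0$ be integers and let $(Z_t)_{t\in\mathbb Z}$ be i.i.d. real random variables with $\mathbb E Z_0=0$, $\mathbb E Z_0^2=1$; put $\mathcal F_t=\sigma(Z_k;k\le t)$. For $\theta=(\alpha_0,\alpha_1,\dots,\alpha_p,\beta_1,\dots,\beta_q,\gamma)$, $x\in\mathbb R^p$ and $s\in[0,\infty)^q$ write $$g_\theta(x,s)=\alpha_0+\sum_{i=1}^p\alpha_i(|x_i|-\gamma x_i)^2+\sum_{j=1}^q\beta_j s_j .$$ Let $B=\{(\beta_1,\dots,\beta_q)\in[0,1)^q:\sum_{j=1}^q\beta_j<1\}$, let $K\subset(0,\infty)\times[0,\infty)^p\times B\times[-1,1]$ be compact, and let $\theta_0=(\alpha_0^\circ,\alpha_1^\circ,\dots,\alpha_p^\circ,\beta_1^\circ,\dots,\beta_q^\circ,\gamma^\circ)\in K$. Let $((X_t,\sigma_t))_{t\in\mathbb Z}$ be a stationary AGARCH$(p,q)$ process with parameter $\theta_0$ (a GARCH$(p,q)$ process if $\gamma^\circ=0$), that is, a strictly stationary sequence with $\sigma_t\ge 0$, $\sigma_t$ (a.s. equal to an) $\mathcal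 F_{t-1}$-measurable random variable, and, almost surely for all $t\in\mathbb Z$, $$X_t=\sigma_tZ_t,\qquad \sigma_t^2=g_{\theta_0}(X_{t-1},\dots,X_{t-p};\sigma_{t-1}^2,\dots,\sigma_{t-q}^2).$$ Suppose that 1. $\alpha_i^\circ>0$ for some $i\in\{1,\dots,p\}$ and, if $q\ge1$, $(\alpha_p^\circ,\beta_q^\circ)\ne(0,0)$; 2. the polynomials $a^\circ(z)=\sum_{i=1}^p\alpha_i^\circ z^i$ and $b^\circ(z)=1-\sum_{j=1}^q\beta_j^\circ z^j$ have no common zeros in $\mathbb C$; 3. the distribution of $Z_0$ is not concentrated at two points: there are no $a,b\in\mathbb R$ with $\mathbb P(Z_0\in\{a,b\})=1$. Fix any initial vector $\varsigma\in[0,\infty)^q$. For $\theta\in K$ set $(\hat h_0(\theta),\hat h_{-1}(\theta),\dots,\hat h_{-q+1}(\theta))=\varsigma$ and, for $t\ge1$, $$\hat h_t(\theta)=g_\theta(X_{t-1},\dots,X_{t-p};\hat h_{t-1}(\theta),\dots,\hat h_{t-q}(\theta)),\qquad \hat L_n(\theta)=-\frac12\sum_{t=1}^n\Big(\frac{X_t^2}{\hat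 h_t(\theta)}+\log\hat h_t(\theta)\Big).$$ Then $\hat L_n$ attains its maximum over $K$ for every $n$ and every outcome, and the quasi-maximum-likelihood estimator is strongly consistent: if, for every $n\ge1$, $\hat\theta_n\in K$ almost surely maximizes $\hat L_n$ over $K$, then $\hat\theta_n\to\theta_0$ almost surely as $n\to\infty$. -/

import Mathlib

open Filter Topology MeasureTheory ProbabilityTheory

noncomputable section

/-- Parameter vectors `θ = (α₀, (α₁, …, α_p), (β₁, …, β_q), γ)` of the AGARCH(p, q) model.
The entry of index `i` of the second (third) component is `α_{i+1}` (`β_{i+1}`). -/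
abbrev AGARCHParam (p q : ℕ) : Type := ℝ × (Fin p → ℝ) × (Fin q → ℝ) × ℝ

namespace AGARCHParam

variable {p q : ℕ}

/-- The constant coefficient `α₀`. -/
def alphaZero (θ : AGARCHParam p q) : ℝ := θ.1

/-- The coefficients `α₁, …, α_p`. -/
def alpha (θ : AGARCHParam p q) : Fin p → ℝ := θ.2.1

/-- The coefficients `β₁, …, β_q`. -/
def beta (θ : AGARCHParam p q) : Fin q → ℝ := θ.2.2.1

/-- The asymmetry parameter `γ`. -/
def gamma (θ : AGARCHParam p q) : ℝ := θ.2.2.2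

/-- The parameter space `(0, ∞) × [0, ∞)^p × B × [-1, 1]`, where
`B = {β ∈ [0, 1)^q | β₁ + ⋯ + β_q < 1}`. -/
def space (p q : ℕ) : Set (AGARCHParam p q) :=
  {θ | 0 < θ.alphaZero ∧ (∀ i, 0 ≤ θ.alpha i) ∧
    ((∀ j, 0 ≤ θ.beta j ∧ θ.beta j < 1) ∧ ∑ j, θ.beta j < 1) ∧
    -1 ≤ θ.gamma ∧ θ.gamma ≤ 1}

/-- The polynomial function `a(z) = α₁ z + ⋯ + α_p z^p`. -/
def aPoly (θ : AGARCHParam p q) (z : ℂ) : ℂ :=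
  ∑ i : Fin p, (θ.alpha i : ℂ) * z ^ ((i : ℕ) + 1)

/-- The polynomial function `b(z) = 1 - β₁ z - ⋯ - β_q z^q`. -/
def bPoly (θ : AGARCHParam p q) (z : ℂ) : ℂ :=
  1 - ∑ j : Fin q, (θ.beta j : ℂ) * z ^ ((j : ℕ) + 1)

/-- The squared volatility as a function of the last `p` observations `x` and the last `q`
squared volatilities `s` (most recent first):
`g_θ(x, s) = α₀ + ∑ α_i (|x_i| - γ x_i)² + ∑ β_j s_j`. -/
def volMap (θ : AGARCHParam p q) (x : Fin p → ℝ) (s : Fin q → ℝ) : ℝ :=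
  θ.alphaZero + ∑ i, θ.alpha i * (|x i| - θ.gamma * x i) ^ 2 + ∑ j, θ.beta j * s j

end AGARCHParam

/-- The vector `(y_t, y_{t-1}, …, y_{t-k+1})`. -/
def lagVec (y : ℤ → ℝ) (k : ℕ) (t : ℤ) : Fin k → ℝ := fun i => y (t - ((i : ℕ) : ℤ))

/-- `(Z_t)` is an i.i.d. sequence of random variables with mean zero and variance one. -/
structure IsStandardNoise {Ω : Type*} [MeasurableSpace Ω] (μ : Measure Ω)
    (Z : ℤ → Ω → ℝ) : Prop where
  measurable : ∀ t, Measurable (Z t)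
  indep : iIndepFun Z μ
  identDistrib : ∀ t, IdentDistrib (Z t) (Z 0) μ μ
  memLp : MemLp (Z 0) 2 μ
  mean : ∫ ω, Z 0 ω ∂μ = 0
  secondMoment : ∫ ω, Z 0 ω ^ 2 ∂μ = 1

/-- Strict stationarity of a sequence of random elements indexed by `ℤ`: the law of the whole
sequence is invariant under every time shift. -/
def IsStrictlyStationary {Ω E : Type*} [MeasurableSpace Ω] [MeasurableSpace E] (μ : Measure Ω)
    (V : ℤ → Ω → E) : Prop :=
  ∀ h : ℤ, IdentDistrib (fun ω (t : ℤ) => V (t + h) ω) (fun ω (t : ℤ) => V t ω) μ μ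

/-- The σ-field `ℱ_t = σ(Z_k; k ≤ t)`. -/
@[reducible] def noisePast {Ω : Type*} (Z : ℤ → Ω → ℝ) (t : ℤ) : MeasurableSpace Ω :=
  ⨆ k : {k : ℤ // k ≤ t}, MeasurableSpace.comap (Z k) inferInstance

/-- `((X_t, σ_t))` is a strictly stationary solution, driven by the noise `(Z_t)`, of the
AGARCH(p, q) equations with parameter `θ`; the volatility `σ_t` is nonnegative and, up to null
sets, measurable with respect to `ℱ_{t-1}`. -/
structure IsStationaryAGARCH {Ω : Type*} [MeasurableSpace Ω] (μ : Measure Ω) {p q : ℕ}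
    (θ : AGARCHParam p q) (Z X σ : ℤ → Ω → ℝ) : Prop where
  noise : IsStandardNoise μ Z
  measurable_obs : ∀ t, Measurable (X t)
  measurable_vol : ∀ t, Measurable (σ t)
  vol_nonneg : ∀ t, ∀ᵐ ω ∂μ, 0 ≤ σ t ω
  vol_adapted : ∀ t, ∃ f : Ω → ℝ, Measurable[noisePast Z (t - 1)] f ∧ σ t =ᵐ[μ] f
  stationary : IsStrictlyStationary μ (fun t ω => (X t ω, σ t ω))
  obs_eq : ∀ t, ∀ᵐ ω ∂μ, X t ω = σ t ω * Z t ω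
  vol_eq : ∀ t, ∀ᵐ ω ∂μ, σ t ω ^ 2 =
    θ.volMap (lagVec (fun s => X s ω) p (t - 1)) (lagVec (fun s => σ s ω ^ 2) q (t - 1))

namespace AGARCHParam

variable {p q : ℕ}

/-- The vector `(ĥ_t(θ), …, ĥ_{t-q+1}(θ))`, `t ≥ 0`, computed recursively from the observed
path `x` and the initial value `ς`:
it equals `ς` at `t = 0`, and a step prepends `g_θ(x_t, …, x_{t-p+1}; ĥ_t, …, ĥ_{t-q+1})`
and drops the oldest entry. -/
def hHatVec (θ : AGARCHParam p q) (ς : Fin q → ℝ) (x : ℤ → ℝ) : ℕ → Fin q → ℝ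
  | 0 => ς
  | t + 1 => fun j =>
      Matrix.vecCons (θ.volMap (lagVec x p (t : ℤ)) (hHatVec θ ς x t)) (hHatVec θ ς x t)
        j.castSucc

/-- The value `ĥ_{t+1}(θ) = g_θ(x_t, …, x_{t-p+1}; ĥ_t(θ), …, ĥ_{t-q+1}(θ))`, `t ≥ 0`.
For `q ≥ 1` it is the first coordinate of the vector at time `t + 1`. -/
def hHatSucc (θ : AGARCHParam p q) (ς : Fin q → ℝ) (x : ℤ → ℝ) (t : ℕ) : ℝ :=
  θ.volMap (lagVec x p (t : ℤ)) (θ.hHatVec ς x t)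

/-- The conditional Gaussian log-likelihood
`L̂_n(θ) = -(1/2) ∑_{t=1}^n (x_t² / ĥ_t(θ) + log ĥ_t(θ))`; the summation variable is `t - 1`. -/
def logLik (ς : Fin q → ℝ) (x : ℤ → ℝ) (n : ℕ) (θ : AGARCHParam p q) : ℝ :=
  -(1 / 2) * ∑ t ∈ Finset.range n,
    (x ((t : ℤ) + 1) ^ 2 / θ.hHatSucc ς x t + Real.log (θ.hHatSucc ς x t))

/-- `θ` is a value of the quasi-maximum-likelihood estimator on `K` computed from
`x_{-p+1}, …, x_n`: a maximizer of `L̂_n` over `K`. -/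
def IsQMLE (K : Set (AGARCHParam p q)) (ς : Fin q → ℝ) (x : ℤ → ℝ) (n : ℕ)
    (θ : AGARCHParam p q) : Prop :=
  θ ∈ K ∧ IsMaxOn (logLik ς x n) K θ

end AGARCHParam

end

/-
The volatility of a parameter `θ` is a positive linear recursion driven by the observations, and
its ARCH(∞) solution `statVol θ` depends on the observed past only. The initial values are forgotten
exponentially fast, uniformly on compact sets, so `-2 L̂_n(θ)` stays within a bounded distance of
`∑_{t ≤ n} (X_t² / statVol θ t + log (statVol θ t))`.

Moments of `X` have to come from stationarity alone: since the volatility is stationary, the impulse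
response of its recursion decays exponentially relative to it, so `E R^κ < 1` for some impulse
response `R` and some small `κ > 0`, which gives `E σ^{2κ} < ∞`. Hence `(log σ)⁺` is integrable and
all geometrically weighted series of past observations converge.

By independence of `Z_t` from the past and `log r ≤ r - 1`, the limiting criterion is minimized
exactly at the parameters `θ` with `statVol θ = statVol θ₀` almost surely. Such an equality is a
linear relation between functions of `X_{t-1}, X_{t-2}, …`; its leading term would be determined by
the strict past, which is impossible unless it vanishes because `Z_t` is not concentrated at two
points. So the ARCH(∞) coefficients agree, and coprimality of the two polynomials yields `θ = θ₀`.

A local comparison takes the place of a uniform law of large numbers: near `θ₁ ≠ θ₀` the loss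
differences are dominated by a stationary sequence with negative mean, whose partial sums tend to
`-∞` by the maximal ergodic inequality, and finitely many such neighbourhoods cover `K` outside any
neighbourhood of `θ₀`.
-/

open scoped ENNReal

noncomputable section

/-! ### Birkhoff sums of a function with negative integral -/

/-- The running maximum `max(0, S_1, …, S_n)` of the Birkhoff sums of `f`, through which the
maximal ergodic argument is run. -/
def birkhoffMax {α : Type*} (T : α → α) (f : α → ℝ) : ℕ → α → ℝ
  | 0 => fun _ => 0
  | n + 1 => fun x => max 0 (f x + birkhoffMax T f n (T x))

namespace birkhoffMax

variable {α : Type*} {T : α → α} {f : α → ℝ}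

theorem nonneg (n : ℕ) (x : α) : 0 ≤ birkhoffMax T f n x := by
  cases n with
  | zero => exact le_rfl
  | succ n => exact le_max_left _ _

theorem le_succ (n : ℕ) (x : α) : birkhoffMax T f n x ≤ birkhoffMax T f (n + 1) x := by
  induction n generalizing x with
  | zero => exact nonneg _ x
  | succ n ih => exact max_le_max le_rfl (add_le_add_right (ih (T x)) _)

theorem monotone (x : α) : Monotone fun n => birkhoffMax T f n x :=
  monotone_nat_of_le_succ fun n => le_succ n x

theorem birkhoffSum_le (n : ℕ) (x : α) : birkhoffSum T f n x ≤ birkhoffMax T f n x := by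
  induction n generalizing x with
  | zero => simp [birkhoffMax]
  | succ n ih =>
    rw [birkhoffSum_succ']
    exact (add_le_add_right (ih (T x)) _).trans (le_max_right _ _)

theorem succ_sub (n : ℕ) (x : α) :
    birkhoffMax T f (n + 1) x - birkhoffMax T f n (T x) =
      max (-birkhoffMax T f n (T x)) (f x) := by
  change max 0 (f x + birkhoffMax T f n (T x)) - _ = _
  rw [← max_sub_sub_right, zero_sub, add_sub_cancel_right]

theorem abs_succ_sub_le (n : ℕ) (x : α) :
    |birkhoffMax T f (n + 1) x - birkhoffMax T f n (T x)| ≤ |f x| := by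
  rw [succ_sub, abs_le]
  have h := nonneg (T := T) (f := f) n (T x)
  exact ⟨(neg_abs_le _).trans (le_max_right _ _),
    max_le ((neg_nonpos.2 h).trans (abs_nonneg _)) (le_abs_self _)⟩

theorem bddAbove_range_comp_iff (x : α) :
    BddAbove (Set.range fun n => birkhoffMax T f n (T x)) ↔
      BddAbove (Set.range fun n => birkhoffMax T f n x) := by
  constructor
  · rintro ⟨C, hC⟩
    refine ⟨max 0 (f x + C), ?_⟩
    rintro _ ⟨n, rfl⟩
    exact (le_succ n x).trans (max_le_max le_rfl (add_le_add_right (hC ⟨n, rfl⟩) _))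
  · rintro ⟨C, hC⟩
    refine ⟨C - f x, ?_⟩
    rintro _ ⟨n, rfl⟩
    exact le_sub_iff_add_le'.2 ((le_max_right _ _).trans (hC ⟨n + 1, rfl⟩))

theorem tendsto_succ_sub {x : α}
    (hx : ¬ BddAbove (Set.range fun n => birkhoffMax T f n x)) :
    Tendsto (fun n => birkhoffMax T f (n + 1) x - birkhoffMax T f n (T x)) atTop (𝓝 (f x)) := by
  have htop : Tendsto (fun n => birkhoffMax T f n (T x)) atTop atTop :=
    tendsto_atTop_atTop_of_monotone (monotone (T x)) fun b => by
      obtain ⟨_, ⟨n, rfl⟩, hn⟩ := not_bddAbove_iff.1 (mt (bddAbove_range_comp_iff x).1 hx) b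
      exact ⟨n, hn.le⟩
  refine tendsto_const_nhds.congr' ?_
  filter_upwards [htop.eventually_ge_atTop (-f x)] with n hn
  rw [succ_sub, max_eq_right (neg_le.1 hn)]

variable [MeasurableSpace α] {ν : Measure α}

theorem measurable (hT : Measurable T) (hf : Measurable f) (n : ℕ) :
    Measurable (birkhoffMax T f n) := by
  induction n with
  | zero => exact measurable_const
  | succ n ih => exact measurable_const.max (hf.add (ih.comp hT))

theorem integrable (hT : MeasurePreserving T ν ν) (hf : Integrable f ν) (n : ℕ) :
    Integrable (birkhoffMax T f n) ν := by
  induction n with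
  | zero => exact integrable_zero α ℝ ν
  | succ n ih =>
    exact (integrable_zero α ℝ ν).sup (hf.add (hT.integrable_comp_of_integrable ih))

theorem integral_succ_sub_nonneg (hT : MeasurePreserving T ν ν) (hf : Integrable f ν) (n : ℕ) :
    0 ≤ ∫ x, (birkhoffMax T f (n + 1) x - birkhoffMax T f n (T x)) ∂ν := by
  have hint := integrable hT hf
  have hcomp : ∫ x, birkhoffMax T f n (T x) ∂ν = ∫ x, birkhoffMax T f n x ∂ν := by
    rw [← integral_map hT.aemeasurable (by rw [hT.map_eq]; exact (hint n).aestronglyMeasurable),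
      hT.map_eq]
  rw [integral_sub (hint (n + 1)) (g := fun x => birkhoffMax T f n (T x))
    (hT.integrable_comp_of_integrable (hint n)), hcomp, sub_nonneg]
  exact integral_mono (hint n) (hint (n + 1)) fun x => le_succ n x

theorem integral_nonneg_of_ae_not_bddAbove (hT : MeasurePreserving T ν ν) (hfm : Measurable f)
    (hf : Integrable f ν)
    (hunb : ∀ᵐ x ∂ν, ¬ BddAbove (Set.range fun n => birkhoffMax T f n x)) :
    0 ≤ ∫ x, f x ∂ν := by
  have hM := measurable hT.measurable hfm
  have hconv := tendsto_integral_of_dominated_convergence (fun x => |f x|)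
    (fun n => ((hM (n + 1)).sub ((hM n).comp hT.measurable)).aestronglyMeasurable)
    hf.abs (fun n => ae_of_all _ fun x => abs_succ_sub_le n x)
    (hunb.mono fun x hx => tendsto_succ_sub hx)
  exact ge_of_tendsto' hconv fun n => integral_succ_sub_nonneg hT hf n

end birkhoffMax

theorem ae_bddAbove_birkhoffSum_of_integral_neg {α : Type*} [MeasurableSpace α] {T : α → α}
    {ν : Measure α} (hT : Ergodic T ν) {f : α → ℝ} (hfm : Measurable f) (hf : Integrable f ν)
    (hneg : ∫ x, f x ∂ν < 0) :
    ∀ᵐ x ∂ν, BddAbove (Set.range fun n => birkhoffSum T f n x) := by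
  have hmeas : MeasurableSet {x | BddAbove (Set.range fun n => birkhoffMax T f n x)} :=
    measurableSet_bddAbove_range (birkhoffMax.measurable hT.measurable hfm)
  have hbdd : ∀ᵐ x ∂ν, BddAbove (Set.range fun n => birkhoffMax T f n x) := by
    rcases hT.ae_mem_or_ae_notMem hmeas
      (Set.ext fun x => birkhoffMax.bddAbove_range_comp_iff x) with h | h
    · exact h
    · exact absurd (birkhoffMax.integral_nonneg_of_ae_not_bddAbove hT.toMeasurePreserving hfm hf h)
        hneg.not_ge
  filter_upwards [hbdd] with x ⟨C, hC⟩
  refine ⟨C, ?_⟩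
  rintro _ ⟨n, rfl⟩
  exact (birkhoffMax.birkhoffSum_le n x).trans (hC ⟨n, rfl⟩)

/-! ### Ergodicity of stationary sequences adapted to an independent noise -/

/-- The translation by `h` on two-sided sequences; strict stationarity is invariance of the law
of the path under all `pathShift h`. -/
def pathShift {E : Type*} (h : ℤ) (w : ℤ → E) : ℤ → E := fun t => w (t + h)

theorem measurable_pathShift {E : Type*} [MeasurableSpace E] (h : ℤ) :
    Measurable (pathShift (E := E) h) :=
  measurable_pi_lambda _ fun t => measurable_pi_apply (t + h)

theorem pathShift_zero {E : Type*} (w : ℤ → E) : pathShift 0 w = w :=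
  funext fun t => congrArg w (add_zero t)

theorem pathShift_iterate {E : Type*} (h : ℤ) (n : ℕ) :
    (pathShift (E := E) h)^[n] = pathShift (n * h) := by
  induction n with
  | zero => ext w t; simp [pathShift]
  | succ n ih =>
    ext w t
    rw [Function.iterate_succ_apply, ih]
    simp only [pathShift]
    congr 1
    push_cast
    ring

theorem preimage_pathShift_neg {E : Type*} {A : Set (ℤ → E)} (hA : pathShift 1 ⁻¹' A = A) (n : ℕ) :
    pathShift (-n : ℤ) ⁻¹' A = A := by
  have hinv : Function.IsFixedPt (Set.preimage (pathShift (-1))) A := by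
    have hcomp : pathShift (E := E) 1 ∘ pathShift (-1) = id := by ext w t; simp [pathShift]
    change pathShift (-1) ⁻¹' A = A
    rw [← hA, ← Set.preimage_comp, hcomp, Set.preimage_id, hA]
  simpa [pathShift_iterate] using (hinv.preimage_iterate n).eq

/-- The σ-field generated by the noise after time `t`, the complement of `noisePast Z t`. -/
@[reducible] def noiseFuture {Ω : Type*} (Z : ℤ → Ω → ℝ) (t : ℤ) : MeasurableSpace Ω :=
  ⨆ k : {k : ℤ // t < k}, MeasurableSpace.comap (Z k) inferInstance

section noise

variable {Ω : Type*} {Z : ℤ → Ω → ℝ}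

theorem noisePast_mono : Monotone (noisePast Z) := fun _ t hst =>
  iSup_le fun k => le_iSup (fun k : {k : ℤ // k ≤ t} => MeasurableSpace.comap (Z k) inferInstance)
    ⟨k, k.2.trans hst⟩

theorem measurable_noisePast {t k : ℤ} (h : k ≤ t) : Measurable[noisePast Z t] (Z k) :=
  (comap_measurable (Z k)).mono
    (le_iSup (fun k : {k : ℤ // k ≤ t} => MeasurableSpace.comap (Z k) inferInstance) ⟨k, h⟩) le_rfl

theorem measurable_noiseFuture {t k : ℤ} (h : t < k) : Measurable[noiseFuture Z t] (Z k) :=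
  (comap_measurable (Z k)).mono
    (le_iSup (fun k : {k : ℤ // t < k} => MeasurableSpace.comap (Z k) inferInstance) ⟨k, h⟩) le_rfl

theorem limsup_comap_atBot_eq :
    limsup (fun k => MeasurableSpace.comap (Z k) inferInstance) atBot = ⨅ t, noisePast Z t := by
  rw [atBot_basis.limsup_eq_iInf_iSup]
  simp only [iInf_true, noisePast, iSup_subtype, Set.mem_Iic]

variable [MeasurableSpace Ω] {μ : Measure Ω}

theorem indep_noisePast_noiseFuture (hZm : ∀ t, Measurable (Z t)) (hZ : iIndepFun Z μ) (t : ℤ) :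
    Indep (noisePast Z t) (noiseFuture Z t) μ := by
  have h := indep_iSup_of_disjoint (fun i => (hZm i).comap_le) hZ
    (S := Set.Iic t) (T := Set.Ioi t) (Set.Iic_disjoint_Ioi le_rfl)
  rw [iSup_subtype', iSup_subtype'] at h
  exact h

/-- By Borel–Cantelli such an event agrees almost surely with an event of the remote past, to which
Kolmogorov's zero-one law applies. -/
theorem measure_eq_zero_or_one_of_approx_noisePast (hZm : ∀ t, Measurable (Z t))
    (hZ : iIndepFun Z μ) {A : Set Ω}
    (happ : ∀ t : ℤ, ∀ ε > 0, ∃ D, MeasurableSet[noisePast Z t] D ∧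
      μ (symmDiff A D) ≤ ENNReal.ofReal ε) :
    μ A = 0 ∨ μ A = 1 := by
  choose D hD hAD using fun n : ℕ => happ (-n) ((1 / 2) ^ n) (by positivity)
  have htail : MeasurableSet[limsup (fun k => MeasurableSpace.comap (Z k) inferInstance) atBot]
      (limsup D atTop) := by
    rw [limsup_comap_atBot_eq, MeasurableSpace.measurableSet_iInf]
    intro t
    rw [← limsup_nat_add D (-t).toNat]
    refine @MeasurableSet.measurableSet_limsup _ (noisePast Z t) _ fun n => ?_
    exact noisePast_mono (by have := Int.self_le_toNat (-t); push_cast; linarith) _ (hD _)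
  have hae : ∀ᵐ ω ∂μ, ω ∈ A ↔ ω ∈ limsup D atTop := by
    have hsum : ∑' n, μ (symmDiff A (D n)) ≠ ⊤ :=
      ((ENNReal.tsum_le_tsum hAD).trans_lt
        summable_geometric_two.tsum_ofReal_lt_top).ne
    filter_upwards [ae_eventually_notMem hsum] with ω hω
    have hmem : ∀ᶠ n in atTop, ω ∈ D n ↔ ω ∈ A := hω.mono fun n hn => by
      simp only [Set.mem_symmDiff] at hn
      tauto
    rw [mem_limsup_iff_frequently_mem, frequently_congr hmem, frequently_const]
  rw [measure_congr (eventuallyEq_set.2 hae)]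
  exact measure_zero_or_one_of_measurableSet_limsup_atBot (fun k => (hZm k).comap_le) hZ htail

variable {E : Type*} [MeasurableSpace E] {V : ℤ → Ω → E}

theorem IsStrictlyStationary.measurePreserving_pathShift (hV : IsStrictlyStationary μ V)
    (hVm : ∀ t, Measurable (V t)) (h : ℤ) :
    MeasurePreserving (pathShift h) (μ.map fun ω t => V t ω) (μ.map fun ω t => V t ω) := by
  refine ⟨measurable_pathShift h, ?_⟩
  rw [Measure.map_map (measurable_pathShift h) (measurable_pi_lambda _ hVm)]
  exact (hV h).map_eq

theorem exists_noisePast_ae_eq_cylinder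
    (had : ∀ t, ∃ f : Ω → E, Measurable[noisePast Z t] f ∧ V t =ᵐ[μ] f) {s : Finset ℤ}
    {S : Set (s → E)} (hS : MeasurableSet S) (t : ℤ) :
    ∃ n : ℕ, ∃ D, MeasurableSet[noisePast Z t] D ∧
      {ω | pathShift (-n : ℤ) (fun k => V k ω) ∈ cylinder s S} =ᵐ[μ] D := by
  choose f hfm hf using had
  obtain ⟨M, hM⟩ := s.bddAbove
  have hle : ∀ k ∈ s, k - (M - t).toNat ≤ t := fun k hk => by
    have := hM hk
    have := Int.self_le_toNat (M - t)
    linarith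
  refine ⟨(M - t).toNat, {ω | (fun k : s => f (k.1 - (M - t).toNat) ω) ∈ S}, ?_, ?_⟩
  · have hmeas : Measurable[noisePast Z t] fun ω (k : s) => f (k.1 - (M - t).toNat) ω :=
      @measurable_pi_lambda _ _ _ (noisePast Z t) _ _ fun k =>
        (hfm _).mono (noisePast_mono (hle k.1 k.2)) le_rfl
    exact hmeas hS
  · filter_upwards [ae_all_iff.2 hf] with ω hω
    have hrestrict : s.restrict (pathShift (-(M - t).toNat : ℤ) fun k => V k ω) =
        fun k : s => f (k.1 - (M - t).toNat) ω := by
      funext k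
      simp only [Finset.restrict, pathShift, hω, sub_eq_add_neg]
    exact congrArg (· ∈ S) hrestrict

variable [IsProbabilityMeasure μ]

theorem exists_noisePast_symmDiff_le (hVm : ∀ t, Measurable (V t)) (hV : IsStrictlyStationary μ V)
    (had : ∀ t, ∃ f : Ω → E, Measurable[noisePast Z t] f ∧ V t =ᵐ[μ] f) {A : Set (ℤ → E)}
    (hA : MeasurableSet A) (hinv : pathShift 1 ⁻¹' A = A) (t : ℤ) {ε : ℝ} (hε : 0 < ε) :
    ∃ D, MeasurableSet[noisePast Z t] D ∧
      μ (symmDiff ((fun ω t => V t ω) ⁻¹' A) D) ≤ ENNReal.ofReal ε := by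
  have hΦ : Measurable fun ω t => V t ω := measurable_pi_lambda _ hVm
  set Φ : Ω → ℤ → E := fun ω t => V t ω
  have : IsProbabilityMeasure (μ.map Φ) := Measure.isProbabilityMeasure_map hΦ.aemeasurable
  obtain ⟨C, hC, hAC⟩ := (Measure.MeasureDense.of_generateFrom_isSetAlgebra_finite (μ := μ.map Φ)
    (isSetAlgebra_measurableCylinders (α := fun _ : ℤ => E))
    generateFrom_measurableCylinders.symm).approx A hA (measure_ne_top _ _) ε hε
  have hACm := hA.symmDiff (MeasurableSet.of_mem_measurableCylinders hC)
  obtain ⟨s, S, hS, rfl⟩ := (mem_measurableCylinders _).1 hC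
  obtain ⟨n, D, hD, hCD⟩ := exists_noisePast_ae_eq_cylinder had hS t
  refine ⟨D, hD, ?_⟩
  calc μ (symmDiff (Φ ⁻¹' A) D)
      = μ (symmDiff (Φ ⁻¹' A) (Φ ⁻¹' (pathShift (-n : ℤ) ⁻¹' cylinder s S))) :=
        measure_congr ((ae_eq_refl _).symmDiff hCD.symm)
    _ = μ (Φ ⁻¹' (pathShift (-n : ℤ) ⁻¹' symmDiff A (cylinder s S))) := by
        rw [Set.preimage_symmDiff (f := pathShift _), preimage_pathShift_neg hinv n,
          Set.preimage_symmDiff]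
    _ = μ.map Φ (symmDiff A (cylinder s S)) := by
        rw [← Measure.map_apply hΦ (measurable_pathShift _ hACm),
          (hV.measurePreserving_pathShift hVm _).measure_preimage hACm.nullMeasurableSet]
    _ ≤ ENNReal.ofReal ε := hAC.le

theorem IsStrictlyStationary.ergodic_pathShift (hV : IsStrictlyStationary μ V)
    (hZm : ∀ t, Measurable (Z t)) (hZ : iIndepFun Z μ) (hVm : ∀ t, Measurable (V t))
    (had : ∀ t, ∃ f : Ω → E, Measurable[noisePast Z t] f ∧ V t =ᵐ[μ] f) :
    Ergodic (pathShift 1) (μ.map fun ω t => V t ω) := by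
  have hΦ : Measurable fun ω t => V t ω := measurable_pi_lambda _ hVm
  have : IsProbabilityMeasure (μ.map fun ω t => V t ω) :=
    Measure.isProbabilityMeasure_map hΦ.aemeasurable
  refine ⟨hV.measurePreserving_pathShift hVm 1, ⟨fun A hA hinv => ?_⟩⟩
  have h01 := measure_eq_zero_or_one_of_approx_noisePast hZm hZ fun t ε hε =>
    exists_noisePast_symmDiff_le hVm hV had hA hinv t hε
  rw [← Measure.map_apply hΦ hA] at h01
  exact eventuallyConst_set'.2 (h01.imp ae_eq_empty.2 fun h =>
    (ae_eq_univ_iff_measure_eq hA.nullMeasurableSet).2 (by rw [h, measure_univ]))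

end noise

theorem ae_bddAbove_sum_pathShift {Ω E : Type*} [MeasurableSpace Ω] [MeasurableSpace E]
    {μ : Measure Ω} {V : ℤ → Ω → E} (hVm : ∀ t, Measurable (V t))
    (hV : Ergodic (pathShift 1) (μ.map fun ω t => V t ω)) {f : (ℤ → E) → ℝ} (hfm : Measurable f)
    (hf : Integrable (fun ω => f fun t => V t ω) μ) (hneg : ∫ ω, f (fun t => V t ω) ∂μ < 0) :
    ∀ᵐ ω ∂μ, ∃ C, ∀ n : ℕ, ∑ k ∈ Finset.range n, f (pathShift k fun t => V t ω) ≤ C := by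
  have hΦ : Measurable fun ω t => V t ω := measurable_pi_lambda _ hVm
  have hbdd := ae_bddAbove_birkhoffSum_of_integral_neg hV hfm
    ((integrable_map_measure hfm.aestronglyMeasurable hΦ.aemeasurable).2 hf)
    (by rwa [integral_map hΦ.aemeasurable hfm.aestronglyMeasurable])
  filter_upwards [ae_of_ae_map hΦ.aemeasurable hbdd] with ω ⟨C, hC⟩
  refine ⟨C, fun n => ?_⟩
  simpa only [birkhoffSum, pathShift_iterate, mul_one] using hC ⟨n, rfl⟩

/-! ### Discrete Volterra equations -/

theorem prod_range_one_add_eq (C : ℕ → ℝ) (n : ℕ) : ∏ u ∈ Finset.range n, (1 + C u) =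
    1 + ∑ u ∈ Finset.range n, C u * ∏ v ∈ Finset.range u, (1 + C v) := by
  induction n with
  | zero => simp
  | succ n ih =>
    rw [Finset.prod_range_succ, Finset.sum_range_succ, ← add_assoc, ← ih]
    ring

/-- The solution `x` of the equation `x n = b n + ∑ u < n, K n u * x u`, in which a linear
recursion with random coefficients started at time zero is written. -/
def volterra (K : ℕ → ℕ → ℝ) (b : ℕ → ℝ) (n : ℕ) : ℝ :=
  b n + ∑ u : Fin n, K n u * volterra K b u
termination_by n
decreasing_by exact u.2

namespace volterra

variable {K : ℕ → ℕ → ℝ} {b : ℕ → ℝ}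

theorem eq_add_sum (n : ℕ) :
    volterra K b n = b n + ∑ u ∈ Finset.range n, K n u * volterra K b u := by
  rw [volterra, Finset.sum_range (fun u => K n u * volterra K b u)]

theorem eq_of_eq {x : ℕ → ℝ}
    (hx : ∀ n, x n = b n + ∑ u ∈ Finset.range n, K n u * x u) (n : ℕ) :
    x n = volterra K b n := by
  induction n using Nat.strong_induction_on with
  | _ n ih =>
    rw [eq_add_sum, hx n]
    congr 1
    exact Finset.sum_congr rfl fun u hu => by rw [ih u (Finset.mem_range.1 hu)]

theorem mul_add_mul (r r' : ℝ) (b' : ℕ → ℝ) (n : ℕ) :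
    r * volterra K b n + r' * volterra K b' n = volterra K (fun k => r * b k + r' * b' k) n := by
  refine eq_of_eq (x := fun n => r * volterra K b n + r' * volterra K b' n) (fun n => ?_) n
  rw [eq_add_sum, eq_add_sum (b := b'), mul_add, mul_add, Finset.mul_sum, Finset.mul_sum,
    add_add_add_comm, ← Finset.sum_add_distrib]
  congr 1
  exact Finset.sum_congr rfl fun u _ => by ring

theorem nonneg (hK : ∀ n u, 0 ≤ K n u) (hb : ∀ n, 0 ≤ b n) (n : ℕ) : 0 ≤ volterra K b n := by
  induction n using Nat.strong_induction_on with
  | _ n ih =>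
    rw [eq_add_sum]
    exact add_nonneg (hb n) (Finset.sum_nonneg fun u hu =>
      mul_nonneg (hK n u) (ih u (Finset.mem_range.1 hu)))

theorem le_of_le {x : ℕ → ℝ} (hK : ∀ n u, 0 ≤ K n u)
    (hx : ∀ n, x n ≤ b n + ∑ u ∈ Finset.range n, K n u * x u) (n : ℕ) :
    x n ≤ volterra K b n := by
  induction n using Nat.strong_induction_on with
  | _ n ih =>
    rw [eq_add_sum]
    refine (hx n).trans (add_le_add_right (Finset.sum_le_sum fun u hu => ?_) _)
    exact mul_le_mul_of_nonneg_left (ih u (Finset.mem_range.1 hu)) (hK n u)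

theorem le_of_ge {x : ℕ → ℝ} (hK : ∀ n u, 0 ≤ K n u)
    (hx : ∀ n, b n + ∑ u ∈ Finset.range n, K n u * x u ≤ x n) (n : ℕ) :
    volterra K b n ≤ x n := by
  induction n using Nat.strong_induction_on with
  | _ n ih =>
    rw [eq_add_sum]
    refine (add_le_add_right (Finset.sum_le_sum fun u hu => ?_) _).trans (hx n)
    exact mul_le_mul_of_nonneg_left (ih u (Finset.mem_range.1 hu)) (hK n u)

theorem le_prod {C : ℕ → ℝ} {B : ℝ} (hK : ∀ n u, 0 ≤ K n u) (hKC : ∀ n u, K n u ≤ C u)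
    (hb : ∀ n, b n ≤ B) (hB : 0 ≤ B) (n : ℕ) :
    volterra K b n ≤ B * ∏ u ∈ Finset.range n, (1 + C u) := by
  have hprod : ∀ u, 0 ≤ ∏ v ∈ Finset.range u, (1 + C v) := fun u =>
    Finset.prod_nonneg fun v _ => add_nonneg zero_le_one ((hK 0 v).trans (hKC 0 v))
  refine le_of_ge (x := fun n => B * ∏ u ∈ Finset.range n, (1 + C u)) hK (fun n => ?_) n
  rw [prod_range_one_add_eq C n, mul_add, mul_one, Finset.mul_sum]
  refine add_le_add (hb n) (Finset.sum_le_sum fun u _ => ?_)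
  rw [mul_left_comm]
  exact mul_le_mul_of_nonneg_left (mul_le_mul_of_nonneg_right (hKC n u) (hprod u)) hB

theorem measurable {Ω : Type*} [MeasurableSpace Ω] {K : Ω → ℕ → ℕ → ℝ} {b : ℕ → ℝ}
    (hK : ∀ n, ∀ u < n, Measurable fun ω => K ω n u) (n : ℕ) :
    Measurable fun ω => volterra (K ω) b n := by
  induction n using Nat.strong_induction_on with
  | _ n ih =>
    rw [funext fun ω => eq_add_sum (K := K ω) (b := b) n]
    exact measurable_const.add (Finset.measurable_sum _ fun u hu =>
      (hK n u (Finset.mem_range.1 hu)).mul (ih u (Finset.mem_range.1 hu)))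

end volterra

/-! ### Positive linear recursions -/

/-- A nonnegative two-sided solution of
`s t = a + ∑ i < m, c i (t - 1 - i) * s (t - 1 - i)` with `a > 0` and nonnegative coefficients: the
form taken by the squared volatility once the observations are expressed through the noise.
The second argument of `c` is the time of the value which the coefficient multiplies. -/
structure IsPosRecursion (m : ℕ) (a : ℝ) (c : ℕ → ℤ → ℝ) (s : ℤ → ℝ) : Prop where
  pos_order : 0 < m
  pos_const : 0 < a
  coeff_nonneg : ∀ i t, 0 ≤ c i t
  coeff_eq_zero : ∀ i t, m ≤ i → c i t = 0
  sol_nonneg : ∀ t, 0 ≤ s t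
  sol_eq : ∀ t, s t = a + ∑ i ∈ Finset.range m, c i (t - 1 - i) * s (t - 1 - i)

/-- The Volterra kernel of the recursion with coefficients `c` started at time zero. It is only
evaluated at `u < n`, where the subtraction is not truncated. -/
def recKernel (c : ℕ → ℤ → ℝ) (n u : ℕ) : ℝ := c (n - 1 - u) u

/-- The sum of the coefficients which multiply the value at time `t`. -/
def coeffSum (m : ℕ) (c : ℕ → ℤ → ℝ) (t : ℤ) : ℝ := ∑ i ∈ Finset.range m, c i t

/-- The total weight carried by the last `m` values before time `t`; it dominates their
contribution to all later values of the recursion. -/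
def lagSum (m : ℕ) (c : ℕ → ℤ → ℝ) (s : ℤ → ℝ) (t : ℤ) : ℝ :=
  ∑ l ∈ Finset.range m, coeffSum m c (t - 1 - l) * s (t - 1 - l)

/-- The version of `lagSum` for sequences indexed by `ℕ`, meaningful for `m ≤ n`. -/
def lagResp (m : ℕ) (c : ℕ → ℤ → ℝ) (x : ℕ → ℝ) (n : ℕ) : ℝ :=
  ∑ l ∈ Finset.range m, coeffSum m c ((n - 1 - l : ℕ) : ℤ) * x (n - 1 - l)

/-- The response at time `n` of the homogeneous recursion to unit impulses at `0, …, m - 1`. -/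
def impulseResp (m : ℕ) (c : ℕ → ℤ → ℝ) (n : ℕ) : ℝ :=
  volterra (recKernel c) (fun n => if n < m then 1 else 0) n

/-- The exponential rate at time `k` at which impulse responses decay relative to the solution `s`
of a positive recursion of order `m` with constant `a`. -/
def decayRate (m : ℕ) (a : ℝ) (s : ℤ → ℝ) (k : ℤ) : ℝ := a / (m * ∑ i ∈ Finset.range m, s (k + i))

theorem lagSum_eq_lagResp {m n : ℕ} {c : ℕ → ℤ → ℝ} {s : ℤ → ℝ} (hn : m ≤ n) :
    lagSum m c s n = lagResp m c (fun u => s u) n := by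
  refine Finset.sum_congr rfl fun l hl => ?_
  have hl := Finset.mem_range.1 hl
  rw [show (n : ℤ) - 1 - l = ((n - 1 - l : ℕ) : ℤ) by omega]

namespace IsPosRecursion

variable {m : ℕ} {a : ℝ} {c : ℕ → ℤ → ℝ} {s : ℤ → ℝ}

theorem le_sol (h : IsPosRecursion m a c s) (t : ℤ) : a ≤ s t := by
  rw [h.sol_eq t]
  exact le_add_of_nonneg_right (Finset.sum_nonneg fun i _ =>
    mul_nonneg (h.coeff_nonneg _ _) (h.sol_nonneg _))

theorem sol_pos (h : IsPosRecursion m a c s) (t : ℤ) : 0 < s t :=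
  h.pos_const.trans_le (h.le_sol t)

theorem kernel_nonneg (h : IsPosRecursion m a c s) (n u : ℕ) : 0 ≤ recKernel c n u :=
  h.coeff_nonneg _ _

theorem coeffSum_nonneg (h : IsPosRecursion m a c s) (t : ℤ) : 0 ≤ coeffSum m c t :=
  Finset.sum_nonneg fun i _ => h.coeff_nonneg i t

theorem coeff_le_coeffSum (h : IsPosRecursion m a c s) (i : ℕ) (t : ℤ) :
    c i t ≤ coeffSum m c t := by
  rcases lt_or_ge i m with hi | hi
  · exact Finset.single_le_sum (f := fun i => c i t) (fun j _ => h.coeff_nonneg j t)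
      (Finset.mem_range.2 hi)
  · rw [h.coeff_eq_zero i t hi]
    exact h.coeffSum_nonneg t

theorem lagSum_nonneg (h : IsPosRecursion m a c s) (t : ℤ) : 0 ≤ lagSum m c s t :=
  Finset.sum_nonneg fun _ _ => mul_nonneg (h.coeffSum_nonneg _) (h.sol_nonneg _)

theorem lagResp_nonneg (h : IsPosRecursion m a c s) {x : ℕ → ℝ} (hx : ∀ k, 0 ≤ x k) (n : ℕ) :
    0 ≤ lagResp m c x n :=
  Finset.sum_nonneg fun _ _ => mul_nonneg (h.coeffSum_nonneg _) (hx _)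

theorem lagResp_mono (h : IsPosRecursion m a c s) {x y : ℕ → ℝ} {n : ℕ} (hxy : ∀ u, x u ≤ y u) :
    lagResp m c x n ≤ lagResp m c y n :=
  Finset.sum_le_sum fun _ _ => mul_le_mul_of_nonneg_left (hxy _) (h.coeffSum_nonneg _)

theorem impulseResp_nonneg (h : IsPosRecursion m a c s) (n : ℕ) : 0 ≤ impulseResp m c n :=
  volterra.nonneg h.kernel_nonneg (fun n => by split_ifs <;> norm_num) n

/-- The last sum collects the contribution of the negative times. -/
theorem sol_natCast_eq (h : IsPosRecursion m a c s) (n : ℕ) :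
    s n = a + ∑ u ∈ Finset.range n, recKernel c n u * s u +
      ∑ l ∈ Finset.range m, c (n + l) (-1 - l) * s (-1 - l) := by
  have hextend : ∑ i ∈ Finset.range m, c i ((n : ℤ) - 1 - i) * s ((n : ℤ) - 1 - i) =
      ∑ i ∈ Finset.range (n + m), c i ((n : ℤ) - 1 - i) * s ((n : ℤ) - 1 - i) :=
    Finset.sum_subset (Finset.range_mono (Nat.le_add_left m n)) fun i _ hi => by
      rw [h.coeff_eq_zero i _ (not_lt.1 (mt Finset.mem_range.2 hi)), zero_mul]
  rw [h.sol_eq n, hextend, Finset.sum_range_add, ← Finset.sum_range_reflect, add_assoc]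
  congr 2
  · refine Finset.sum_congr rfl fun u hu => ?_
    have hu := Finset.mem_range.1 hu
    rw [show (n : ℤ) - 1 - ((n - 1 - u : ℕ) : ℤ) = u by omega, recKernel]
  · refine Finset.sum_congr rfl fun l _ => ?_
    rw [show (n : ℤ) - 1 - ((n + l : ℕ) : ℤ) = -1 - l by push_cast; ring]

theorem sum_kernel_le (h : IsPosRecursion m a c s) (n : ℕ) :
    ∑ u ∈ Finset.range n, recKernel c n u * s u ≤ s n - a := by
  have hneg : 0 ≤ ∑ l ∈ Finset.range m, c (n + l) (-1 - l) * s (-1 - l) :=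
    Finset.sum_nonneg fun _ _ => mul_nonneg (h.coeff_nonneg _ _) (h.sol_nonneg _)
  linarith [h.sol_natCast_eq n]

theorem sol_le (h : IsPosRecursion m a c s) (n : ℕ) :
    s n ≤ a * volterra (recKernel c) (fun _ => 1) n + impulseResp m c n * lagSum m c s 0 := by
  rw [mul_comm (impulseResp m c n), impulseResp, volterra.mul_add_mul]
  refine volterra.le_of_le (x := fun n : ℕ => s n) h.kernel_nonneg (fun n => ?_) n
  rw [h.sol_natCast_eq n, add_right_comm, mul_one]
  gcongr
  rcases lt_or_ge n m with hn | hn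
  · rw [if_pos hn, mul_one, lagSum]
    simp only [zero_sub]
    exact Finset.sum_le_sum fun l _ =>
      mul_le_mul_of_nonneg_right (h.coeff_le_coeffSum _ _) (h.sol_nonneg _)
  · rw [if_neg hn.not_gt, mul_zero]
    refine (Finset.sum_eq_zero fun l _ => ?_).le
    rw [h.coeff_eq_zero _ _ (hn.trans (Nat.le_add_right n l)), zero_mul]

theorem lagSum_le (h : IsPosRecursion m a c s) {n : ℕ} (hn : m ≤ n) :
    lagSum m c s n ≤ a * lagResp m c (volterra (recKernel c) fun _ => 1) n +
      lagResp m c (impulseResp m c) n * lagSum m c s 0 := by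
  rw [lagSum_eq_lagResp hn]
  refine (h.lagResp_mono h.sol_le).trans_eq ?_
  simp only [lagResp, Finset.mul_sum, Finset.sum_mul, ← Finset.sum_add_distrib]
  exact Finset.sum_congr rfl fun l _ => by ring

theorem lagResp_le_prod (h : IsPosRecursion m a c s) {x : ℕ → ℝ} {n : ℕ} (hn : m ≤ n)
    (hx : ∀ k, x k ≤ ∏ u ∈ Finset.range k, (1 + coeffSum m c u)) :
    lagResp m c x n ≤ ∏ u ∈ Finset.range n, (1 + coeffSum m c u) := by
  have hprod : ∀ k : ℕ, 0 ≤ ∏ v ∈ Finset.range k, (1 + coeffSum m c v) := fun k =>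
    Finset.prod_nonneg fun v _ => add_nonneg zero_le_one (h.coeffSum_nonneg v)
  calc lagResp m c x n
      ≤ lagResp m c (fun k => ∏ u ∈ Finset.range k, (1 + coeffSum m c u)) n := h.lagResp_mono hx
    _ ≤ ∑ u ∈ Finset.range n, coeffSum m c u * ∏ v ∈ Finset.range u, (1 + coeffSum m c v) := by
        rw [← Finset.sum_range_reflect]
        exact Finset.sum_le_sum_of_subset_of_nonneg (Finset.range_mono hn) fun u _ _ =>
          mul_nonneg (h.coeffSum_nonneg _) (hprod _)
    _ ≤ ∏ u ∈ Finset.range n, (1 + coeffSum m c u) := by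
        rw [prod_range_one_add_eq (fun u : ℕ => coeffSum m c u)]
        exact le_add_of_nonneg_left zero_le_one

theorem lagResp_volterra_le_prod (h : IsPosRecursion m a c s) {b : ℕ → ℝ} (hb : ∀ k, b k ≤ 1)
    {n : ℕ} (hn : m ≤ n) :
    lagResp m c (volterra (recKernel c) b) n ≤ ∏ u ∈ Finset.range n, (1 + coeffSum m c u) :=
  h.lagResp_le_prod hn fun k => by
    simpa only [one_mul] using volterra.le_prod (C := fun u : ℕ => coeffSum m c u)
      h.kernel_nonneg (fun n u => h.coeff_le_coeffSum _ _) hb zero_le_one k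

theorem decayRate_pos (h : IsPosRecursion m a c s) (k : ℤ) : 0 < decayRate m a s k :=
  div_pos h.pos_const (mul_pos (Nat.cast_pos.2 h.pos_order)
    (Finset.sum_pos (fun _ _ => h.sol_pos _) (Finset.nonempty_range_iff.2 h.pos_order.ne')))

theorem decayRate_le (h : IsPosRecursion m a c s) (k : ℤ) {i : ℕ} (hi : i < m) :
    decayRate m a s k ≤ a / s (k + i) / m := by
  have hm : (0 : ℝ) < m := Nat.cast_pos.2 h.pos_order
  rw [div_div, mul_comm]
  refine div_le_div_of_nonneg_left h.pos_const.le (mul_pos hm (h.sol_pos _)) ?_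
  exact mul_le_mul_of_nonneg_left (Finset.single_le_sum (f := fun i : ℕ => s (k + i))
    (fun _ _ => h.sol_nonneg _) (Finset.mem_range.2 hi)) hm.le

theorem decayRate_le_one (h : IsPosRecursion m a c s) (k : ℤ) : decayRate m a s k ≤ 1 :=
  (h.decayRate_le k h.pos_order).trans (div_le_one_of_le₀
    ((div_le_one_of_le₀ (h.le_sol _) (h.sol_nonneg _)).trans
      (by exact_mod_cast Nat.one_le_iff_ne_zero.2 h.pos_order.ne')) (Nat.cast_nonneg m))

theorem sum_Ico_decayRate_le (h : IsPosRecursion m a c s) (n : ℕ) :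
    ∑ k ∈ Finset.Ico (n + 1 - m) (n + 1), decayRate m a s k ≤ a / s n := by
  have hm : (0 : ℝ) < m := Nat.cast_pos.2 h.pos_order
  have hcard : ((Finset.Ico (n + 1 - m) (n + 1)).card : ℝ) ≤ m := by
    rw [Nat.card_Ico]
    exact_mod_cast (by omega : n + 1 - (n + 1 - m) ≤ m)
  have hterm : ∀ k ∈ Finset.Ico (n + 1 - m) (n + 1), decayRate m a s k ≤ a / s n / m := by
    intro k hk
    have hk := Finset.mem_Ico.1 hk
    have hle := h.decayRate_le k (i := n - k) (by omega)
    rwa [show (k : ℤ) + ((n - k : ℕ) : ℤ) = n by omega] at hle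
  calc ∑ k ∈ Finset.Ico (n + 1 - m) (n + 1), decayRate m a s k
      ≤ (Finset.Ico (n + 1 - m) (n + 1)).card * (a / s n / m) := by
        simpa only [nsmul_eq_mul] using Finset.sum_le_card_nsmul _ _ _ hterm
    _ ≤ m * (a / s n / m) := mul_le_mul_of_nonneg_right hcard
        (div_nonneg (div_nonneg h.pos_const.le (h.sol_nonneg n)) hm.le)
    _ = a / s n := mul_div_cancel₀ _ hm.ne'

theorem impulseResp_le_div (h : IsPosRecursion m a c s) (n : ℕ) : impulseResp m c n ≤ s n / a := by
  refine volterra.le_of_ge (x := fun n : ℕ => s n / a) h.kernel_nonneg (fun k => ?_) n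
  have hind : (if k < m then (1 : ℝ) else 0) ≤ 1 := by split_ifs <;> norm_num
  calc (if k < m then (1 : ℝ) else 0) + ∑ u ∈ Finset.range k, recKernel c k u * (s u / a)
      ≤ 1 + (s k - a) / a := by
        simp only [← mul_div_assoc, ← Finset.sum_div]
        exact add_le_add hind (div_le_div_of_nonneg_right (h.sum_kernel_le k) h.pos_const.le)
    _ = s k / a := by rw [sub_div, div_self h.pos_const.ne', add_sub_cancel]

theorem impulseResp_le_mul_exp (h : IsPosRecursion m a c s) {n : ℕ} (hn : m ≤ n) {D : ℝ}
    (hD : 0 ≤ D) (hlag : ∀ u < n, n - m ≤ u → impulseResp m c u ≤ D * s u) :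
    impulseResp m c n ≤ D * s n * Real.exp (-(a / s n)) := by
  have hterm : ∀ u ∈ Finset.range n,
      recKernel c n u * impulseResp m c u ≤ D * (recKernel c n u * s u) := by
    intro u hu
    rw [mul_left_comm]
    rcases lt_or_ge u (n - m) with hum | hum
    · rw [recKernel, h.coeff_eq_zero _ _ (by omega), zero_mul, zero_mul]
    · exact mul_le_mul_of_nonneg_left (hlag u (Finset.mem_range.1 hu) hum) (h.kernel_nonneg _ _)
  have hexp : s n - a ≤ s n * Real.exp (-(a / s n)) := by
    calc s n - a = s n * (-(a / s n) + 1) := by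
          rw [mul_add, mul_neg, mul_div_cancel₀ _ (h.sol_pos n).ne']; ring
      _ ≤ _ := mul_le_mul_of_nonneg_left (Real.add_one_le_exp _) (h.sol_nonneg n)
  calc impulseResp m c n = ∑ u ∈ Finset.range n, recKernel c n u * impulseResp m c u := by
        rw [impulseResp, volterra.eq_add_sum, if_neg hn.not_gt, zero_add]
        rfl
    _ ≤ D * ∑ u ∈ Finset.range n, recKernel c n u * s u := by
        rw [Finset.mul_sum]
        exact Finset.sum_le_sum hterm
    _ ≤ D * s n * Real.exp (-(a / s n)) := by
        rw [mul_assoc]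
        exact mul_le_mul_of_nonneg_left ((h.sum_kernel_le n).trans hexp) hD

theorem exp_neg_sum_decayRate_anti (h : IsPosRecursion m a c s) :
    Antitone fun n : ℕ => Real.exp (-∑ k ∈ Finset.range n, decayRate m a s k) := fun _ _ hle =>
  Real.exp_le_exp.2 (neg_le_neg (Finset.sum_le_sum_of_subset_of_nonneg (Finset.range_mono hle)
    fun _ _ _ => (h.decayRate_pos _).le))

theorem impulseResp_le (h : IsPosRecursion m a c s) (n : ℕ) :
    impulseResp m c n ≤ Real.exp 1 / a * s n *
      Real.exp (-∑ k ∈ Finset.range (n + 1), decayRate m a s k) := by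
  have hconst : 0 < Real.exp 1 / a := div_pos (Real.exp_pos 1) h.pos_const
  induction n using Nat.strong_induction_on with
  | _ n ih =>
  have hsum : ∑ k ∈ Finset.range (n + 1), decayRate m a s k ≤
      ∑ k ∈ Finset.range (n + 1 - m), decayRate m a s k + a / s n := by
    rw [← Finset.sum_range_add_sum_Ico _ (Nat.sub_le (n + 1) m)]
    exact add_le_add_right (h.sum_Ico_decayRate_le n) _
  rcases lt_or_ge n m with hn | hn
  · have hle : ∑ k ∈ Finset.range (n + 1), decayRate m a s k ≤ 1 := by
      rw [Nat.sub_eq_zero_of_le hn, Finset.sum_range_zero, zero_add] at hsum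
      exact hsum.trans (div_le_one_of_le₀ (h.le_sol n) (h.sol_nonneg n))
    calc impulseResp m c n ≤ s n / a := h.impulseResp_le_div n
      _ ≤ s n / a * Real.exp (1 + -∑ k ∈ Finset.range (n + 1), decayRate m a s k) :=
          le_mul_of_one_le_right (div_nonneg (h.sol_nonneg _) h.pos_const.le)
            (Real.one_le_exp (by linarith))
      _ = _ := by rw [Real.exp_add]; ring
  · set D := Real.exp 1 / a * Real.exp (-∑ k ∈ Finset.range (n + 1 - m), decayRate m a s k)
    have hlag : ∀ u < n, n - m ≤ u → impulseResp m c u ≤ D * s u := fun u hun hu =>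
      (ih u hun).trans (by
        rw [mul_right_comm]
        exact mul_le_mul_of_nonneg_right (mul_le_mul_of_nonneg_left
          (h.exp_neg_sum_decayRate_anti (by omega)) hconst.le) (h.sol_nonneg u))
    calc impulseResp m c n ≤ D * s n * Real.exp (-(a / s n)) :=
          h.impulseResp_le_mul_exp hn (by positivity) hlag
      _ = Real.exp 1 / a * s n *
          Real.exp (-(∑ k ∈ Finset.range (n + 1 - m), decayRate m a s k + a / s n)) := by
          rw [neg_add, Real.exp_add]; ring
      _ ≤ _ := mul_le_mul_of_nonneg_left (Real.exp_le_exp.2 (neg_le_neg hsum))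
          (mul_nonneg hconst.le (h.sol_nonneg _))

theorem lagResp_impulseResp_le_exp (h : IsPosRecursion m a c s) {n : ℕ} (hn : m ≤ n) :
    lagResp m c (impulseResp m c) n ≤ Real.exp 1 / a * lagSum m c s n *
      Real.exp (-∑ k ∈ Finset.range (n - m), decayRate m a s k) := by
  have hconst : 0 < Real.exp 1 / a := div_pos (Real.exp_pos 1) h.pos_const
  rw [lagSum_eq_lagResp hn, lagResp, lagResp, Finset.mul_sum, Finset.sum_mul]
  refine Finset.sum_le_sum fun l hl => ?_
  have hl := Finset.mem_range.1 hl
  rw [mul_left_comm, mul_assoc]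
  refine mul_le_mul_of_nonneg_left ((h.impulseResp_le _).trans ?_) (h.coeffSum_nonneg _)
  exact mul_le_mul_of_nonneg_left (h.exp_neg_sum_decayRate_anti (by omega))
    (mul_nonneg hconst.le (h.sol_nonneg _))

end IsPosRecursion

/-! ### Moment bounds -/

section moments

variable {Ω : Type*} [MeasurableSpace Ω] {μ : Measure Ω} [IsProbabilityMeasure μ]

theorem lintegral_min_mul_le_of_indepFun {f g : Ω → ℝ≥0∞} (hf : Measurable f)
    (hg : AEMeasurable g μ) (hindep : IndepFun f g μ) (M : ℝ≥0∞) :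
    ∫⁻ ω, min (f ω * g ω) M ∂μ ≤ ∫⁻ ω, min ((∫⁻ ω', f ω' ∂μ) * g ω) M ∂μ := by
  have hmin : Measurable fun z : ℝ≥0∞ × ℝ≥0∞ => min (z.1 * z.2) M :=
    (measurable_fst.mul measurable_snd).min measurable_const
  have hprod := (indepFun_iff_map_prod_eq_prod_map_map hf.aemeasurable hg).1 hindep
  have := Measure.isProbabilityMeasure_map (μ := μ) hf.aemeasurable
  calc ∫⁻ ω, min (f ω * g ω) M ∂μ
      = ∫⁻ z, min (z.1 * z.2) M ∂(μ.map fun ω => (f ω, g ω)) :=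
        (lintegral_map' hmin.aemeasurable (hf.aemeasurable.prodMk hg)).symm
    _ = ∫⁻ y, ∫⁻ x, min (x * y) M ∂(μ.map f) ∂(μ.map g) := by
        rw [hprod, lintegral_prod_symm' _ hmin]
    _ ≤ ∫⁻ y, min ((∫⁻ ω', f ω' ∂μ) * y) M ∂(μ.map g) := by
        refine lintegral_mono fun y => le_min ?_ ?_
        · refine (lintegral_mono fun x => min_le_left _ _).trans_eq ?_
          rw [lintegral_mul_const _ measurable_id', lintegral_map measurable_id' hf]
        · exact (lintegral_mono fun x => min_le_right _ _).trans_eq (by simp)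
    _ = ∫⁻ ω, min ((∫⁻ ω', f ω' ∂μ) * g ω) M ∂μ :=
        lintegral_map' (f := fun y => min ((∫⁻ ω', f ω' ∂μ) * y) M)
          ((measurable_const.mul measurable_id).min measurable_const).aemeasurable hg

theorem one_sub_mul_lintegral_le_of_lintegral_min_le {W : Ω → ℝ≥0∞} (hW : AEMeasurable W μ)
    (hfin : ∀ᵐ ω ∂μ, W ω ≠ ∞) {ρ c : ℝ≥0∞} (hρ : ρ ≤ 1)
    (hle : ∀ n : ℕ, ∫⁻ ω, min (W ω) n ∂μ ≤ c + ∫⁻ ω, min (ρ * W ω) n ∂μ) :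
    (1 - ρ) * ∫⁻ ω, W ω ∂μ ≤ c := by
  -- `(1 - ρ) w 1_{w ≤ n} ≤ min w n - min (ρ w) n`
  have hpoint : ∀ (n : ℕ) (w : ℝ≥0∞),
      (1 - ρ) * (Set.Iic (n : ℝ≥0∞)).indicator id w + min (ρ * w) n ≤ min w n := by
    intro n w
    by_cases hn : w ≤ n
    · rw [Set.indicator_of_mem (Set.mem_Iic.2 hn), id_eq, min_eq_left hn]
      calc (1 - ρ) * w + min (ρ * w) n ≤ (1 - ρ) * w + ρ * w := by gcongr; exact min_le_left _ _
        _ = w := by rw [← add_mul, tsub_add_cancel_of_le hρ, one_mul]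
    · rw [Set.indicator_of_notMem (by simpa using hn), mul_zero, zero_add,
        min_eq_right (not_le.1 hn).le]
      exact min_le_right _ _
  have hind : ∀ n : ℕ, AEMeasurable (fun ω => (Set.Iic (n : ℝ≥0∞)).indicator id (W ω)) μ :=
    fun n => (measurable_id.indicator measurableSet_Iic).comp_aemeasurable hW
  have hbound : ∀ n : ℕ, (1 - ρ) * ∫⁻ ω, (Set.Iic (n : ℝ≥0∞)).indicator id (W ω) ∂μ ≤ c := by
    intro n
    have hne : ∫⁻ ω, min (ρ * W ω) (n : ℝ≥0∞) ∂μ ≠ ∞ := ne_top_of_le_ne_top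
      (ENNReal.natCast_ne_top n) ((lintegral_mono fun ω => min_le_right _ _).trans_eq (by simp))
    refine (ENNReal.add_le_add_iff_right hne).1 (le_trans ?_ (hle n))
    rw [← lintegral_const_mul'' _ (hind n),
      ← lintegral_add_right' (g := fun ω => min (ρ * W ω) n) _
        ((aemeasurable_const.mul hW).min aemeasurable_const)]
    exact lintegral_mono fun ω => hpoint n (W ω)
  have hlim : Tendsto (fun n : ℕ => ∫⁻ ω, (Set.Iic (n : ℝ≥0∞)).indicator id (W ω) ∂μ) atTop
      (𝓝 (∫⁻ ω, W ω ∂μ)) := by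
    refine lintegral_tendsto_of_tendsto_of_monotone hind (ae_of_all _ fun ω m n hmn =>
      Set.indicator_le_indicator_of_subset (Set.Iic_subset_Iic.2 (by exact_mod_cast hmn))
        (fun _ => zero_le) _) ?_
    filter_upwards [hfin] with ω hω
    obtain ⟨N, hN⟩ := ENNReal.exists_nat_gt hω
    refine tendsto_const_nhds.congr' ?_
    filter_upwards [eventually_ge_atTop N] with n hn
    exact (Set.indicator_of_mem (Set.mem_Iic.2 (hN.le.trans (by exact_mod_cast hn))) id).symm
  exact le_of_tendsto' (ENNReal.Tendsto.const_mul hlim (Or.inr (by simp))) hbound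

theorem lintegral_ne_top_of_affine_bound {W W' h q : Ω → ℝ≥0∞} (hW : AEMeasurable W μ)
    (hh : Measurable h) (hq : Measurable q) (hident : IdentDistrib W' W μ μ)
    (hindep : IndepFun h W μ) (hfin : ∀ᵐ ω ∂μ, W ω ≠ ∞)
    (hle : ∀ᵐ ω ∂μ, W' ω ≤ q ω + h ω * W ω) (hh1 : ∫⁻ ω, h ω ∂μ < 1) (hq1 : ∫⁻ ω, q ω ∂μ ≠ ∞) :
    ∫⁻ ω, W ω ∂μ ≠ ∞ := by
  have hbound := one_sub_mul_lintegral_le_of_lintegral_min_le hW hfin hh1.le fun n => calc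
    ∫⁻ ω, min (W ω) n ∂μ = ∫⁻ ω, min (W' ω) n ∂μ :=
        ((hident.comp (u := fun x => min x (n : ℝ≥0∞))
          (measurable_id.min measurable_const)).lintegral_eq).symm
    _ ≤ ∫⁻ ω, (q ω + min (h ω * W ω) n) ∂μ := by
        refine lintegral_mono_ae ?_
        filter_upwards [hle] with ω hω
        refine (min_le_min_right _ hω).trans ?_
        rw [← min_add_add_left]
        exact min_le_min le_rfl le_add_self
    _ ≤ ∫⁻ ω, q ω ∂μ + ∫⁻ ω, min ((∫⁻ ω', h ω' ∂μ) * W ω) n ∂μ := by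
        rw [lintegral_add_left hq]
        exact add_le_add_right (lintegral_min_mul_le_of_indepFun hh hW hindep n) _
  intro htop
  rw [htop, ENNReal.mul_top (tsub_pos_of_lt hh1).ne'] at hbound
  exact hq1 (top_le_iff.1 hbound)

/-- Fatou's lemma for `A n - Y n ≥ 0`. -/
theorem eventually_lintegral_ofReal_lt {Y A : ℕ → Ω → ℝ} {r r' c : ℝ}
    (hY : ∀ n, Measurable (Y n)) (hY0 : ∀ n, 0 ≤ᵐ[μ] Y n) (hYA : ∀ᶠ n in atTop, Y n ≤ᵐ[μ] A n)
    (hA : ∀ n, Integrable (A n) μ) (hAc : Tendsto (fun n => ∫ ω, A n ω ∂μ) atTop (𝓝 c))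
    (hlim : ∀ᵐ ω ∂μ, Tendsto (fun n => A n ω) atTop (𝓝 c))
    (hYr : ∀ᵐ ω ∂μ, ∀ᶠ n in atTop, Y n ω ≤ r) (hr : r < r') :
    ∀ᶠ n in atTop, ∫⁻ ω, ENNReal.ofReal (Y n ω) ∂μ < ENNReal.ofReal r' := by
  have hYi : ∀ᶠ n in atTop, Integrable (Y n) μ := by
    filter_upwards [hYA] with n hn
    refine (hA n).mono' (hY n).aestronglyMeasurable ?_
    filter_upwards [hn, hY0 n] with ω hle hnonneg
    rwa [Real.norm_eq_abs, abs_of_nonneg hnonneg]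
  suffices h : ∀ᶠ n in atTop, ∫ ω, Y n ω ∂μ < r' by
    filter_upwards [h, hYi] with n hn hYn
    rwa [← ofReal_integral_eq_lintegral_ofReal hYn (hY0 n),
      ENNReal.ofReal_lt_ofReal_iff_of_nonneg (integral_nonneg_of_ae (hY0 n))]
  rcases le_or_gt c r with hcr | hrc
  · filter_upwards [hYA, hYi, hAc.eventually_lt_const (hcr.trans_lt hr)] with n hYAn hYn hAn
    exact (integral_mono_ae hYn (hA n) hYAn).trans_lt hAn
  obtain ⟨s, hrs, hs⟩ := exists_between (lt_min hr hrc)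
  obtain ⟨s', hrs', hss'⟩ := exists_between hrs
  obtain ⟨hsr', hsc⟩ := lt_min_iff.1 hs
  have hlow : ENNReal.ofReal (c - s) <
      liminf (fun n => ∫⁻ ω, ENNReal.ofReal (A n ω - Y n ω) ∂μ) atTop := by
    refine lt_of_lt_of_le ?_ ((lintegral_mono_ae (f := fun _ => ENNReal.ofReal (c - s')) ?_).trans
      (lintegral_liminf_le' fun n =>
        ((hA n).aemeasurable.sub (hY n).aemeasurable).ennreal_ofReal))
    · rw [lintegral_const, measure_univ, mul_one]
      exact (ENNReal.ofReal_lt_ofReal_iff (by linarith)).2 (by linarith)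
    filter_upwards [hlim, hYr] with ω hAω hYω
    refine le_liminf_of_le (by isBoundedDefault) ?_
    filter_upwards [hYω, hAω.eventually_const_lt (show c - (s' - r) < c by linarith)] with n hYn hAn
    exact ENNReal.ofReal_le_ofReal (by linarith)
  filter_upwards [eventually_lt_of_lt_liminf hlow, hYA, hYi,
    hAc.eventually_lt_const (show c < c + (r' - s) by linarith)] with n hn hYAn hYn hAn
  have hAY : Integrable (fun ω => A n ω - Y n ω) μ := (hA n).sub hYn
  rw [← ofReal_integral_eq_lintegral_ofReal hAY (hYAn.mono fun ω hω => sub_nonneg.2 hω),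
    integral_sub (hA n) hYn] at hn
  have hsub := (ENNReal.ofReal_lt_ofReal_iff_of_nonneg (by linarith)).1 hn
  linarith

end moments

/-! ### Basic properties of stationary AGARCH processes -/

/-- The function `x ↦ (|x| - γ x)²`. -/
def asymSq (γ x : ℝ) : ℝ := (|x| - γ * x) ^ 2

theorem asymSq_nonneg (γ x : ℝ) : 0 ≤ asymSq γ x := sq_nonneg _

theorem measurable_asymSq (γ : ℝ) : Measurable (asymSq γ) := by
  unfold asymSq
  fun_prop

theorem asymSq_mul (γ : ℝ) {r : ℝ} (hr : 0 ≤ r) (z : ℝ) :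
    asymSq γ (r * z) = asymSq γ z * r ^ 2 := by
  unfold asymSq
  rw [abs_mul, abs_of_nonneg hr]
  ring

theorem asymSq_le (γ x : ℝ) : asymSq γ x ≤ (1 + |γ|) ^ 2 * x ^ 2 := by
  unfold asymSq
  rw [← mul_pow, ← sq_abs (|x| - γ * x), ← sq_abs ((1 + |γ|) * x)]
  refine pow_le_pow_left₀ (abs_nonneg _) ?_ 2
  refine (abs_sub _ _).trans_eq ?_
  rw [abs_abs, abs_mul, abs_mul, abs_of_nonneg (by positivity : 0 ≤ 1 + |γ|)]
  ring

namespace AGARCHParam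

variable {p q : ℕ}

/-- The coefficients `α` extended by zero; the entry of index `i` is `α_{i+1}`. -/
def alphaN (θ : AGARCHParam p q) (i : ℕ) : ℝ := if h : i < p then θ.alpha ⟨i, h⟩ else 0

/-- The coefficients `β` extended by zero; the entry of index `j` is `β_{j+1}`. -/
def betaN (θ : AGARCHParam p q) (j : ℕ) : ℝ := if h : j < q then θ.beta ⟨j, h⟩ else 0

theorem alphaN_fin (θ : AGARCHParam p q) (i : Fin p) : θ.alphaN i = θ.alpha i :=
  dif_pos i.2

theorem betaN_fin (θ : AGARCHParam p q) (j : Fin q) : θ.betaN j = θ.beta j :=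
  dif_pos j.2

theorem alphaN_of_le (θ : AGARCHParam p q) {i : ℕ} (h : p ≤ i) : θ.alphaN i = 0 :=
  dif_neg h.not_gt

theorem betaN_of_le (θ : AGARCHParam p q) {j : ℕ} (h : q ≤ j) : θ.betaN j = 0 :=
  dif_neg h.not_gt

theorem alphaN_nonneg {θ : AGARCHParam p q} (hθ : θ ∈ space p q) (i : ℕ) : 0 ≤ θ.alphaN i := by
  unfold alphaN
  split_ifs with h
  · exact hθ.2.1 _
  · exact le_rfl

theorem betaN_nonneg {θ : AGARCHParam p q} (hθ : θ ∈ space p q) (j : ℕ) : 0 ≤ θ.betaN j := by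
  unfold betaN
  split_ifs with h
  · exact (hθ.2.2.1.1 _).1
  · exact le_rfl

theorem sum_betaN (θ : AGARCHParam p q) : ∑ j ∈ Finset.range q, θ.betaN j = ∑ j, θ.beta j := by
  rw [Finset.sum_range]
  exact Finset.sum_congr rfl fun j _ => θ.betaN_fin j

theorem volMap_lagVec (θ : AGARCHParam p q) (x s : ℤ → ℝ) (t : ℤ) :
    θ.volMap (lagVec x p (t - 1)) (lagVec s q (t - 1)) = θ.alphaZero +
      ∑ i ∈ Finset.range p, θ.alphaN i * asymSq θ.gamma (x (t - 1 - i)) +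
      ∑ j ∈ Finset.range q, θ.betaN j * s (t - 1 - j) := by
  rw [volMap, Finset.sum_range, Finset.sum_range]
  simp only [alphaN_fin, betaN_fin, lagVec, asymSq]

/-- The random coefficients of the recursion satisfied by the squared volatility. -/
def recCoeff (θ : AGARCHParam p q) (z : ℤ → ℝ) (i : ℕ) (t : ℤ) : ℝ :=
  θ.alphaN i * asymSq θ.gamma (z t) + θ.betaN i

/-- The sum of the weighted past values as a functional of the path of `(X, σ)`. -/
def lagFun (θ : AGARCHParam p q) (w : ℤ → ℝ × ℝ) : ℝ :=
  ∑ l ∈ Finset.range (p + q), ∑ i ∈ Finset.range (p + q),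
    (θ.alphaN i * asymSq θ.gamma (w (-1 - l)).1 + θ.betaN i * (w (-1 - l)).2 ^ 2)

theorem measurable_lagFun (θ : AGARCHParam p q) : Measurable θ.lagFun := by
  unfold lagFun
  have := measurable_asymSq θ.gamma
  fun_prop

/-- The deterministic properties of almost every path of a stationary AGARCH process. -/
structure IsPath (θ : AGARCHParam p q) (z x v : ℤ → ℝ) : Prop where
  vol_nonneg : ∀ t, 0 ≤ v t
  obs_eq : ∀ t, x t = v t * z t
  vol_eq : ∀ t, v t ^ 2 = θ.alphaZero +
      ∑ i ∈ Finset.range p, θ.alphaN i * asymSq θ.gamma (x (t - 1 - i)) +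
      ∑ j ∈ Finset.range q, θ.betaN j * v (t - 1 - j) ^ 2

namespace IsPath

variable {θ : AGARCHParam p q} {z x v : ℤ → ℝ}

theorem asymSq_obs (h : θ.IsPath z x v) (γ : ℝ) (t : ℤ) :
    asymSq γ (x t) = asymSq γ (z t) * v t ^ 2 := by
  rw [h.obs_eq, asymSq_mul γ (h.vol_nonneg t)]

theorem isPosRecursion (h : θ.IsPath z x v) (hθ : θ ∈ space p q) (hp : 0 < p) :
    IsPosRecursion (p + q) θ.alphaZero (θ.recCoeff z) (fun t => v t ^ 2) where
  pos_order := by omega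
  pos_const := hθ.1
  coeff_nonneg i t := add_nonneg (mul_nonneg (alphaN_nonneg hθ i) (asymSq_nonneg _ _))
    (betaN_nonneg hθ i)
  coeff_eq_zero i t hi := by
    rw [recCoeff, alphaN_of_le θ (by omega), betaN_of_le θ (by omega), zero_mul, zero_add]
  sol_nonneg t := sq_nonneg _
  sol_eq t := by
    rw [h.vol_eq, add_assoc]
    simp only [recCoeff, add_mul, Finset.sum_add_distrib]
    congr 2
    · refine (Finset.sum_subset (Finset.range_mono (Nat.le_add_right p q)) fun i _ hi => ?_).trans
        (Finset.sum_congr rfl fun i _ => ?_)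
      · rw [alphaN_of_le θ (by simpa using hi), zero_mul]
      · rw [h.asymSq_obs, mul_assoc]
    · refine Finset.sum_subset (Finset.range_mono (Nat.le_add_left q p)) fun i _ hi => ?_
      rw [betaN_of_le θ (by simpa using hi), zero_mul]

theorem lagSum_eq (h : θ.IsPath z x v) (t : ℤ) :
    lagSum (p + q) (θ.recCoeff z) (fun t => v t ^ 2) t =
      θ.lagFun (pathShift t fun t => (x t, v t)) := by
  unfold lagSum lagFun coeffSum
  refine Finset.sum_congr rfl fun l _ => ?_
  rw [Finset.sum_mul]
  refine Finset.sum_congr rfl fun i _ => ?_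
  simp only [pathShift, recCoeff]
  rw [show -1 - (l : ℤ) + t = t - 1 - l by ring, h.asymSq_obs]
  ring

theorem lagSum_zero (h : θ.IsPath z x v) :
    lagSum (p + q) (θ.recCoeff z) (fun t => v t ^ 2) 0 = θ.lagFun fun t => (x t, v t) := by
  rw [h.lagSum_eq, pathShift_zero]

theorem alphaZero_le (h : θ.IsPath z x v) (hθ : θ ∈ space p q) (t : ℤ) :
    θ.alphaZero ≤ v t ^ 2 := by
  rw [h.vol_eq, add_assoc]
  refine le_add_of_nonneg_right (add_nonneg (Finset.sum_nonneg fun i _ => ?_)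
    (Finset.sum_nonneg fun i _ => ?_))
  · exact mul_nonneg (alphaN_nonneg hθ i) (asymSq_nonneg _ _)
  · exact mul_nonneg (betaN_nonneg hθ i) (sq_nonneg _)

theorem sq_le (h : θ.IsPath z x v) (hθ : θ ∈ space p q) (hp : 0 < p) :
    v 0 ^ 2 ≤ θ.alphaZero + θ.lagFun fun t => (x t, v t) := by
  have hrec := h.isPosRecursion hθ hp
  rw [← h.lagSum_zero]
  refine (hrec.sol_eq 0).trans_le (add_le_add_right (Finset.sum_le_sum fun i _ => ?_) _)
  exact mul_le_mul_of_nonneg_right (hrec.coeff_le_coeffSum _ _) (sq_nonneg _)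

end IsPath

end AGARCHParam

namespace IsStationaryAGARCH

open AGARCHParam

variable {Ω : Type*} [MeasurableSpace Ω] {μ : Measure Ω} {p q : ℕ} {θ : AGARCHParam p q}
  {Z X σ : ℤ → Ω → ℝ}

theorem ae_isPath (h : IsStationaryAGARCH μ θ Z X σ) :
    ∀ᵐ ω ∂μ, θ.IsPath (fun t => Z t ω) (fun t => X t ω) (fun t => σ t ω) := by
  filter_upwards [ae_all_iff.2 h.vol_nonneg, ae_all_iff.2 h.obs_eq, ae_all_iff.2 h.vol_eq]
    with ω hvol hobs hrec
  exact ⟨hvol, hobs, fun t => by rw [hrec t, volMap_lagVec]⟩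

theorem measurable_path (h : IsStationaryAGARCH μ θ Z X σ) (t : ℤ) :
    Measurable fun ω => (X t ω, σ t ω) :=
  (h.measurable_obs t).prodMk (h.measurable_vol t)

theorem measurable_pathMap (h : IsStationaryAGARCH μ θ Z X σ) :
    Measurable fun ω t => (X t ω, σ t ω) :=
  measurable_pi_lambda _ h.measurable_path

theorem identDistrib_pathShift (h : IsStationaryAGARCH μ θ Z X σ) {β : Type*} [MeasurableSpace β]
    {f : (ℤ → ℝ × ℝ) → β} (hf : Measurable f) (k : ℤ) :
    IdentDistrib (fun ω => f (pathShift k fun t => (X t ω, σ t ω)))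
      (fun ω => f fun t => (X t ω, σ t ω)) μ μ :=
  (h.stationary k).comp hf

theorem exists_noisePast_path (h : IsStationaryAGARCH μ θ Z X σ) (t : ℤ) :
    ∃ f : Ω → ℝ × ℝ, Measurable[noisePast Z t] f ∧ (fun ω => (X t ω, σ t ω)) =ᵐ[μ] f := by
  obtain ⟨f, hfm, hf⟩ := h.vol_adapted t
  have hfm' : Measurable[noisePast Z t] f := hfm.mono (noisePast_mono (by omega)) le_rfl
  have hZ : Measurable[noisePast Z t] (Z t) := measurable_noisePast le_rfl
  refine ⟨fun ω => (f ω * Z t ω, f ω), ?_, ?_⟩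
  · exact (hfm'.mul hZ).prodMk hfm'
  · filter_upwards [hf, h.obs_eq t] with ω hσ hX
    rw [hX, hσ]

theorem ergodic [IsProbabilityMeasure μ] (h : IsStationaryAGARCH μ θ Z X σ) :
    Ergodic (pathShift 1) (μ.map fun ω t => (X t ω, σ t ω)) :=
  h.stationary.ergodic_pathShift h.noise.measurable h.noise.indep h.measurable_path
    h.exists_noisePast_path

theorem ae_bddAbove_sum [IsProbabilityMeasure μ] (h : IsStationaryAGARCH μ θ Z X σ)
    {f : (ℤ → ℝ × ℝ) → ℝ} (hfm : Measurable f)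
    (hf : Integrable (fun ω => f fun t => (X t ω, σ t ω)) μ)
    (hneg : ∫ ω, f (fun t => (X t ω, σ t ω)) ∂μ < 0) :
    ∀ᵐ ω ∂μ, ∃ C, ∀ n : ℕ, ∑ k ∈ Finset.range n, f (pathShift k fun t => (X t ω, σ t ω)) ≤ C :=
  ae_bddAbove_sum_pathShift h.measurable_path h.ergodic hfm hf hneg

end IsStationaryAGARCH

/-! ### Fractional moments of the volatility -/

theorem exists_seq_exp_neg_mul_tendsto {Ω : Type*} [MeasurableSpace Ω] {μ : Measure Ω}
    [IsFiniteMeasure μ] {V : ℕ → Ω → ℝ} {V₀ : Ω → ℝ} (hV₀ : Measurable V₀)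
    (hV : ∀ n, IdentDistrib (V n) V₀ μ μ) {κ : ℝ} (hκ : 0 < κ) :
    ∃ ns : ℕ → ℕ, StrictMono ns ∧
      ∀ᵐ ω ∂μ, Tendsto (fun i => Real.exp (-(κ * ns i)) * V (ns i) ω) atTop (𝓝 0) := by
  have hexp : Tendsto (fun n : ℕ => Real.exp (-(κ * n))) atTop (𝓝 0) :=
    Real.tendsto_exp_atBot.comp (tendsto_neg_atTop_atBot.comp
      (tendsto_natCast_atTop_atTop.const_mul_atTop hκ))
  have h₀ : TendstoInMeasure μ (fun (n : ℕ) ω => Real.exp (-(κ * n)) * V₀ ω) atTop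
      (fun _ => (0 : ℝ)) :=
    tendstoInMeasure_of_tendsto_ae (fun n => (measurable_const.mul hV₀).aestronglyMeasurable)
      (ae_of_all _ fun ω => by simpa only [zero_mul] using hexp.mul_const (V₀ ω))
  have h : TendstoInMeasure μ (fun (n : ℕ) ω => Real.exp (-(κ * n)) * V n ω) atTop
      (fun _ => (0 : ℝ)) := fun ε hε => (h₀ ε hε).congr fun n =>
    ((hV n).comp (u := fun x => Real.exp (-(κ * n)) * x)
      (measurable_const.mul measurable_id)).symm.measure_mem_eq (s := {x | ε ≤ edist x 0})
      (measurableSet_le measurable_const (measurable_id.edist measurable_const))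
  exact h.exists_seq_tendsto_ae

theorem prod_rpow_inv_le_avg {x : ℕ → ℝ} (hx : ∀ u, 0 ≤ x u) {n : ℕ} (hn : 0 < n) :
    (∏ u ∈ Finset.range n, x u) ^ ((n : ℝ)⁻¹) ≤ (∑ u ∈ Finset.range n, x u) / n := by
  simpa using Real.geom_mean_le_arith_mean (Finset.range n) (fun _ => 1) x
    (fun _ _ => zero_le_one) (by simpa using hn) (fun u _ => hx u)

section measurability

variable {Ω : Type*} {mΩ : MeasurableSpace Ω} {c : Ω → ℕ → ℤ → ℝ}

theorem measurable_volterra_recKernel (hc : ∀ i (u : ℕ), Measurable fun ω => c ω i u) {b : ℕ → ℝ}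
    (n : ℕ) : Measurable fun ω => volterra (recKernel (c ω)) b n :=
  volterra.measurable (fun _ _ _ => hc _ _) n

theorem measurable_lagResp (hc : ∀ i (u : ℕ), Measurable fun ω => c ω i u) {m : ℕ}
    {x : Ω → ℕ → ℝ} (hx : ∀ k, Measurable fun ω => x ω k) (n : ℕ) :
    Measurable fun ω => lagResp m (c ω) (x ω) n :=
  Finset.measurable_sum _ fun _ _ => (Finset.measurable_sum _ fun _ _ => hc _ _).mul (hx _)

end measurability

namespace AGARCHParam

variable {p q : ℕ} {θ : AGARCHParam p q}

/-- The sum of the coefficients of the volatility recursion at a time, as a function of the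
noise at that time. -/
def coeffFun (θ : AGARCHParam p q) (z : ℝ) : ℝ :=
  ∑ i ∈ Finset.range (p + q), (θ.alphaN i * asymSq θ.gamma z + θ.betaN i)

/-- The response at time `n` of the lagged sums to their value at time `0`, as a functional of
the noise. -/
def response (θ : AGARCHParam p q) (z : ℤ → ℝ) (n : ℕ) : ℝ :=
  lagResp (p + q) (θ.recCoeff z) (impulseResp (p + q) (θ.recCoeff z)) n

/-- The contribution to the lagged sum at time `n` of a unit constant term acting between the
times `0` and `n`, as a functional of the noise. -/
def forcing (θ : AGARCHParam p q) (z : ℤ → ℝ) (n : ℕ) : ℝ :=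
  lagResp (p + q) (θ.recCoeff z) (volterra (recKernel (θ.recCoeff z)) fun _ => 1) n

/-- The empirical means which dominate the `n`-th roots of `response` and `forcing`. -/
def avgCoeff (θ : AGARCHParam p q) (z : ℤ → ℝ) (n : ℕ) : ℝ :=
  (∑ u ∈ Finset.range n, (1 + θ.coeffFun (z u))) / n

theorem measurable_coeffFun (θ : AGARCHParam p q) : Measurable θ.coeffFun := by
  have := measurable_asymSq θ.gamma
  unfold coeffFun
  fun_prop

section measurability

variable {Ω : Type*} {mΩ : MeasurableSpace Ω} {Z : ℤ → Ω → ℝ}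

theorem measurable_recCoeff {t : ℤ} (hZ : Measurable (Z t)) (i : ℕ) :
    Measurable fun ω => θ.recCoeff (fun t => Z t ω) i t :=
  (measurable_const.mul ((measurable_asymSq _).comp hZ)).add measurable_const

theorem measurable_response (hZ : ∀ u : ℕ, Measurable (Z u)) (n : ℕ) :
    Measurable fun ω => θ.response (fun t => Z t ω) n :=
  measurable_lagResp (fun i u => measurable_recCoeff (hZ u) i)
    (fun _ => measurable_volterra_recKernel (fun i u => measurable_recCoeff (hZ u) i) _) n

theorem measurable_forcing (hZ : ∀ u : ℕ, Measurable (Z u)) (n : ℕ) :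
    Measurable fun ω => θ.forcing (fun t => Z t ω) n :=
  measurable_lagResp (fun i u => measurable_recCoeff (hZ u) i)
    (fun _ => measurable_volterra_recKernel (fun i u => measurable_recCoeff (hZ u) i) _) n

end measurability

namespace IsPath

variable {z x v : ℤ → ℝ}

theorem response_nonneg (h : θ.IsPath z x v) (hθ : θ ∈ space p q) (hp : 0 < p) (n : ℕ) :
    0 ≤ θ.response z n :=
  (h.isPosRecursion hθ hp).lagResp_nonneg (h.isPosRecursion hθ hp).impulseResp_nonneg n

theorem forcing_nonneg (h : θ.IsPath z x v) (hθ : θ ∈ space p q) (hp : 0 < p) (n : ℕ) :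
    0 ≤ θ.forcing z n :=
  (h.isPosRecursion hθ hp).lagResp_nonneg
    (volterra.nonneg (h.isPosRecursion hθ hp).kernel_nonneg fun _ => zero_le_one) n

theorem lagResp_volterra_rpow_le (h : θ.IsPath z x v) (hθ : θ ∈ space p q) (hp : 0 < p)
    {b : ℕ → ℝ} (hb0 : ∀ k, 0 ≤ b k) (hb1 : ∀ k, b k ≤ 1) {n : ℕ} (hn : p + q ≤ n) :
    lagResp (p + q) (θ.recCoeff z) (volterra (recKernel (θ.recCoeff z)) b) n ^ ((n : ℝ)⁻¹) ≤
      θ.avgCoeff z n := by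
  have hrec := h.isPosRecursion hθ hp
  exact (Real.rpow_le_rpow (hrec.lagResp_nonneg (volterra.nonneg hrec.kernel_nonneg hb0) n)
    (hrec.lagResp_volterra_le_prod hb1 hn) (by positivity)).trans
    (prod_rpow_inv_le_avg (fun u => add_nonneg zero_le_one (hrec.coeffSum_nonneg u)) (by omega))

theorem response_rpow_le (h : θ.IsPath z x v) (hθ : θ ∈ space p q) (hp : 0 < p) {n : ℕ}
    (hn : p + q ≤ n) : θ.response z n ^ ((n : ℝ)⁻¹) ≤ θ.avgCoeff z n :=
  h.lagResp_volterra_rpow_le hθ hp (fun k => by split_ifs <;> norm_num)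
    (fun k => by split_ifs <;> norm_num) hn

theorem forcing_rpow_le (h : θ.IsPath z x v) (hθ : θ ∈ space p q) (hp : 0 < p) {n : ℕ}
    (hn : p + q ≤ n) : θ.forcing z n ^ ((n : ℝ)⁻¹) ≤ θ.avgCoeff z n :=
  h.lagResp_volterra_rpow_le hθ hp (fun _ => zero_le_one) (fun _ => le_rfl) hn

theorem lagFun_pathShift_le (h : θ.IsPath z x v) (hθ : θ ∈ space p q) (hp : 0 < p) {n : ℕ}
    (hn : p + q ≤ n) : θ.lagFun (pathShift n fun t => (x t, v t)) ≤
      θ.alphaZero * θ.forcing z n + θ.response z n * θ.lagFun fun t => (x t, v t) := by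
  rw [← h.lagSum_eq, ← h.lagSum_zero]
  exact (h.isPosRecursion hθ hp).lagSum_le hn

theorem lagFun_nonneg (h : θ.IsPath z x v) (hθ : θ ∈ space p q) (hp : 0 < p) :
    0 ≤ θ.lagFun fun t => (x t, v t) :=
  h.lagSum_zero ▸ (h.isPosRecursion hθ hp).lagSum_nonneg 0

theorem eventually_response_rpow_le (h : θ.IsPath z x v) (hθ : θ ∈ space p q) (hp : 0 < p)
    {κ C : ℝ} (hκ : 0 < κ) (hrate : ∀ n : ℕ, κ * n - C ≤
      ∑ k ∈ Finset.range n, decayRate (p + q) θ.alphaZero (fun t => v t ^ 2) k) :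
    ∀ᶠ n : ℕ in atTop, θ.lagFun (pathShift n fun t => (x t, v t)) ≤ Real.exp (κ / 2 * n) →
      θ.response z n ^ ((n : ℝ)⁻¹) ≤ Real.exp (-(κ / 4)) := by
  have hlarge : ∀ᶠ n : ℕ in atTop,
      Real.log (Real.exp 1 / θ.alphaZero) + κ * (p + q : ℕ) + C ≤ κ / 4 * n :=
    (tendsto_natCast_atTop_atTop.const_mul_atTop (by positivity)).eventually_ge_atTop _
  filter_upwards [hlarge, eventually_ge_atTop (p + q)] with n hnC hn hlag
  have hconst : 0 < Real.exp 1 / θ.alphaZero := div_pos (Real.exp_pos 1) hθ.1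
  have hn0 : (n : ℝ) ≠ 0 := by exact_mod_cast (by omega : n ≠ 0)
  have hresp : θ.response z n ≤ Real.exp (-(κ / 4) * n) := calc
    θ.response z n ≤ Real.exp 1 / θ.alphaZero * θ.lagFun (pathShift n fun t => (x t, v t)) *
        Real.exp (-∑ k ∈ Finset.range (n - (p + q)),
          decayRate (p + q) θ.alphaZero (fun t => v t ^ 2) k) :=
        h.lagSum_eq n ▸ (h.isPosRecursion hθ hp).lagResp_impulseResp_le_exp hn
    _ ≤ Real.exp 1 / θ.alphaZero * Real.exp (κ / 2 * n) *
        Real.exp (-(κ * (n - (p + q) : ℕ) - C)) := by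
        gcongr
        exact hrate _
    _ = Real.exp (Real.log (Real.exp 1 / θ.alphaZero) + κ / 2 * n +
          -(κ * (n - (p + q) : ℕ) - C)) := by
        rw [Real.exp_add, Real.exp_add, Real.exp_log hconst]
    _ ≤ Real.exp (-(κ / 4) * n) := by
        refine Real.exp_le_exp.2 ?_
        rw [Nat.cast_sub hn]
        linarith
  calc θ.response z n ^ ((n : ℝ)⁻¹) ≤ Real.exp (-(κ / 4) * n) ^ ((n : ℝ)⁻¹) :=
        Real.rpow_le_rpow (h.response_nonneg hθ hp n) hresp (by positivity)
    _ = Real.exp (-(κ / 4)) := by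
        rw [← Real.exp_mul, mul_assoc, mul_inv_cancel₀ hn0, mul_one]

end IsPath

end AGARCHParam

namespace IsStationaryAGARCH

open AGARCHParam

variable {Ω : Type*} [MeasurableSpace Ω] {μ : Measure Ω} {p q : ℕ} {θ : AGARCHParam p q}
  {Z X σ : ℤ → Ω → ℝ}

theorem integrable_sq_noise (h : IsStationaryAGARCH μ θ Z X σ) (t : ℤ) :
    Integrable (fun ω => Z t ω ^ 2) μ :=
  ((h.noise.identDistrib t).comp (u := fun x => x ^ 2) (by fun_prop)).integrable_iff.2
    h.noise.memLp.integrable_sq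

theorem identDistrib_one_add_coeffFun (h : IsStationaryAGARCH μ θ Z X σ) (t : ℤ) :
    IdentDistrib (fun ω => 1 + θ.coeffFun (Z t ω)) (fun ω => 1 + θ.coeffFun (Z 0 ω)) μ μ :=
  (h.noise.identDistrib t).comp (u := fun z => 1 + θ.coeffFun z)
    (measurable_const.add θ.measurable_coeffFun)

theorem exists_noisePast_lagFun (h : IsStationaryAGARCH μ θ Z X σ) :
    ∃ g : Ω → ℝ, Measurable[noisePast Z (-1)] g ∧
      (fun ω => θ.lagFun fun t => (X t ω, σ t ω)) =ᵐ[μ] g := by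
  choose f hfm hf using h.exists_noisePast_path
  refine ⟨fun ω => ∑ l ∈ Finset.range (p + q), ∑ i ∈ Finset.range (p + q),
    (θ.alphaN i * asymSq θ.gamma (f (-1 - l) ω).1 + θ.betaN i * (f (-1 - l) ω).2 ^ 2), ?_, ?_⟩
  · refine Finset.measurable_sum _ fun l _ => Finset.measurable_sum _ fun i _ => ?_
    have hl : Measurable[noisePast Z (-1)] (f (-1 - l)) :=
      (hfm _).mono (noisePast_mono (by omega)) le_rfl
    exact (measurable_const.mul ((measurable_asymSq _).comp (measurable_fst.comp hl))).add
      (measurable_const.mul ((measurable_snd.comp hl).pow_const 2))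
  · filter_upwards [ae_all_iff.2 hf] with ω hω
    simp only [lagFun, ← hω]

theorem indepFun_of_measurable (h : IsStationaryAGARCH μ θ Z X σ) {β γ : Type*}
    [MeasurableSpace β] [MeasurableSpace γ] {f : Ω → β} {g g' : Ω → γ} {t : ℤ}
    (hf : Measurable[noiseFuture Z t] f) (hg : Measurable[noisePast Z t] g) (hgg : g' =ᵐ[μ] g) :
    IndepFun f g' μ := by
  refine IndepFun.congr (f := f) (g := g) ?_ (ae_eq_refl _) hgg.symm
  rw [IndepFun_iff_Indep]
  exact indep_of_indep_of_le (indep_noisePast_noiseFuture h.noise.measurable h.noise.indep t).symm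
    hf.comap_le hg.comap_le

variable [IsProbabilityMeasure μ]

theorem integrable_one_add_coeffFun (h : IsStationaryAGARCH μ θ Z X σ) (t : ℤ) :
    Integrable (fun ω => 1 + θ.coeffFun (Z t ω)) μ := by
  refine (integrable_const 1).add (integrable_finsetSum _ fun i _ =>
    (Integrable.const_mul ?_ _).add (integrable_const _))
  refine ((h.integrable_sq_noise t).const_mul ((1 + |θ.gamma|) ^ 2)).mono'
    ((measurable_asymSq _).comp (h.noise.measurable t)).aestronglyMeasurable
    (ae_of_all _ fun ω => ?_)
  rw [Real.norm_eq_abs, abs_of_nonneg (asymSq_nonneg _ _)]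
  exact asymSq_le _ _

theorem integrable_avgCoeff (h : IsStationaryAGARCH μ θ Z X σ) (n : ℕ) :
    Integrable (fun ω => θ.avgCoeff (fun t => Z t ω) n) μ :=
  (integrable_finsetSum _ fun _ _ => h.integrable_one_add_coeffFun _).div_const _

theorem integral_avgCoeff (h : IsStationaryAGARCH μ θ Z X σ) {n : ℕ} (hn : 0 < n) :
    ∫ ω, θ.avgCoeff (fun t => Z t ω) n ∂μ = ∫ ω, (1 + θ.coeffFun (Z 0 ω)) ∂μ := by
  unfold avgCoeff
  rw [integral_div, integral_finsetSum _ fun _ _ => h.integrable_one_add_coeffFun _,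
    Finset.sum_congr rfl fun (u : ℕ) _ => (h.identDistrib_one_add_coeffFun u).integral_eq,
    Finset.sum_const, Finset.card_range, nsmul_eq_mul,
    mul_div_cancel_left₀ _ (Nat.cast_ne_zero.2 hn.ne')]

theorem tendsto_avgCoeff (h : IsStationaryAGARCH μ θ Z X σ) :
    ∀ᵐ ω ∂μ, Tendsto (θ.avgCoeff fun t => Z t ω) atTop
      (𝓝 (∫ ω, (1 + θ.coeffFun (Z 0 ω)) ∂μ)) := by
  have hmeas : Measurable fun z => 1 + θ.coeffFun z := measurable_const.add θ.measurable_coeffFun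
  exact strong_law_ae_real (fun (u : ℕ) ω => 1 + θ.coeffFun (Z u ω))
    (h.integrable_one_add_coeffFun 0)
    (fun u v huv => (h.noise.indep.indepFun (Nat.cast_injective.ne huv)).comp hmeas hmeas)
    (fun u => h.identDistrib_one_add_coeffFun u)

theorem exists_mul_sub_le_sum_decayRate (h : IsStationaryAGARCH μ θ Z X σ)
    (hθ : θ ∈ space p q) (hp : 0 < p) : ∃ κ > 0, ∀ᵐ ω ∂μ, ∃ C, ∀ n : ℕ, κ * n - C ≤
      ∑ k ∈ Finset.range n, decayRate (p + q) θ.alphaZero (fun t => σ t ω ^ 2) k := by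
  set f : (ℤ → ℝ × ℝ) → ℝ := fun w => decayRate (p + q) θ.alphaZero (fun t => (w t).2 ^ 2) 0
    with hf
  have hfm : Measurable f := by
    simp only [hf, decayRate]
    fun_prop
  have hbounds : ∀ᵐ ω ∂μ, 0 < f (fun t => (X t ω, σ t ω)) ∧ f (fun t => (X t ω, σ t ω)) ≤ 1 := by
    filter_upwards [h.ae_isPath] with ω hω
    exact ⟨(hω.isPosRecursion hθ hp).decayRate_pos 0, (hω.isPosRecursion hθ hp).decayRate_le_one 0⟩
  have hint : Integrable (fun ω => f fun t => (X t ω, σ t ω)) μ := by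
    refine (integrable_const (1 : ℝ)).mono'
      (hfm.comp h.measurable_pathMap).aestronglyMeasurable (hbounds.mono fun ω hω => ?_)
    rw [Real.norm_eq_abs, abs_of_pos hω.1]
    exact hω.2
  set I := ∫ ω, f (fun t => (X t ω, σ t ω)) ∂μ with hI
  have hIpos : 0 < I := by
    refine (integral_pos_iff_support_of_nonneg_ae (hbounds.mono fun ω hω => hω.1.le) hint).2 ?_
    exact one_pos.trans_eq ((measure_congr
      (eventuallyEq_univ.2 (hbounds.mono fun ω hω => hω.1.ne'))).trans measure_univ).symm
  refine ⟨I / 2, half_pos hIpos, ?_⟩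
  have hbdd := h.ae_bddAbove_sum (f := fun w => I / 2 - f w) (measurable_const.sub hfm)
    ((integrable_const _).sub hint) (by
      rw [integral_sub (integrable_const _) hint, ← hI, integral_const, probReal_univ, one_smul]
      linarith)
  have hshift : ∀ ω (k : ℕ), f (pathShift k fun t => (X t ω, σ t ω)) =
      decayRate (p + q) θ.alphaZero (fun t => σ t ω ^ 2) k := fun ω k => by
    simp only [hf, decayRate, pathShift, zero_add, add_comm (k : ℤ)]
  filter_upwards [hbdd] with ω ⟨C, hC⟩
  refine ⟨C, fun n => ?_⟩
  have hCn := hC n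
  simp only [hshift, Finset.sum_sub_distrib, Finset.sum_const, Finset.card_range,
    nsmul_eq_mul] at hCn
  linarith

theorem exists_lintegral_response_lt_one (h : IsStationaryAGARCH μ θ Z X σ)
    (hθ : θ ∈ space p q) (hp : 0 < p) : ∃ n ≥ p + q,
      ∫⁻ ω, ENNReal.ofReal (θ.response (fun t => Z t ω) n) ^ ((n : ℝ)⁻¹) ∂μ < 1 := by
  obtain ⟨κ, hκ, hrate⟩ := h.exists_mul_sub_le_sum_decayRate hθ hp
  obtain ⟨ns, hns, hsub⟩ := exists_seq_exp_neg_mul_tendsto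
    (θ.measurable_lagFun.comp h.measurable_pathMap)
    (fun n : ℕ => h.identDistrib_pathShift θ.measurable_lagFun n) (half_pos hκ)
  have hns' : Tendsto ns atTop atTop := hns.tendsto_atTop
  have hresp : ∀ n, ∀ᵐ ω ∂μ, 0 ≤ θ.response (fun t => Z t ω) n := fun n =>
    h.ae_isPath.mono fun ω hω => hω.response_nonneg hθ hp n
  have hlt := eventually_lintegral_ofReal_lt
    (Y := fun i ω => θ.response (fun t => Z t ω) (ns i) ^ ((ns i : ℝ)⁻¹))
    (A := fun i ω => θ.avgCoeff (fun t => Z t ω) (ns i))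
    (fun i => (measurable_response (fun u => h.noise.measurable u) _).pow_const _)
    (fun i => (hresp _).mono fun ω hω => Real.rpow_nonneg hω _)
    ((hns'.eventually_ge_atTop (p + q)).mono fun i hi =>
      h.ae_isPath.mono fun ω hω => hω.response_rpow_le hθ hp hi)
    (fun i => h.integrable_avgCoeff _)
    (tendsto_const_nhds.congr' ((hns'.eventually_gt_atTop 0).mono fun i hi =>
      (h.integral_avgCoeff hi).symm))
    (h.tendsto_avgCoeff.mono fun ω hω => hω.comp hns')
    (r := Real.exp (-(κ / 4))) (r' := 1) (by
      filter_upwards [h.ae_isPath, hrate, hsub] with ω hω ⟨C, hC⟩ hsubω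
      filter_upwards [hsubω.eventually_le_const one_pos,
        hns'.eventually (hω.eventually_response_rpow_le hθ hp hκ hC)] with i hi hle
      refine hle ?_
      rwa [Real.exp_neg, ← div_eq_inv_mul, div_le_one (Real.exp_pos _)] at hi)
    (by rw [Real.exp_lt_one_iff]; linarith)
  obtain ⟨i, hi, hn⟩ := (hlt.and (hns'.eventually_ge_atTop (p + q))).exists
  refine ⟨ns i, hn, lt_of_eq_of_lt (lintegral_congr_ae ?_) (hi.trans_eq ENNReal.ofReal_one)⟩
  filter_upwards [hresp (ns i)] with ω hω
  rw [ENNReal.ofReal_rpow_of_nonneg hω (by positivity)]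

theorem lintegral_forcing_rpow_ne_top (h : IsStationaryAGARCH μ θ Z X σ) (hθ : θ ∈ space p q)
    (hp : 0 < p) {n : ℕ} (hn : p + q ≤ n) :
    ∫⁻ ω, ENNReal.ofReal (θ.alphaZero * θ.forcing (fun t => Z t ω) n) ^ ((n : ℝ)⁻¹) ∂μ ≠ ∞ := by
  have hn0 : (0 : ℝ) ≤ (n : ℝ)⁻¹ := by positivity
  have hα : ENNReal.ofReal θ.alphaZero ^ ((n : ℝ)⁻¹) ≠ ∞ :=
    ENNReal.rpow_ne_top_of_nonneg hn0 ENNReal.ofReal_ne_top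
  refine ne_top_of_le_ne_top (b := ENNReal.ofReal θ.alphaZero ^ ((n : ℝ)⁻¹) *
    ∫⁻ ω, ENNReal.ofReal (θ.avgCoeff (fun t => Z t ω) n) ∂μ)
    (ENNReal.mul_ne_top hα (h.integrable_avgCoeff n).lintegral_lt_top.ne) ?_
  rw [← lintegral_const_mul' _ _ hα]
  refine lintegral_mono_ae (h.ae_isPath.mono fun ω hω => ?_)
  rw [ENNReal.ofReal_mul hθ.1.le, ENNReal.mul_rpow_of_nonneg _ _ hn0,
    ENNReal.ofReal_rpow_of_nonneg (hω.forcing_nonneg hθ hp n) hn0]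
  gcongr
  exact hω.forcing_rpow_le hθ hp hn

theorem exists_lintegral_lagFun_rpow_ne_top (h : IsStationaryAGARCH μ θ Z X σ)
    (hθ : θ ∈ space p q) (hp : 0 < p) : ∃ κ : ℝ, 0 < κ ∧ κ ≤ 1 ∧
      ∫⁻ ω, ENNReal.ofReal (θ.lagFun fun t => (X t ω, σ t ω)) ^ κ ∂μ ≠ ∞ := by
  obtain ⟨n, hn, hlt⟩ := h.exists_lintegral_response_lt_one hθ hp
  have hn0 : 0 < n := by omega
  have hκ0 : 0 < (n : ℝ)⁻¹ := by positivity
  have hκ1 : (n : ℝ)⁻¹ ≤ 1 := inv_le_one_of_one_le₀ (by exact_mod_cast hn0)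
  have hφ : Measurable fun x : ℝ => ENNReal.ofReal x ^ ((n : ℝ)⁻¹) :=
    ENNReal.measurable_ofReal.pow_const _
  have hZ : ∀ u : ℕ, Measurable (Z u) := fun u => h.noise.measurable u
  obtain ⟨g, hgm, hg⟩ := h.exists_noisePast_lagFun
  refine ⟨(n : ℝ)⁻¹, hκ0, hκ1, lintegral_ne_top_of_affine_bound
    (hφ.comp (θ.measurable_lagFun.comp h.measurable_pathMap)).aemeasurable
    (hφ.comp (measurable_response hZ n))
    (hφ.comp (measurable_const.mul (measurable_forcing hZ n)))
    (h.identDistrib_pathShift (hφ.comp θ.measurable_lagFun) n)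
    ((h.indepFun_of_measurable
      (measurable_response (fun u => measurable_noiseFuture (by omega)) n) hgm hg).comp hφ hφ)
    (ae_of_all _ fun ω => ENNReal.rpow_ne_top_of_nonneg hκ0.le ENNReal.ofReal_ne_top)
    ?_ hlt (h.lintegral_forcing_rpow_ne_top hθ hp hn)⟩
  filter_upwards [h.ae_isPath] with ω hω
  have hforc := mul_nonneg hθ.1.le (hω.forcing_nonneg hθ hp n)
  have hresp := hω.response_nonneg hθ hp n
  simp only [Function.comp_apply]
  calc ENNReal.ofReal (θ.lagFun (pathShift n fun t => (X t ω, σ t ω))) ^ ((n : ℝ)⁻¹) ≤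
      (ENNReal.ofReal (θ.alphaZero * θ.forcing (fun t => Z t ω) n) +
        ENNReal.ofReal (θ.response (fun t => Z t ω) n) *
          ENNReal.ofReal (θ.lagFun fun t => (X t ω, σ t ω))) ^ ((n : ℝ)⁻¹) := by
        rw [← ENNReal.ofReal_mul hresp,
          ← ENNReal.ofReal_add hforc (mul_nonneg hresp (hω.lagFun_nonneg hθ hp))]
        exact ENNReal.rpow_le_rpow
          (ENNReal.ofReal_le_ofReal (hω.lagFun_pathShift_le hθ hp hn)) hκ0.le
    _ ≤ _ := by
        rw [← ENNReal.mul_rpow_of_nonneg _ _ hκ0.le]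
        exact ENNReal.rpow_add_le_add_rpow _ _ hκ0.le hκ1

theorem exists_lintegral_vol_rpow_ne_top (h : IsStationaryAGARCH μ θ Z X σ)
    (hθ : θ ∈ space p q) (hp : 0 < p) :
    ∃ κ : ℝ, 0 < κ ∧ κ ≤ 1 ∧ ∫⁻ ω, ENNReal.ofReal (σ 0 ω ^ 2) ^ κ ∂μ ≠ ∞ := by
  obtain ⟨κ, hκ0, hκ1, hlag⟩ := h.exists_lintegral_lagFun_rpow_ne_top hθ hp
  refine ⟨κ, hκ0, hκ1, ne_top_of_le_ne_top (b := ∫⁻ ω, (ENNReal.ofReal θ.alphaZero ^ κ +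
    ENNReal.ofReal (θ.lagFun fun t => (X t ω, σ t ω)) ^ κ) ∂μ) ?_
    (lintegral_mono_ae (h.ae_isPath.mono fun ω hω => ?_))⟩
  · rw [lintegral_add_left measurable_const, lintegral_const, measure_univ, mul_one]
    exact ENNReal.add_ne_top.2
      ⟨ENNReal.rpow_ne_top_of_nonneg hκ0.le ENNReal.ofReal_ne_top, hlag⟩
  · exact (ENNReal.rpow_le_rpow ((ENNReal.ofReal_le_ofReal (hω.sq_le hθ hp)).trans
      ENNReal.ofReal_add_le) hκ0.le).trans (ENNReal.rpow_add_le_add_rpow _ _ hκ0.le hκ1)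

theorem lintegral_obs_rpow_ne_top (h : IsStationaryAGARCH μ θ Z X σ) {κ : ℝ} (hκ0 : 0 < κ)
    (hκ1 : κ ≤ 1) (hσ : ∫⁻ ω, ENNReal.ofReal (σ 0 ω ^ 2) ^ κ ∂μ ≠ ∞) :
    ∫⁻ ω, ENNReal.ofReal (X 0 ω ^ 2) ^ κ ∂μ ≠ ∞ := by
  have hφ : Measurable fun x : ℝ => ENNReal.ofReal (x ^ 2) ^ κ := by fun_prop
  obtain ⟨g, hgm, hg⟩ := h.vol_adapted 0
  have hind : IndepFun (Z 0) (σ 0) μ :=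
    h.indepFun_of_measurable (measurable_noiseFuture (by omega)) hgm hg
  have hZ : ∫⁻ ω, ENNReal.ofReal (Z 0 ω ^ 2) ^ κ ∂μ ≠ ∞ := by
    refine ne_top_of_le_ne_top (b := ∫⁻ ω, (1 + ENNReal.ofReal (Z 0 ω ^ 2)) ∂μ) ?_
      (lintegral_mono fun ω => ?_)
    · rw [lintegral_add_left measurable_const, lintegral_const, measure_univ, mul_one]
      exact ENNReal.add_ne_top.2
        ⟨ENNReal.one_ne_top, (h.integrable_sq_noise 0).lintegral_lt_top.ne⟩
    · rcases le_total (ENNReal.ofReal (Z 0 ω ^ 2)) 1 with hZ | hZ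
      · exact (ENNReal.rpow_le_one hZ hκ0.le).trans le_self_add
      · exact ((ENNReal.rpow_le_rpow_of_exponent_le hZ hκ1).trans_eq
          (ENNReal.rpow_one _)).trans le_add_self
  calc ∫⁻ ω, ENNReal.ofReal (X 0 ω ^ 2) ^ κ ∂μ =
      ∫⁻ ω, ENNReal.ofReal (Z 0 ω ^ 2) ^ κ * ENNReal.ofReal (σ 0 ω ^ 2) ^ κ ∂μ := by
        refine lintegral_congr_ae ((h.obs_eq 0).mono fun ω hω => ?_)
        simp only [hω, mul_pow, mul_comm (σ 0 ω ^ 2), ENNReal.ofReal_mul (sq_nonneg (Z 0 ω)),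
          ENNReal.mul_rpow_of_nonneg _ _ hκ0.le]
    _ = (∫⁻ ω, ENNReal.ofReal (Z 0 ω ^ 2) ^ κ ∂μ) * ∫⁻ ω, ENNReal.ofReal (σ 0 ω ^ 2) ^ κ ∂μ :=
        lintegral_mul_eq_lintegral_mul_lintegral_of_indepFun''
          (hφ.comp (h.noise.measurable 0)).aemeasurable
          (hφ.comp (h.measurable_vol 0)).aemeasurable (hind.comp hφ hφ)
    _ ≠ ∞ := ENNReal.mul_ne_top hZ hσ

end IsStationaryAGARCH

/-! ### The stationary approximation of the volatility recursion -/

theorem abs_le_of_contracting_recursion {q : ℕ} {b : ℕ → ℝ} {ρ : ℝ} (hρ0 : 0 ≤ ρ) (hρ1 : ρ ≤ 1)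
    (hb : ∀ j, 0 ≤ b j) (hsum : ∑ j ∈ Finset.range q, b j ≤ ρ ^ (q + 1)) {d : ℤ → ℝ} {s : ℤ}
    (hd : ∀ n : ℕ, d (s + 1 + n) = ∑ j ∈ Finset.range q, b j * d (s + n - j)) (n : ℕ) :
    |d (s + 1 + n)| ≤ ρ ^ (n + 1) * ∑ j ∈ Finset.range q, |d (s - j)| := by
  set M := ∑ j ∈ Finset.range q, |d (s - j)|
  have hM0 : 0 ≤ M := Finset.sum_nonneg fun _ _ => abs_nonneg _
  induction n using Nat.strong_induction_on with
  | _ n ih =>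
    have hterm : ∀ j ∈ Finset.range q, |b j * d (s + n - j)| ≤ b j * (ρ ^ (n - j) * M) := by
      intro j hj
      rw [abs_mul, abs_of_nonneg (hb j)]
      refine mul_le_mul_of_nonneg_left ?_ (hb j)
      rcases lt_or_ge j n with hjn | hjn
      · have hprev := ih (n - j - 1) (by omega)
        have hidx : s + 1 + ((n - j - 1 : ℕ) : ℤ) = s + n - j := by omega
        rwa [hidx, show n - j - 1 + 1 = n - j by omega] at hprev
      · rw [Nat.sub_eq_zero_of_le hjn, pow_zero, one_mul]
        have hidx : s + (n : ℤ) - j = s - ((j - n : ℕ) : ℤ) := by omega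
        rw [hidx]
        have hj' := Finset.mem_range.1 hj
        exact Finset.single_le_sum (f := fun j : ℕ => |d (s - j)|) (fun _ _ => abs_nonneg _)
          (Finset.mem_range.2 (by omega))
    rw [hd n]
    calc |∑ j ∈ Finset.range q, b j * d (s + n - j)|
        ≤ ∑ j ∈ Finset.range q, b j * (ρ ^ (n - j) * M) :=
          (Finset.abs_sum_le_sum_abs _ _).trans (Finset.sum_le_sum hterm)
      _ ≤ ∑ j ∈ Finset.range q, b j * (ρ ^ (n + 1 - q) * M) := by
          refine Finset.sum_le_sum fun j hj => ?_
          have hj' := Finset.mem_range.1 hj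
          refine mul_le_mul_of_nonneg_left (mul_le_mul_of_nonneg_right ?_ hM0) (hb j)
          exact pow_le_pow_of_le_one hρ0 hρ1 (by omega)
      _ ≤ ρ ^ (q + 1) * (ρ ^ (n + 1 - q) * M) := by
          rw [← Finset.sum_mul]
          exact mul_le_mul_of_nonneg_right hsum (by positivity)
      _ = ρ ^ (q + 1 + (n + 1 - q)) * M := by rw [pow_add _ (q + 1), mul_assoc]
      _ ≤ ρ ^ (n + 1) * M :=
          mul_le_mul_of_nonneg_right (pow_le_pow_of_le_one hρ0 hρ1 (by omega)) hM0

theorem hasSum_ite_lt_sub {M : Type*} [AddCommGroup M] [TopologicalSpace M]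
    [IsTopologicalAddGroup M] {f : ℕ → M} {s : M} (hf : HasSum f s) (j : ℕ) :
    HasSum (fun k => if j < k then f (k - 1 - j) else 0) s := by
  have hzero : ∑ k ∈ Finset.range (j + 1), (if j < k then f (k - 1 - j) else 0) = 0 :=
    Finset.sum_eq_zero fun k hk => if_neg (by have := Finset.mem_range.1 hk; omega)
  rw [← hasSum_nat_add_iff' (j + 1), hzero, sub_zero]
  refine hf.congr_fun fun k => ?_
  rw [if_pos (by omega), show k + (j + 1) - 1 - j = k by omega]

theorem exists_le_pow_of_lt_one {b : ℝ} (hb : b < 1) (n : ℕ) :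
    ∃ ρ : ℝ, 0 < ρ ∧ ρ < 1 ∧ b ≤ ρ ^ n := by
  have hlim : Tendsto (fun ρ : ℝ => ρ ^ n) (𝓝[<] 1) (𝓝 1) :=
    ((continuous_pow n).tendsto' 1 1 (one_pow n)).mono_left nhdsWithin_le_nhds
  obtain ⟨ρ, hbρ, hρ0, hρ1⟩ :=
    ((hlim.eventually_const_le hb).and (Ioo_mem_nhdsLT zero_lt_one)).exists
  exact ⟨ρ, hρ0, hρ1, hbρ⟩

namespace AGARCHParam

variable {p q : ℕ}

/-- The coefficients of the power series `a(z) / (z b(z))`; index `k` belongs to lag `k + 1`. -/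
def archCoeff (θ : AGARCHParam p q) (k : ℕ) : ℝ :=
  volterra (fun n u => θ.betaN (n - 1 - u)) θ.alphaN k

theorem archCoeff_eq_add_sum (θ : AGARCHParam p q) (k : ℕ) :
    θ.archCoeff k = θ.alphaN k + ∑ u ∈ Finset.range k, θ.betaN (k - 1 - u) * θ.archCoeff u :=
  volterra.eq_add_sum k

theorem archCoeff_eq_add_sum_beta (θ : AGARCHParam p q) (k : ℕ) :
    θ.archCoeff k = θ.alphaN k +
      ∑ j ∈ Finset.range q, if j < k then θ.betaN j * θ.archCoeff (k - 1 - j) else 0 := by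
  rw [archCoeff_eq_add_sum, ← Finset.sum_range_reflect, ← Finset.sum_filter]
  congr 1
  calc ∑ j ∈ Finset.range k, θ.betaN (k - 1 - (k - 1 - j)) * θ.archCoeff (k - 1 - j) =
      ∑ j ∈ Finset.range k, θ.betaN j * θ.archCoeff (k - 1 - j) := by
        refine Finset.sum_congr rfl fun j hj => ?_
        have := Finset.mem_range.1 hj
        rw [show k - 1 - (k - 1 - j) = j by omega]
    _ = ∑ j ∈ Finset.range q with j < k, θ.betaN j * θ.archCoeff (k - 1 - j) := by
        refine (Finset.sum_subset (fun j hj => Finset.mem_range.2 (Finset.mem_filter.1 hj).2)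
          fun j hj hj' => ?_).symm
        rw [betaN_of_le, zero_mul]
        by_contra! hlt
        exact hj' (Finset.mem_filter.2 ⟨Finset.mem_range.2 hlt, Finset.mem_range.1 hj⟩)

theorem archCoeff_nonneg {θ : AGARCHParam p q} (hθ : θ ∈ space p q) (k : ℕ) :
    0 ≤ θ.archCoeff k :=
  volterra.nonneg (fun _ _ => betaN_nonneg hθ _) (alphaN_nonneg hθ) k

theorem alphaN_le_archCoeff {θ : AGARCHParam p q} (hθ : θ ∈ space p q) (k : ℕ) :
    θ.alphaN k ≤ θ.archCoeff k := by
  rw [archCoeff_eq_add_sum]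
  exact le_add_of_nonneg_right (Finset.sum_nonneg fun _ _ =>
    mul_nonneg (betaN_nonneg hθ _) (archCoeff_nonneg hθ _))

/-- The constant term of the stationary volatility. -/
def volConst (θ : AGARCHParam p q) : ℝ := θ.alphaZero / (1 - ∑ j ∈ Finset.range q, θ.betaN j)

/-- The stationary solution of the volatility recursion with parameter `θ` driven by the
observations `x`. -/
def statVol (θ : AGARCHParam p q) (x : ℤ → ℝ) (t : ℤ) : ℝ :=
  θ.volConst + ∑' k : ℕ, θ.archCoeff k * asymSq θ.gamma (x (t - 1 - k))

/-- Bounds which hold uniformly on a set of parameters. -/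
structure UnifBounds (K : Set (AGARCHParam p q)) (a A ρ : ℝ) : Prop where
  subset : K ⊆ space p q
  a_pos : 0 < a
  rho_pos : 0 < ρ
  rho_lt_one : ρ < 1
  le_alphaZero : ∀ θ ∈ K, a ≤ θ.alphaZero
  alphaZero_le : ∀ θ ∈ K, θ.alphaZero ≤ A
  sum_beta_le : ∀ θ ∈ K, ∑ j ∈ Finset.range q, θ.betaN j ≤ ρ ^ (q + 1)
  alphaN_le : ∀ θ ∈ K, ∀ i, θ.alphaN i ≤ A
  nonneg : 0 ≤ A

theorem continuous_alphaN (i : ℕ) : Continuous fun θ : AGARCHParam p q => θ.alphaN i := by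
  unfold alphaN alpha
  split_ifs <;> fun_prop

theorem continuous_betaN (j : ℕ) : Continuous fun θ : AGARCHParam p q => θ.betaN j := by
  unfold betaN beta
  split_ifs <;> fun_prop

theorem continuous_alphaZero : Continuous fun θ : AGARCHParam p q => θ.alphaZero := by
  unfold alphaZero
  fun_prop

theorem continuous_gamma : Continuous fun θ : AGARCHParam p q => θ.gamma := by
  unfold gamma
  fun_prop

theorem continuous_archCoeff (k : ℕ) : Continuous fun θ : AGARCHParam p q => θ.archCoeff k := by
  induction k using Nat.strong_induction_on with
  | _ k ih =>
    rw [funext fun θ : AGARCHParam p q => θ.archCoeff_eq_add_sum k]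
    exact (continuous_alphaN k).add (continuous_finsetSum _ fun u hu =>
      (continuous_betaN _).mul (ih u (Finset.mem_range.1 hu)))

theorem sum_betaN_lt_one {θ : AGARCHParam p q} (hθ : θ ∈ space p q) :
    ∑ j ∈ Finset.range q, θ.betaN j < 1 := by
  rw [sum_betaN]
  exact hθ.2.2.1.2

theorem volConst_eq {θ : AGARCHParam p q} (hθ : θ ∈ space p q) :
    θ.volConst = θ.alphaZero + (∑ j ∈ Finset.range q, θ.betaN j) * θ.volConst := by
  have : 1 - ∑ j ∈ Finset.range q, θ.betaN j ≠ 0 := (sub_pos.2 (sum_betaN_lt_one hθ)).ne'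
  unfold volConst
  field_simp
  ring

theorem exists_unifBounds {K : Set (AGARCHParam p q)} (hK : IsCompact K) (hne : K.Nonempty)
    (hsub : K ⊆ space p q) : ∃ a A ρ, UnifBounds K a A ρ := by
  obtain ⟨θmin, hθmin, hmin⟩ := hK.exists_isMinOn hne continuous_alphaZero.continuousOn
  obtain ⟨θmax, hθmax, hmax⟩ := hK.exists_isMaxOn hne
    (continuous_finsetSum _ fun j _ => continuous_betaN j :
      Continuous fun θ : AGARCHParam p q => ∑ j ∈ Finset.range q, θ.betaN j).continuousOn
  obtain ⟨A, hA⟩ := hK.bddAbove_image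
    (continuous_alphaZero.add (continuous_finsetSum _ fun i _ => continuous_alphaN i) :
      Continuous fun θ : AGARCHParam p q =>
        θ.alphaZero + ∑ i ∈ Finset.range p, θ.alphaN i).continuousOn
  replace hA : ∀ θ ∈ K, θ.alphaZero + ∑ i ∈ Finset.range p, θ.alphaN i ≤ A :=
    fun θ hθ => hA (Set.mem_image_of_mem _ hθ)
  obtain ⟨ρ, hρ0, hρ1, hρ⟩ := exists_le_pow_of_lt_one (sum_betaN_lt_one (hsub hθmax)) (q + 1)
  have hα : ∀ θ ∈ K, ∀ i, 0 ≤ θ.alphaN i := fun θ hθ => alphaN_nonneg (hsub hθ)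
  have hα₀A : ∀ θ ∈ K, θ.alphaZero ≤ A := fun θ hθ =>
    (le_add_of_nonneg_right (Finset.sum_nonneg fun i _ => hα θ hθ i)).trans (hA θ hθ)
  have hA0 : 0 ≤ A := (hsub hθmin).1.le.trans (hα₀A _ hθmin)
  refine ⟨θmin.alphaZero, A, ρ, hsub, (hsub hθmin).1, hρ0, hρ1, fun θ hθ => hmin hθ,
    hα₀A, fun θ hθ => (hmax hθ : _ ≤ _).trans hρ, fun θ hθ i => ?_, hA0⟩
  rcases lt_or_ge i p with hi | hi
  · refine le_trans ?_ ((le_add_of_nonneg_left (hsub hθ).1.le).trans (hA θ hθ))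
    exact Finset.single_le_sum (fun i _ => hα θ hθ i) (Finset.mem_range.2 hi)
  · exact (alphaN_of_le θ hi).trans_le hA0

/-- The functional of the past observations of which, on a set of parameters with `UnifBounds`, the
stationary volatility is bounded by a multiple. -/
def pathDom (ρ : ℝ) (x : ℤ → ℝ) (t : ℤ) : ℝ := ∑' k : ℕ, ρ ^ k * (1 + x (t - 1 - k) ^ 2)

/-- The observations grow slowly enough for `pathDom ρ` to be finite. -/
def TemperedPath (ρ : ℝ) (x : ℤ → ℝ) : Prop :=
  ∀ t : ℤ, Summable fun k : ℕ => ρ ^ k * (1 + x (t - 1 - k) ^ 2)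

theorem asymSq_le_of_mem {θ : AGARCHParam p q} (hθ : θ ∈ space p q) (x : ℝ) :
    asymSq θ.gamma x ≤ 4 * x ^ 2 := by
  refine (asymSq_le _ _).trans ?_
  have : |θ.gamma| ≤ 1 := abs_le.2 hθ.2.2.2
  have h0 := abs_nonneg θ.gamma
  gcongr
  nlinarith

namespace UnifBounds

variable {K : Set (AGARCHParam p q)} {a A ρ : ℝ} {θ : AGARCHParam p q}

/-- The constant of the bound `archCoeff θ k ≤ archBound p A ρ * ρ ^ k`. -/
def archBound (p : ℕ) (A ρ : ℝ) : ℝ := A / (ρ ^ p * (1 - ρ))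

theorem archBound_nonneg (h : UnifBounds K a A ρ) : 0 ≤ archBound p A ρ := by
  have := h.rho_pos
  have hρ1 := sub_pos.2 h.rho_lt_one
  exact div_nonneg h.nonneg (by positivity)

theorem sum_betaN_mul_pow_le (h : UnifBounds K a A ρ) (hθ : θ ∈ K) (k : ℕ) :
    ∑ u ∈ Finset.range k, θ.betaN (k - 1 - u) * ρ ^ u ≤ ρ ^ (k + 1) := by
  have hρ := h.rho_pos
  have hβ := betaN_nonneg (h.subset hθ)
  calc ∑ u ∈ Finset.range k, θ.betaN (k - 1 - u) * ρ ^ u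
      ≤ ∑ u ∈ Finset.range k, θ.betaN (k - 1 - u) * ρ ^ (k - q) := by
        refine Finset.sum_le_sum fun u _ => ?_
        rcases lt_or_ge u (k - q) with hu | hu
        · rw [betaN_of_le θ (by omega), zero_mul, zero_mul]
        · exact mul_le_mul_of_nonneg_left
            (pow_le_pow_of_le_one hρ.le h.rho_lt_one.le hu) (hβ _)
    _ = (∑ j ∈ Finset.range k, θ.betaN j) * ρ ^ (k - q) := by
        rw [← Finset.sum_mul, Finset.sum_range_reflect (fun j => θ.betaN j)]
    _ ≤ (∑ j ∈ Finset.range q, θ.betaN j) * ρ ^ (k - q) := by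
        refine mul_le_mul_of_nonneg_right ?_ (by positivity)
        rcases le_total k q with hkq | hkq
        · exact Finset.sum_le_sum_of_subset_of_nonneg (Finset.range_mono hkq) fun j _ _ => hβ j
        · exact (Finset.sum_subset (Finset.range_mono hkq) fun j _ hj =>
            betaN_of_le θ (not_lt.1 fun hjq => hj (Finset.mem_range.2 hjq))).ge
    _ ≤ ρ ^ (q + 1) * ρ ^ (k - q) :=
        mul_le_mul_of_nonneg_right (h.sum_beta_le θ hθ) (by positivity)
    _ ≤ ρ ^ (k + 1) := by
        rw [← pow_add]
        exact pow_le_pow_of_le_one hρ.le h.rho_lt_one.le (by omega)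

theorem alphaN_le_archBound_mul (h : UnifBounds K a A ρ) (hθ : θ ∈ K) (k : ℕ) :
    θ.alphaN k ≤ archBound p A ρ * ρ ^ k * (1 - ρ) := by
  have hρ := h.rho_pos
  have hρ1 := sub_pos.2 h.rho_lt_one
  have hD := h.archBound_nonneg
  rcases lt_or_ge k p with hk | hk
  · calc θ.alphaN k ≤ A := h.alphaN_le θ hθ k
      _ = archBound p A ρ * ρ ^ p * (1 - ρ) := by
        unfold archBound
        field_simp
      _ ≤ archBound p A ρ * ρ ^ k * (1 - ρ) := by
        gcongr archBound p A ρ * ?_ * _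
        exact pow_le_pow_of_le_one hρ.le h.rho_lt_one.le hk.le
  · rw [alphaN_of_le θ hk]
    positivity

theorem archCoeff_le (h : UnifBounds K a A ρ) (hθ : θ ∈ K) (k : ℕ) :
    θ.archCoeff k ≤ archBound p A ρ * ρ ^ k := by
  refine volterra.le_of_ge (x := fun k => archBound p A ρ * ρ ^ k)
    (fun _ _ => betaN_nonneg (h.subset hθ) _) (fun k => ?_) k
  calc θ.alphaN k +
      ∑ u ∈ Finset.range k, θ.betaN (k - 1 - u) * (archBound p A ρ * ρ ^ u) =
      θ.alphaN k +
        archBound p A ρ * ∑ u ∈ Finset.range k, θ.betaN (k - 1 - u) * ρ ^ u := by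
        simp only [Finset.mul_sum, mul_left_comm]
    _ ≤ archBound p A ρ * ρ ^ k * (1 - ρ) + archBound p A ρ * ρ ^ (k + 1) :=
        add_le_add (h.alphaN_le_archBound_mul hθ k)
          (mul_le_mul_of_nonneg_left (h.sum_betaN_mul_pow_le hθ k) h.archBound_nonneg)
    _ = archBound p A ρ * ρ ^ k := by ring

theorem sum_betaN_lt_one (h : UnifBounds K a A ρ) (hθ : θ ∈ K) :
    ∑ j ∈ Finset.range q, θ.betaN j < 1 :=
  AGARCHParam.sum_betaN_lt_one (h.subset hθ)

theorem le_volConst (h : UnifBounds K a A ρ) (hθ : θ ∈ K) : a ≤ θ.volConst := by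
  have hβ1 := h.sum_betaN_lt_one hθ
  have hβ0 : 0 ≤ ∑ j ∈ Finset.range q, θ.betaN j :=
    Finset.sum_nonneg fun j _ => betaN_nonneg (h.subset hθ) j
  refine (h.le_alphaZero θ hθ).trans ?_
  unfold volConst
  rw [le_div_iff₀ (by linarith)]
  nlinarith [(h.subset hθ).1]

theorem archCoeff_mul_asymSq_le (h : UnifBounds K a A ρ) (hθ : θ ∈ K) (k : ℕ) (y : ℝ) :
    θ.archCoeff k * asymSq θ.gamma y ≤ 4 * archBound p A ρ * (ρ ^ k * (1 + y ^ 2)) := by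
  have hD := h.archBound_nonneg
  have hρ := h.rho_pos
  calc θ.archCoeff k * asymSq θ.gamma y ≤ (archBound p A ρ * ρ ^ k) * (4 * (1 + y ^ 2)) :=
        mul_le_mul (h.archCoeff_le hθ k) ((asymSq_le_of_mem (h.subset hθ) y).trans (by linarith))
          (asymSq_nonneg _ _) (by positivity)
    _ = 4 * archBound p A ρ * (ρ ^ k * (1 + y ^ 2)) := by ring

theorem summable_archCoeff (h : UnifBounds K a A ρ) (hθ : θ ∈ K) {x : ℤ → ℝ}
    (hx : TemperedPath ρ x) (t : ℤ) :
    Summable fun k : ℕ => θ.archCoeff k * asymSq θ.gamma (x (t - 1 - k)) :=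
  Summable.of_nonneg_of_le
    (fun k => mul_nonneg (archCoeff_nonneg (h.subset hθ) k) (asymSq_nonneg _ _))
    (fun k => h.archCoeff_mul_asymSq_le hθ k _) ((hx t).mul_left _)

theorem le_statVol (h : UnifBounds K a A ρ) (hθ : θ ∈ K) (x : ℤ → ℝ) (t : ℤ) :
    a ≤ θ.statVol x t :=
  (h.le_volConst hθ).trans (le_add_of_nonneg_right (tsum_nonneg fun k =>
    mul_nonneg (archCoeff_nonneg (h.subset hθ) k) (asymSq_nonneg _ _)))

theorem statVol_pos (h : UnifBounds K a A ρ) (hθ : θ ∈ K) (x : ℤ → ℝ) (t : ℤ) :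
    0 < θ.statVol x t :=
  h.a_pos.trans_le (h.le_statVol hθ x t)

theorem statVol_eq (h : UnifBounds K a A ρ) (hθ : θ ∈ K) {x : ℤ → ℝ}
    (hx : TemperedPath ρ x) (t : ℤ) :
    θ.statVol x t = θ.alphaZero +
      ∑ i ∈ Finset.range p, θ.alphaN i * asymSq θ.gamma (x (t - 1 - i)) +
      ∑ j ∈ Finset.range q, θ.betaN j * θ.statVol x (t - 1 - j) := by
  set y : ℕ → ℝ := fun k => asymSq θ.gamma (x (t - 1 - k))
  have hα : HasSum (fun k : ℕ => θ.alphaN k * y k) (∑ i ∈ Finset.range p, θ.alphaN i * y i) :=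
    hasSum_sum_of_ne_finset_zero fun k hk => by
      rw [alphaN_of_le θ (not_lt.1 fun hkp => hk (Finset.mem_range.2 hkp)), zero_mul]
  have hshift : ∀ j : ℕ, HasSum (fun k : ℕ => if j < k then θ.archCoeff (k - 1 - j) * y k else 0)
      (∑' k : ℕ, θ.archCoeff k * asymSq θ.gamma (x (t - 1 - j - 1 - k))) := fun j => by
    refine (hasSum_ite_lt_sub (h.summable_archCoeff hθ hx (t - 1 - j)).hasSum j).congr_fun
      fun k => ?_
    split_ifs with hjk
    · rw [show t - 1 - j - 1 - ((k - 1 - j : ℕ) : ℤ) = t - 1 - k by omega]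
    · rfl
  have hsum : HasSum (fun k : ℕ => θ.archCoeff k * y k)
      (∑ i ∈ Finset.range p, θ.alphaN i * y i + ∑ j ∈ Finset.range q, θ.betaN j *
        ∑' k : ℕ, θ.archCoeff k * asymSq θ.gamma (x (t - 1 - j - 1 - k))) := by
    refine (hα.add (hasSum_sum fun j _ => (hshift j).mul_left (θ.betaN j))).congr_fun fun k => ?_
    rw [archCoeff_eq_add_sum_beta, add_mul, Finset.sum_mul]
    congr 1
    refine Finset.sum_congr rfl fun j _ => ?_
    split_ifs <;> ring
  have hconst := volConst_eq (h.subset hθ)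
  unfold statVol
  rw [hsum.tsum_eq]
  simp only [mul_add, Finset.sum_add_distrib, ← Finset.sum_mul]
  linarith

theorem statVol_le (h : UnifBounds K a A ρ) (hθ : θ ∈ K) {x : ℤ → ℝ} (hx : TemperedPath ρ x)
    (t : ℤ) : θ.statVol x t ≤ A / (1 - ρ) + 4 * archBound p A ρ * pathDom ρ x t := by
  have hβ : ∑ j ∈ Finset.range q, θ.betaN j ≤ ρ := (h.sum_beta_le θ hθ).trans
    (pow_le_of_le_one h.rho_pos.le h.rho_lt_one.le (Nat.succ_ne_zero q))
  refine add_le_add (div_le_div₀ h.nonneg (h.alphaZero_le θ hθ) (sub_pos.2 h.rho_lt_one)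
    (sub_le_sub_left hβ 1)) ?_
  rw [pathDom, ← tsum_mul_left]
  exact (h.summable_archCoeff hθ hx t).tsum_le_tsum
    (fun k => h.archCoeff_mul_asymSq_le hθ k _) ((hx t).mul_left _)

end UnifBounds

end AGARCHParam

namespace AGARCHParam

variable {p q : ℕ}

theorem asymSq_eq (γ x : ℝ) : asymSq γ x = (1 + γ ^ 2) * x ^ 2 - 2 * γ * (x * |x|) := by
  unfold asymSq
  rw [sub_sq, sq_abs]
  ring

theorem abs_mul_asymSq_sub_le (c c' γ γ' x : ℝ) : |c * asymSq γ x - c' * asymSq γ' x| ≤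
    (|c * (1 + γ ^ 2) - c' * (1 + γ' ^ 2)| + 2 * |c * γ - c' * γ'|) * x ^ 2 := by
  have hdiff : c * asymSq γ x - c' * asymSq γ' x =
      (c * (1 + γ ^ 2) - c' * (1 + γ' ^ 2)) * x ^ 2 - 2 * (c * γ - c' * γ') * (x * |x|) := by
    rw [asymSq_eq, asymSq_eq]
    ring
  rw [hdiff]
  refine (abs_sub _ _).trans_eq ?_
  have habs : abs (x * |x|) = x ^ 2 := by rw [abs_mul, abs_abs, ← sq, sq_abs]
  rw [abs_mul, abs_mul (2 * _), habs, abs_mul 2, abs_of_nonneg (sq_nonneg x), abs_two]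
  ring

theorem TemperedPath.mono {ρ ρ' : ℝ} (hρ : 0 ≤ ρ) (hle : ρ ≤ ρ') {x : ℤ → ℝ}
    (hx : TemperedPath ρ' x) : TemperedPath ρ x := fun t =>
  Summable.of_nonneg_of_le (fun k => by positivity) (fun k => by gcongr) (hx t)

/-- A distance between the terms of order `k` of `statVol` for two parameters: the absolute
difference of these terms is at most `archDist θ θ₁ k * x ^ 2`. -/
def archDist (θ θ₁ : AGARCHParam p q) (k : ℕ) : ℝ :=
  |θ.archCoeff k * (1 + θ.gamma ^ 2) - θ₁.archCoeff k * (1 + θ₁.gamma ^ 2)| +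
    2 * |θ.archCoeff k * θ.gamma - θ₁.archCoeff k * θ₁.gamma|

theorem tendsto_archDist (θ₁ : AGARCHParam p q) (k : ℕ) :
    Tendsto (fun θ => archDist θ θ₁ k) (𝓝 θ₁) (𝓝 0) := by
  have hcoeff := continuous_archCoeff (p := p) (q := q) k
  have hgamma := continuous_gamma (p := p) (q := q)
  refine Continuous.tendsto' ?_ _ _
    (by simp only [archDist, sub_self, abs_zero, mul_zero, add_zero])
  unfold archDist
  fun_prop

namespace UnifBounds

variable {K : Set (AGARCHParam p q)} {a A ρ : ℝ} {θ θ₁ : AGARCHParam p q}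

theorem archDist_le (h : UnifBounds K a A ρ) (hθ : θ ∈ K) (hθ₁ : θ₁ ∈ K) (k : ℕ) :
    archDist θ θ₁ k ≤ 8 * archBound p A ρ * ρ ^ k := by
  have hc := h.archCoeff_le hθ k
  have hc₁ := h.archCoeff_le hθ₁ k
  have hc0 := archCoeff_nonneg (h.subset hθ) k
  have hc0₁ := archCoeff_nonneg (h.subset hθ₁) k
  obtain ⟨hγ, hγ'⟩ := (h.subset hθ).2.2.2
  obtain ⟨hγ₁, hγ₁'⟩ := (h.subset hθ₁).2.2.2
  have hsq : θ.gamma ^ 2 ≤ 1 := by nlinarith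
  have hsq₁ : θ₁.gamma ^ 2 ≤ 1 := by nlinarith
  have heven : |θ.archCoeff k * (1 + θ.gamma ^ 2) - θ₁.archCoeff k * (1 + θ₁.gamma ^ 2)| ≤
      2 * (archBound p A ρ * ρ ^ k) := by
    rw [abs_le]
    constructor <;> nlinarith [sq_nonneg θ.gamma, sq_nonneg θ₁.gamma]
  have hodd : |θ.archCoeff k * θ.gamma - θ₁.archCoeff k * θ₁.gamma| ≤
      2 * (archBound p A ρ * ρ ^ k) := by
    rw [abs_le]
    constructor <;> nlinarith
  unfold archDist
  linarith

theorem eventually_archDist_le (h : UnifBounds K a A ρ) {ρ' : ℝ} (hρ' : ρ < ρ') (hθ₁ : θ₁ ∈ K)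
    {η : ℝ} (hη : 0 < η) : ∀ᶠ θ in 𝓝[K] θ₁, ∀ k, archDist θ θ₁ k ≤ η * ρ' ^ k := by
  have hρ'0 : 0 < ρ' := h.rho_pos.trans hρ'
  have hlim : Tendsto (fun k : ℕ => 8 * archBound p A ρ * (ρ / ρ') ^ k) atTop (𝓝 0) := by
    simpa only [mul_zero] using (tendsto_pow_atTop_nhds_zero_of_lt_one
      (div_nonneg h.rho_pos.le hρ'0.le) ((div_lt_one hρ'0).2 hρ')).const_mul
        (8 * archBound p A ρ)
  obtain ⟨k₀, hk₀⟩ := eventually_atTop.1 (hlim.eventually_le_const hη)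
  have hfin : ∀ᶠ θ in 𝓝[K] θ₁, ∀ k ∈ Finset.range k₀, archDist θ θ₁ k ≤ η * ρ' ^ k :=
    (eventually_all_finset _).2 fun k _ => ((tendsto_archDist θ₁ k).mono_left
      nhdsWithin_le_nhds).eventually_le_const (mul_pos hη (pow_pos hρ'0 k))
  filter_upwards [hfin, self_mem_nhdsWithin] with θ hfirst hθ k
  rcases lt_or_ge k k₀ with hk | hk
  · exact hfirst k (Finset.mem_range.2 hk)
  · have htail := hk₀ k hk
    rw [div_pow, ← mul_div_assoc, div_le_iff₀ (pow_pos hρ'0 k)] at htail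
    exact (h.archDist_le hθ hθ₁ k).trans htail

theorem eventually_abs_volConst_sub_le (h : UnifBounds K a A ρ) (hθ₁ : θ₁ ∈ K) {η : ℝ}
    (hη : 0 < η) : ∀ᶠ θ in 𝓝[K] θ₁, |θ.volConst - θ₁.volConst| ≤ η := by
  have hcont : ContinuousAt (fun θ : AGARCHParam p q => θ.volConst) θ₁ :=
    continuous_alphaZero.continuousAt.div (continuous_const.sub
      (continuous_finsetSum _ fun j _ => continuous_betaN j)).continuousAt
      (sub_pos.2 (h.sum_betaN_lt_one hθ₁)).ne'
  have hlim := (hcont.tendsto.sub_const θ₁.volConst).abs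
  rw [sub_self, abs_zero] at hlim
  exact (hlim.mono_left nhdsWithin_le_nhds).eventually_le_const hη

theorem abs_statVol_sub_le (h : UnifBounds K a A ρ) (hθ : θ ∈ K) (hθ₁ : θ₁ ∈ K) {ρ' η : ℝ}
    (hρ' : ρ ≤ ρ') (hη : 0 ≤ η) (hdist : ∀ k, archDist θ θ₁ k ≤ η * ρ' ^ k)
    (hconst : |θ.volConst - θ₁.volConst| ≤ η) {x : ℤ → ℝ} (hx : TemperedPath ρ' x) (t : ℤ) :
    |θ.statVol x t - θ₁.statVol x t| ≤ η * pathDom ρ' x t := by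
  have hx' := hx.mono h.rho_pos.le hρ'
  have hρ'0 : 0 ≤ ρ' := h.rho_pos.le.trans hρ'
  set d : ℕ → ℝ := fun k => θ.archCoeff k * asymSq θ.gamma (x (t - 1 - k)) -
    θ₁.archCoeff k * asymSq θ₁.gamma (x (t - 1 - k))
  have hd : ∀ k, |d k| ≤ η * ρ' ^ k * x (t - 1 - k) ^ 2 := fun k =>
    (abs_mul_asymSq_sub_le _ _ _ _ _).trans
      (mul_le_mul_of_nonneg_right (hdist k) (sq_nonneg _))
  -- The difference of the constants is absorbed by the term of order zero of `pathDom`.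
  have hsum : HasSum (fun k => (if k = 0 then θ.volConst - θ₁.volConst else 0) + d k)
      (θ.statVol x t - θ₁.statVol x t) := by
    rw [statVol, statVol, add_sub_add_comm]
    exact (hasSum_ite_eq 0 _).add
      ((h.summable_archCoeff hθ hx' t).hasSum.sub (h.summable_archCoeff hθ₁ hx' t).hasSum)
  refine hsum.norm_le_of_bounded ((hx t).hasSum.mul_left η) fun k => ?_
  have hle : ‖if k = 0 then θ.volConst - θ₁.volConst else 0‖ ≤ η * ρ' ^ k := by
    split_ifs with hk
    · rwa [hk, pow_zero, mul_one]
    · rw [norm_zero]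
      positivity
  calc ‖(if k = 0 then θ.volConst - θ₁.volConst else 0) + d k‖
      ≤ η * ρ' ^ k + η * ρ' ^ k * x (t - 1 - k) ^ 2 := norm_add_le_of_le hle (hd k)
    _ = η * (ρ' ^ k * (1 + x (t - 1 - k) ^ 2)) := by ring

theorem eventually_abs_statVol_sub_le (h : UnifBounds K a A ρ) {ρ' : ℝ} (hρ' : ρ < ρ')
    (hθ₁ : θ₁ ∈ K) {η : ℝ} (hη : 0 < η) :
    ∀ᶠ θ in 𝓝[K] θ₁, ∀ x, TemperedPath ρ' x → ∀ t,
      |θ.statVol x t - θ₁.statVol x t| ≤ η * pathDom ρ' x t := by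
  filter_upwards [h.eventually_archDist_le hρ' hθ₁ hη, h.eventually_abs_volConst_sub_le hθ₁ hη,
    self_mem_nhdsWithin] with θ hdist hconst hθ x hx t
  exact h.abs_statVol_sub_le hθ hθ₁ hρ'.le hη.le hdist hconst hx t

end UnifBounds

end AGARCHParam

/-! ### The observable recursion -/

theorem abs_log_sub_log_le {a u v : ℝ} (ha : 0 < a) (hu : a ≤ u) (hv : a ≤ v) :
    |Real.log u - Real.log v| ≤ |u - v| / a := by
  have log_sub_le : ∀ u v : ℝ, a ≤ u → a ≤ v → Real.log u - Real.log v ≤ |u - v| / a := by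
    intro u v hu hv
    have hu0 := ha.trans_le hu
    have hv0 := ha.trans_le hv
    rw [← Real.log_div hu0.ne' hv0.ne']
    refine (Real.log_le_sub_one_of_pos (div_pos hu0 hv0)).trans ?_
    rw [div_sub_one hv0.ne']
    exact (div_le_div_of_nonneg_right (le_abs_self _) hv0.le).trans
      (div_le_div_of_nonneg_left (abs_nonneg _) ha hv)
  rw [abs_le']
  refine ⟨log_sub_le u v hu hv, ?_⟩
  simpa only [neg_sub, abs_sub_comm] using log_sub_le v u hv hu

theorem abs_div_sub_div_le {a u v y : ℝ} (ha : 0 < a) (hu : a ≤ u) (hv : a ≤ v) (hy : 0 ≤ y) :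
    |y / u - y / v| ≤ y * |u - v| / a ^ 2 := by
  have hu0 := ha.trans_le hu
  have hv0 := ha.trans_le hv
  have hdiff : y / u - y / v = y * (v - u) / (u * v) := by
    field_simp
  rw [hdiff, abs_div, abs_mul, abs_of_nonneg hy, abs_of_pos (mul_pos hu0 hv0), abs_sub_comm, sq]
  gcongr

theorem abs_loss_sub_le {a u v y δ : ℝ} (ha : 0 < a) (hu : a ≤ u) (hv : a ≤ v) (hy : 0 ≤ y)
    (hδ : |u - v| ≤ δ) : |(y / u + Real.log u) - (y / v + Real.log v)| ≤
      δ * (1 / a ^ 2 + 1 / a) * (1 + y) := by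
  have hδ0 : 0 ≤ δ := (abs_nonneg _).trans hδ
  have hdiv : |y / u - y / v| ≤ δ * (1 / a ^ 2) * (1 + y) :=
    calc |y / u - y / v| ≤ y * |u - v| / a ^ 2 := abs_div_sub_div_le ha hu hv hy
      _ ≤ (1 + y) * δ / a ^ 2 := by gcongr; linarith
      _ = δ * (1 / a ^ 2) * (1 + y) := by ring
  have hlog : |Real.log u - Real.log v| ≤ δ * (1 / a) * (1 + y) :=
    calc |Real.log u - Real.log v| ≤ δ * (1 / a) := by
          rw [mul_one_div]
          exact (abs_log_sub_log_le ha hu hv).trans (div_le_div_of_nonneg_right hδ ha.le)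
      _ ≤ δ * (1 / a) * (1 + y) := le_mul_of_one_le_right (by positivity) (by linarith)
  rw [add_sub_add_comm]
  refine (abs_add_le _ _).trans ((add_le_add hdiv hlog).trans_eq ?_)
  ring

namespace AGARCHParam

variable {p q : ℕ}

/-- The observable approximation of the volatility, indexed by `ℤ`: the recursion at positive
times, the initial values before. -/
def hHatSeq (θ : AGARCHParam p q) (ς : Fin q → ℝ) (x : ℤ → ℝ) (s : ℤ) : ℝ :=
  if 1 ≤ s then θ.hHatSucc ς x (s - 1).toNat
  else if h : (-s).toNat < q then ς ⟨(-s).toNat, h⟩ else 0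

theorem hHatSeq_succ (θ : AGARCHParam p q) (ς : Fin q → ℝ) (x : ℤ → ℝ) (t : ℕ) :
    θ.hHatSeq ς x (t + 1) = θ.hHatSucc ς x t := by
  rw [hHatSeq, if_pos (by omega)]
  congr 1
  omega

theorem hHatVec_eq_lagVec (θ : AGARCHParam p q) (ς : Fin q → ℝ) (x : ℤ → ℝ) (t : ℕ) :
    θ.hHatVec ς x t = lagVec (θ.hHatSeq ς x) q t := by
  induction t with
  | zero =>
    funext j
    have hj := j.2
    rw [lagVec, hHatSeq, if_neg (by omega), dif_pos (by omega)]
    simp only [hHatVec]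
    congr 1
    ext
    simp
  | succ t ih =>
    funext j
    rw [hHatVec]
    obtain ⟨j, hj⟩ := j
    cases j with
    | zero =>
      simp only [lagVec]
      rw [Nat.cast_zero, sub_zero, Nat.cast_succ, hHatSeq_succ]
      rfl
    | succ j =>
      change Matrix.vecCons (θ.volMap (lagVec x p t) (θ.hHatVec ς x t)) (θ.hHatVec ς x t)
        (Fin.succ ⟨j, by omega⟩) = _
      rw [Matrix.cons_val_succ, ih]
      simp only [lagVec]
      congr 1
      push_cast
      ring

theorem hHatSucc_eq (θ : AGARCHParam p q) (ς : Fin q → ℝ) (x : ℤ → ℝ) (t : ℕ) :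
    θ.hHatSucc ς x t = θ.alphaZero +
      ∑ i ∈ Finset.range p, θ.alphaN i * asymSq θ.gamma (x (t - i)) +
      ∑ j ∈ Finset.range q, θ.betaN j * θ.hHatSeq ς x (t - j) := by
  have hvol := volMap_lagVec θ x (θ.hHatSeq ς x) (t + 1)
  rw [add_sub_cancel_right] at hvol
  rw [hHatSucc, hHatVec_eq_lagVec, hvol]

theorem alphaZero_le_volMap {θ : AGARCHParam p q} (hθ : θ ∈ space p q) (x : Fin p → ℝ)
    {s : Fin q → ℝ} (hs : ∀ j, 0 ≤ s j) : θ.alphaZero ≤ θ.volMap x s := by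
  have harch : 0 ≤ ∑ i, θ.alpha i * (|x i| - θ.gamma * x i) ^ 2 :=
    Finset.sum_nonneg fun i _ => mul_nonneg (hθ.2.1 i) (sq_nonneg _)
  have hgarch : 0 ≤ ∑ j, θ.beta j * s j :=
    Finset.sum_nonneg fun j _ => mul_nonneg (hθ.2.2.1.1 j).1 (hs j)
  unfold volMap
  linarith

theorem hHatVec_nonneg {θ : AGARCHParam p q} (hθ : θ ∈ space p q) {ς : Fin q → ℝ}
    (hς : ∀ j, 0 ≤ ς j) (x : ℤ → ℝ) (t : ℕ) (j : Fin q) : 0 ≤ θ.hHatVec ς x t j := by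
  induction t generalizing j with
  | zero => exact hς j
  | succ t ih =>
    rw [hHatVec]
    exact Fin.cases (motive := fun i => 0 ≤ Matrix.vecCons (θ.volMap (lagVec x p t)
      (θ.hHatVec ς x t)) (θ.hHatVec ς x t) i)
      (hθ.1.le.trans (alphaZero_le_volMap hθ _ ih)) ih j.castSucc

theorem alphaZero_le_hHatSucc {θ : AGARCHParam p q} (hθ : θ ∈ space p q) {ς : Fin q → ℝ}
    (hς : ∀ j, 0 ≤ ς j) (x : ℤ → ℝ) (t : ℕ) : θ.alphaZero ≤ θ.hHatSucc ς x t :=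
  alphaZero_le_volMap hθ _ (hHatVec_nonneg hθ hς x t)

theorem continuous_hHatVec (ς : Fin q → ℝ) (x : ℤ → ℝ) (t : ℕ) (j : Fin q) :
    Continuous fun θ : AGARCHParam p q => θ.hHatVec ς x t j := by
  induction t generalizing j with
  | zero => exact continuous_const
  | succ t ih =>
    simp only [hHatVec]
    refine Fin.cases ?_ (fun i => ?_) j.castSucc
    · simp only [Matrix.cons_val_zero]
      unfold volMap alphaZero alpha beta gamma
      fun_prop
    · simp only [Matrix.cons_val_succ]
      exact ih i

theorem continuous_hHatSucc (ς : Fin q → ℝ) (x : ℤ → ℝ) (t : ℕ) :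
    Continuous fun θ : AGARCHParam p q => θ.hHatSucc ς x t := by
  have hvec := continuous_hHatVec (p := p) ς x t
  unfold hHatSucc volMap alphaZero alpha beta gamma
  fun_prop

theorem exists_isQMLE {K : Set (AGARCHParam p q)} (hK : IsCompact K) (hne : K.Nonempty)
    (hsub : K ⊆ space p q) {ς : Fin q → ℝ} (hς : ∀ j, 0 ≤ ς j) (x : ℤ → ℝ) (n : ℕ) :
    ∃ θ, IsQMLE K ς x n θ := by
  have hpos : ∀ θ ∈ K, ∀ t, θ.hHatSucc ς x t ≠ 0 := fun θ hθ t =>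
    ((hsub hθ).1.trans_le (alphaZero_le_hHatSucc (hsub hθ) hς x t)).ne'
  have hlik : ContinuousOn (logLik ς x n) K := by
    unfold logLik
    refine continuousOn_const.mul (continuousOn_finsetSum _ fun t _ => ?_)
    have hcont := (continuous_hHatSucc (p := p) ς x t).continuousOn (s := K)
    exact (continuousOn_const.div hcont fun θ hθ => hpos θ hθ t).add
      (hcont.log fun θ hθ => hpos θ hθ t)
  obtain ⟨θ, hθ, hmax⟩ := hK.exists_isMaxOn hne hlik
  exact ⟨θ, hθ, hmax⟩

/-- Minus twice the likelihood computed from the stationary volatility. -/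
def statLoss (θ : AGARCHParam p q) (x : ℤ → ℝ) (n : ℕ) : ℝ :=
  ∑ t ∈ Finset.range n,
    (x ((t : ℤ) + 1) ^ 2 / θ.statVol x (t + 1) + Real.log (θ.statVol x (t + 1)))

namespace UnifBounds

variable {K : Set (AGARCHParam p q)} {a A ρ : ℝ}

theorem exists_sum_abs_hHatSeq_sub_le (h : UnifBounds K a A ρ) (ς : Fin q → ℝ) {x : ℤ → ℝ}
    (hx : TemperedPath ρ x) : ∃ C, ∀ θ ∈ K,
      ∑ j ∈ Finset.range q, |θ.hHatSeq ς x (0 - j) - θ.statVol x (0 - j)| ≤ C := by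
  refine ⟨∑ j ∈ Finset.range q, ((if hj : j < q then |ς ⟨j, hj⟩| else 0) +
    (A / (1 - ρ) + 4 * archBound p A ρ * pathDom ρ x (0 - j))), fun θ hθ =>
    Finset.sum_le_sum fun j hj => ?_⟩
  have hjq := Finset.mem_range.1 hj
  have hinit : |θ.hHatSeq ς x (0 - j)| = |ς ⟨j, hjq⟩| := by
    rw [hHatSeq, if_neg (by omega), dif_pos (by omega)]
    congr 3
    omega
  rw [dif_pos hjq, ← hinit]
  refine (abs_sub _ _).trans (add_le_add_right ?_ _)
  rw [abs_of_pos (h.statVol_pos hθ x _)]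
  exact h.statVol_le hθ hx _

theorem exists_abs_hHatSucc_sub_le (h : UnifBounds K a A ρ) (ς : Fin q → ℝ) {x : ℤ → ℝ}
    (hx : TemperedPath ρ x) : ∃ C, ∀ θ ∈ K, ∀ n : ℕ,
      |θ.hHatSucc ς x n - θ.statVol x (n + 1)| ≤ C * ρ ^ n := by
  have hρ := h.rho_pos.le
  have hρ1 := h.rho_lt_one.le
  obtain ⟨C, hC⟩ := h.exists_sum_abs_hHatSeq_sub_le ς hx
  refine ⟨C, fun θ hθ n => ?_⟩
  have hshift : ∀ n : ℕ, (0 : ℤ) + 1 + n = n + 1 := fun n => by ring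
  have hcontr := abs_le_of_contracting_recursion
    (d := fun s => θ.hHatSeq ς x s - θ.statVol x s) (s := 0)
    hρ hρ1 (fun j => betaN_nonneg (h.subset hθ) j) (h.sum_beta_le θ hθ) (fun n => by
      rw [hshift, hHatSeq_succ, hHatSucc_eq, h.statVol_eq hθ hx]
      simp only [add_sub_cancel_right, zero_add, mul_sub, Finset.sum_sub_distrib]
      ring) n
  rw [hshift, hHatSeq_succ] at hcontr
  refine hcontr.trans ?_
  rw [mul_comm C]
  exact mul_le_mul (pow_le_pow_of_le_one hρ hρ1 n.le_succ) (hC θ hθ)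
    (Finset.sum_nonneg fun j _ => abs_nonneg _) (pow_nonneg hρ n)

theorem exists_abs_logLik_add_statLoss_le (h : UnifBounds K a A ρ) {ς : Fin q → ℝ}
    (hς : ∀ j, 0 ≤ ς j) {x : ℤ → ℝ} (hx : TemperedPath ρ x)
    (hfwd : Summable fun k : ℕ => ρ ^ k * (1 + x (k + 1) ^ 2)) :
    ∃ C, ∀ θ ∈ K, ∀ n : ℕ, |2 * logLik ς x n θ + θ.statLoss x n| ≤ C := by
  obtain ⟨C, hC⟩ := h.exists_abs_hHatSucc_sub_le ς hx
  have ha := h.a_pos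
  have hρ := h.rho_pos
  set M := C * (1 / a ^ 2 + 1 / a) with hM
  refine ⟨∑' k : ℕ, M * (ρ ^ k * (1 + x (k + 1) ^ 2)), fun θ hθ n => ?_⟩
  have hC0 : 0 ≤ C := by
    simpa only [pow_zero, mul_one] using (abs_nonneg _).trans (hC θ hθ 0)
  have hdiff : 2 * logLik ς x n θ + θ.statLoss x n = ∑ t ∈ Finset.range n,
      ((x ((t : ℤ) + 1) ^ 2 / θ.statVol x (t + 1) + Real.log (θ.statVol x (t + 1))) -
        (x ((t : ℤ) + 1) ^ 2 / θ.hHatSucc ς x t + Real.log (θ.hHatSucc ς x t))) := by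
    simp only [logLik, statLoss, Finset.sum_add_distrib, Finset.sum_sub_distrib]
    ring
  rw [hdiff]
  refine (Finset.abs_sum_le_sum_abs _ _).trans (le_trans (Finset.sum_le_sum fun t _ => ?_)
    ((hfwd.mul_left M).sum_le_tsum _ fun k _ => by positivity))
  refine (abs_loss_sub_le (δ := C * ρ ^ t) ha (h.le_statVol hθ x (t + 1))
    ((h.le_alphaZero θ hθ).trans (alphaZero_le_hHatSucc (h.subset hθ) hς x t))
    (sq_nonneg _)
    (by rw [abs_sub_comm]; exact hC θ hθ t)).trans_eq ?_
  rw [hM]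
  ring

end UnifBounds

end AGARCHParam

theorem summable_of_summable_rpow {ι : Type*} {f : ι → ℝ} (hf : ∀ i, 0 ≤ f i) {κ : ℝ}
    (hκ0 : 0 < κ) (hκ1 : κ ≤ 1) (hs : Summable fun i => f i ^ κ) : Summable f := by
  refine Summable.of_norm_bounded_eventually hs ?_
  filter_upwards [hs.tendsto_cofinite_zero.eventually_le_const one_pos] with i hi
  have hi1 : f i ≤ 1 := by
    contrapose! hi
    exact Real.one_lt_rpow hi hκ0
  rw [Real.norm_of_nonneg (hf i)]
  simpa only [Real.rpow_one] using Real.rpow_le_rpow_of_exponent_ge' (hf i) hi1 hκ0.le hκ1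

theorem ae_summable_pow_mul_of_lintegral_rpow_le {Ω : Type*} [MeasurableSpace Ω] {μ : Measure Ω}
    {Y : ℕ → Ω → ℝ} (hYm : ∀ k, Measurable (Y k)) (hY : ∀ k, ∀ᵐ ω ∂μ, 0 ≤ Y k ω) {κ : ℝ}
    (hκ0 : 0 < κ) (hκ1 : κ ≤ 1) {C : ENNReal} (hC : C ≠ ⊤)
    (hle : ∀ k, ∫⁻ ω, ENNReal.ofReal (Y k ω) ^ κ ∂μ ≤ C) {ρ : ℝ} (hρ0 : 0 < ρ) (hρ1 : ρ < 1) :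
    ∀ᵐ ω ∂μ, Summable fun k : ℕ => ρ ^ k * Y k ω := by
  have hm : ∀ k, Measurable fun ω => ENNReal.ofReal (ρ ^ k * Y k ω) ^ κ := fun k =>
    ((hYm k).const_mul _).ennreal_ofReal.pow_const κ
  have hratio : ENNReal.ofReal ρ ^ κ < 1 :=
    ENNReal.rpow_lt_one (ENNReal.ofReal_lt_one.2 hρ1) hκ0
  have hsum : ∫⁻ ω, ∑' k, ENNReal.ofReal (ρ ^ k * Y k ω) ^ κ ∂μ ≠ ⊤ := by
    rw [lintegral_tsum fun k => (hm k).aemeasurable]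
    refine ne_top_of_le_ne_top (b := ∑' k : ℕ, (ENNReal.ofReal ρ ^ κ) ^ k * C) ?_
      (ENNReal.tsum_le_tsum fun k => ?_)
    · rw [ENNReal.tsum_mul_right, ENNReal.tsum_geometric]
      exact ENNReal.mul_ne_top (ENNReal.inv_ne_top.2 (tsub_pos_of_lt hratio).ne') hC
    · have hscale : ∀ ω, ENNReal.ofReal (ρ ^ k * Y k ω) ^ κ =
          (ENNReal.ofReal ρ ^ κ) ^ k * ENNReal.ofReal (Y k ω) ^ κ := by
        intro ω
        rw [ENNReal.ofReal_mul (by positivity), ENNReal.mul_rpow_of_nonneg _ _ hκ0.le,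
          ENNReal.ofReal_pow hρ0.le, ← ENNReal.rpow_natCast, ← ENNReal.rpow_natCast,
          ← ENNReal.rpow_mul, ← ENNReal.rpow_mul, mul_comm κ]
      simp only [hscale]
      rw [lintegral_const_mul _ ((hYm k).ennreal_ofReal.pow_const κ)]
      gcongr
      exact hle k
  filter_upwards [ae_lt_top (Measurable.tsum hm) hsum, ae_all_iff.2 hY] with ω hω hYω
  refine summable_of_summable_rpow (fun k => mul_nonneg (by positivity) (hYω k)) hκ0 hκ1
    ((ENNReal.summable_toReal hω.ne).congr fun k => ?_)
  rw [← ENNReal.toReal_rpow, ENNReal.toReal_ofReal (mul_nonneg (by positivity) (hYω k))]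

theorem eq_zero_of_contracting_recursion {q : ℕ} {b : ℕ → ℝ} {ρ : ℝ} (hρ0 : 0 < ρ) (hρ1 : ρ ≤ 1)
    (hb : ∀ j, 0 ≤ b j) (hsum : ∑ j ∈ Finset.range q, b j ≤ ρ ^ (q + 1)) {d : ℤ → ℝ}
    (hd : ∀ t, d t = ∑ j ∈ Finset.range q, b j * d (t - 1 - j))
    (hlim : ∀ t, Tendsto (fun N : ℕ => ρ ^ N * d (t - N)) atTop (𝓝 0)) (t : ℤ) : d t = 0 := by
  have hbound : ∀ N : ℕ, |d t| ≤ ∑ j ∈ Finset.range q, ρ * |ρ ^ N * d (t - 1 - j - N)| := by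
    intro N
    have hcontr := abs_le_of_contracting_recursion (d := d) (s := t - 1 - N) hρ0.le hρ1 hb hsum
      (fun n => by
        rw [hd]
        refine Finset.sum_congr rfl fun j _ => ?_
        congr 2
        ring) N
    rw [show t - 1 - (N : ℤ) + 1 + N = t by ring, Finset.mul_sum] at hcontr
    refine hcontr.trans_eq (Finset.sum_congr rfl fun j _ => ?_)
    rw [sub_right_comm, abs_mul, abs_of_pos (pow_pos hρ0 N), pow_succ', mul_assoc]
  have hzero : Tendsto (fun N : ℕ => ∑ j ∈ Finset.range q, ρ * |ρ ^ N * d (t - 1 - j - N)|)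
      atTop (𝓝 0) := by
    simpa only [abs_zero, mul_zero, Finset.sum_const_zero] using
      tendsto_finsetSum (Finset.range q) fun j _ => (hlim (t - 1 - j)).abs.const_mul ρ
  exact abs_eq_zero.1 (le_antisymm (ge_of_tendsto' hzero hbound) (abs_nonneg _))

namespace AGARCHParam

variable {p q : ℕ}

theorem tendsto_pow_mul_pathDom (ρ : ℝ) (x : ℤ → ℝ) (t : ℤ) :
    Tendsto (fun N : ℕ => ρ ^ N * pathDom ρ x (t - N)) atTop (𝓝 0) := by
  refine (tendsto_sum_nat_add fun k : ℕ => ρ ^ k * (1 + x (t - 1 - k) ^ 2)).congr fun N => ?_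
  unfold pathDom
  rw [← tsum_mul_left]
  refine tsum_congr fun k => ?_
  rw [add_comm k, pow_add, mul_assoc]
  congr 5
  push_cast
  ring

namespace UnifBounds

variable {K : Set (AGARCHParam p q)} {a A ρ : ℝ} {θ : AGARCHParam p q}

theorem tendsto_pow_mul_statVol (h : UnifBounds K a A ρ) (hθ : θ ∈ K) {x : ℤ → ℝ}
    (hx : TemperedPath ρ x) (t : ℤ) :
    Tendsto (fun N : ℕ => ρ ^ N * θ.statVol x (t - N)) atTop (𝓝 0) := by
  have hρ := h.rho_pos.le
  have hbound := ((tendsto_pow_atTop_nhds_zero_of_lt_one hρ h.rho_lt_one).mul_const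
    (A / (1 - ρ))).add ((tendsto_pow_mul_pathDom ρ x t).const_mul (4 * archBound p A ρ))
  rw [zero_mul, mul_zero, add_zero] at hbound
  refine squeeze_zero (fun N => mul_nonneg (pow_nonneg hρ N)
    (h.a_pos.le.trans (h.le_statVol hθ x _))) (fun N => ?_) hbound
  exact (mul_le_mul_of_nonneg_left (h.statVol_le hθ hx (t - N)) (pow_nonneg hρ N)).trans_eq
    (by ring)

theorem eq_statVol (h : UnifBounds K a A ρ) (hθ : θ ∈ K) {x v : ℤ → ℝ} (hx : TemperedPath ρ x)
    (hv : ∀ t : ℤ, v t = θ.alphaZero +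
      ∑ i ∈ Finset.range p, θ.alphaN i * asymSq θ.gamma (x (t - 1 - i)) +
      ∑ j ∈ Finset.range q, θ.betaN j * v (t - 1 - j))
    (hlim : ∀ t, Tendsto (fun N : ℕ => ρ ^ N * v (t - N)) atTop (𝓝 0)) (t : ℤ) :
    v t = θ.statVol x t := by
  refine sub_eq_zero.1 (eq_zero_of_contracting_recursion (d := fun s => v s - θ.statVol x s)
    h.rho_pos h.rho_lt_one.le (fun j => betaN_nonneg (h.subset hθ) j) (h.sum_beta_le θ hθ)
    (fun t => ?_) (fun t => ?_) t)
  · simp only [mul_sub, Finset.sum_sub_distrib]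
    rw [hv t, h.statVol_eq hθ hx t]
    ring
  · simpa only [mul_sub, sub_zero] using (hlim t).sub (h.tendsto_pow_mul_statVol hθ hx t)

end UnifBounds

theorem measurable_statVol {Ω : Type*} {_ : MeasurableSpace Ω} (θ : AGARCHParam p q)
    {X : ℤ → Ω → ℝ} {t : ℤ} (hX : ∀ k : ℕ, Measurable (X (t - 1 - k))) :
    Measurable fun ω => θ.statVol (fun s => X s ω) t :=
  measurable_const.add (Measurable.tsum fun k =>
    measurable_const.mul ((measurable_asymSq _).comp (hX k)))

theorem measurable_pathDom {Ω : Type*} {_ : MeasurableSpace Ω} (ρ : ℝ)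
    {X : ℤ → Ω → ℝ} {t : ℤ} (hX : ∀ k : ℕ, Measurable (X (t - 1 - k))) :
    Measurable fun ω => pathDom ρ (fun s => X s ω) t :=
  Measurable.tsum fun k => measurable_const.mul (((hX k).pow_const 2).const_add 1)

end AGARCHParam

namespace IsStationaryAGARCH

open AGARCHParam

variable {Ω : Type*} [MeasurableSpace Ω] {μ : Measure Ω} {p q : ℕ} {θ : AGARCHParam p q}
  {Z X σ : ℤ → Ω → ℝ}

theorem lintegral_obs_rpow_eq (h : IsStationaryAGARCH μ θ Z X σ) (κ : ℝ) (t : ℤ) :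
    ∫⁻ ω, ENNReal.ofReal (X t ω ^ 2) ^ κ ∂μ = ∫⁻ ω, ENNReal.ofReal (X 0 ω ^ 2) ^ κ ∂μ := by
  have hf : Measurable fun w : ℤ → ℝ × ℝ => ENNReal.ofReal ((w 0).1 ^ 2) ^ κ := by fun_prop
  simpa only [pathShift, zero_add] using (h.identDistrib_pathShift hf t).lintegral_eq

theorem lintegral_vol_rpow_eq (h : IsStationaryAGARCH μ θ Z X σ) (κ : ℝ) (t : ℤ) :
    ∫⁻ ω, ENNReal.ofReal (σ t ω ^ 2) ^ κ ∂μ = ∫⁻ ω, ENNReal.ofReal (σ 0 ω ^ 2) ^ κ ∂μ := by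
  have hf : Measurable fun w : ℤ → ℝ × ℝ => ENNReal.ofReal ((w 0).2 ^ 2) ^ κ := by fun_prop
  simpa only [pathShift, zero_add] using (h.identDistrib_pathShift hf t).lintegral_eq

theorem exists_noisePast_statVol (h : IsStationaryAGARCH μ θ Z X σ) (θ' : AGARCHParam p q)
    {s t : ℤ} (hst : s ≤ t + 1) : ∃ g : Ω → ℝ, Measurable[noisePast Z t] g ∧
      (fun ω => θ'.statVol (fun s => X s ω) s) =ᵐ[μ] g := by
  choose f hfm hf using h.exists_noisePast_path
  refine ⟨fun ω => θ'.statVol (fun s => (f s ω).1) s, ?_, ?_⟩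
  · refine measurable_statVol θ' (X := fun s ω => (f s ω).1) fun k => ?_
    exact measurable_fst.comp ((hfm _).mono (noisePast_mono (by omega)) le_rfl)
  · filter_upwards [ae_all_iff.2 hf] with ω hω
    congr 1
    funext s
    rw [← hω s]

variable [IsProbabilityMeasure μ]

theorem ae_summable_obs (h : IsStationaryAGARCH μ θ Z X σ) (hθ : θ ∈ space p q) (hp : 0 < p)
    {ρ : ℝ} (hρ0 : 0 < ρ) (hρ1 : ρ < 1) (u : ℕ → ℤ) :
    ∀ᵐ ω ∂μ, Summable fun k : ℕ => ρ ^ k * (1 + X (u k) ω ^ 2) := by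
  obtain ⟨κ, hκ0, hκ1, hσ⟩ := h.exists_lintegral_vol_rpow_ne_top hθ hp
  have hX := h.lintegral_obs_rpow_ne_top hκ0 hκ1 hσ
  filter_upwards [ae_summable_pow_mul_of_lintegral_rpow_le (Y := fun k ω => X (u k) ω ^ 2)
    (fun k => (h.measurable_obs _).pow_const 2) (fun k => ae_of_all _ fun ω => sq_nonneg _)
    hκ0 hκ1 hX (fun k => (h.lintegral_obs_rpow_eq κ (u k)).le) hρ0 hρ1] with ω hω
  refine ((summable_geometric_of_lt_one hρ0.le hρ1).add hω).congr fun k => ?_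
  ring

theorem ae_summable_vol (h : IsStationaryAGARCH μ θ Z X σ) (hθ : θ ∈ space p q) (hp : 0 < p)
    {ρ : ℝ} (hρ0 : 0 < ρ) (hρ1 : ρ < 1) (u : ℕ → ℤ) :
    ∀ᵐ ω ∂μ, Summable fun k : ℕ => ρ ^ k * σ (u k) ω ^ 2 := by
  obtain ⟨κ, hκ0, hκ1, hσ⟩ := h.exists_lintegral_vol_rpow_ne_top hθ hp
  exact ae_summable_pow_mul_of_lintegral_rpow_le (Y := fun k ω => σ (u k) ω ^ 2)
    (fun k => (h.measurable_vol _).pow_const 2) (fun k => ae_of_all _ fun ω => sq_nonneg _)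
    hκ0 hκ1 hσ (fun k => (h.lintegral_vol_rpow_eq κ (u k)).le) hρ0 hρ1

theorem ae_temperedPath (h : IsStationaryAGARCH μ θ Z X σ) (hθ : θ ∈ space p q) (hp : 0 < p)
    {ρ : ℝ} (hρ0 : 0 < ρ) (hρ1 : ρ < 1) : ∀ᵐ ω ∂μ, TemperedPath ρ fun t => X t ω :=
  ae_all_iff.2 fun t => h.ae_summable_obs hθ hp hρ0 hρ1 fun k => t - 1 - k

theorem ae_sq_vol_eq_statVol (h : IsStationaryAGARCH μ θ Z X σ) {K : Set (AGARCHParam p q)}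
    {a A ρ : ℝ} (hK : UnifBounds K a A ρ) (hθ : θ ∈ K) (hp : 0 < p) :
    ∀ᵐ ω ∂μ, ∀ t, σ t ω ^ 2 = θ.statVol (fun s => X s ω) t := by
  filter_upwards [h.ae_isPath, h.ae_temperedPath (hK.subset hθ) hp hK.rho_pos hK.rho_lt_one,
    ae_all_iff.2 fun t : ℤ => h.ae_summable_vol (hK.subset hθ) hp hK.rho_pos hK.rho_lt_one
      fun k => t - k] with ω hpath htemp hsum t
  exact hK.eq_statVol hθ (v := fun s => σ s ω ^ 2) htemp hpath.vol_eq
    (fun t => (hsum t).tendsto_atTop_zero) t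

end IsStationaryAGARCH

/-! ### Identification of the parameter -/

theorem exists_ae_eq_const_of_indepFun_self {Ω : Type*} [MeasurableSpace Ω] {μ : Measure Ω}
    [IsProbabilityMeasure μ] {f : Ω → ℝ} (hf : Measurable f) (h : IndepFun f f μ) :
    ∃ c, ∀ᵐ ω ∂μ, f ω = c := by
  refine Filter.exists_eventuallyEq_const_of_forall_separating (l := ae μ) MeasurableSet ?_
  intro U hU
  rcases measure_eq_zero_or_one_of_indep_self ((IndepFun_iff_Indep f f μ).1 h) (t := f ⁻¹' U)
    ⟨U, hU, rfl⟩ with hzero | hone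
  · exact Or.inr (measure_eq_zero_iff_ae_notMem.1 hzero)
  · exact Or.inl ((mem_ae_iff_prob_eq_one (hf hU)).2 hone)

theorem ae_eq_zero_of_nonpos_of_integral_eq_zero {Ω : Type*} [MeasurableSpace Ω] {μ : Measure Ω}
    {f : Ω → ℝ} (hf : Integrable f μ) (hmean : ∫ ω, f ω ∂μ = 0) (h : ∀ᵐ ω ∂μ, f ω ≤ 0) :
    ∀ᵐ ω ∂μ, f ω = 0 := by
  have hneg := (integral_eq_zero_iff_of_nonneg_ae (f := fun ω => -f ω)
    (h.mono fun ω hω => neg_nonneg.2 hω) hf.neg).1 (by rw [integral_neg, hmean, neg_zero])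
  exact hneg.mono fun ω hω => neg_eq_zero.1 hω

theorem eq_zero_of_ae_half_eq_const {Ω : Type*} [MeasurableSpace Ω] {μ : Measure Ω} {f : Ω → ℝ}
    (hpos : ¬ ∀ᵐ ω ∂μ, f ω ≤ 0) (hneg : ¬ ∀ᵐ ω ∂μ, 0 ≤ f ω) {v c : ℝ}
    (h : ∀ᵐ ω ∂μ, (0 ≤ f ω → 0 = c) ∧ (f ω ≤ 0 → v * f ω ^ 2 = c)) : v = 0 := by
  have hc : 0 = c := by
    by_contra hc
    exact hpos (h.mono fun ω hω => le_of_not_ge fun hf => hc (hω.1 hf))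
  by_contra hv
  refine hneg (h.mono fun ω hω => le_of_not_gt fun hf => ?_)
  exact mul_ne_zero hv (pow_ne_zero 2 hf.ne) ((hω.2 hf.le).trans hc.symm)

theorem eq_zero_of_ae_piecewise_eq_const {Ω : Type*} [MeasurableSpace Ω] {μ : Measure Ω}
    {f : Ω → ℝ} (hf : Integrable f μ) (hmean : ∫ ω, f ω ∂μ = 0)
    (hnd : ¬ ∃ a b : ℝ, ∀ᵐ ω ∂μ, f ω = a ∨ f ω = b) {u v c : ℝ}
    (h : ∀ᵐ ω ∂μ, (0 ≤ f ω → u * f ω ^ 2 = c) ∧ (f ω ≤ 0 → v * f ω ^ 2 = c)) :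
    u = 0 ∧ v = 0 := by
  have hpos : ¬ ∀ᵐ ω ∂μ, f ω ≤ 0 := fun hle => hnd ⟨0, 0,
    (ae_eq_zero_of_nonpos_of_integral_eq_zero hf hmean hle).mono fun ω hω => Or.inl hω⟩
  have hneg : ¬ ∀ᵐ ω ∂μ, 0 ≤ f ω := fun hle => hnd ⟨0, 0,
    (ae_eq_zero_of_nonpos_of_integral_eq_zero (f := fun ω => -f ω) hf.neg
      (by rw [integral_neg, hmean, neg_zero]) (hle.mono fun ω hω => neg_nonpos.2 hω)).mono
      fun ω hω => Or.inl (neg_eq_zero.1 hω)⟩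
  have huv : u = 0 → v = 0 := by
    rintro rfl
    simp only [zero_mul] at h
    exact eq_zero_of_ae_half_eq_const hpos hneg h
  have hvu : v = 0 → u = 0 := by
    rintro rfl
    refine eq_zero_of_ae_half_eq_const (f := fun ω => -f ω) (c := c)
      (by simpa only [neg_nonpos] using hneg) (by simpa only [neg_nonneg] using hpos)
      (h.mono fun ω hω => ?_)
    simpa only [neg_nonneg, neg_nonpos, neg_sq, zero_mul] using hω.symm
  by_cases hu : u = 0
  · exact ⟨hu, huv hu⟩
  -- If `u` and `v` are both nonzero, then `f` takes only the two values solving the equations.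
  refine absurd ⟨√(c / u), -√(c / v), h.mono fun ω hω => ?_⟩ hnd
  rcases le_total 0 (f ω) with hf0 | hf0
  · left
    rw [← hω.1 hf0, mul_div_cancel_left₀ _ hu, Real.sqrt_sq hf0]
  · right
    rw [← hω.2 hf0, mul_div_cancel_left₀ _ (mt hvu hu), Real.sqrt_sq_eq_abs, abs_of_nonpos hf0,
      neg_neg]

namespace AGARCHParam

variable {p q : ℕ}

/-- The polynomial `a(z) / z`. -/
def arPolynomial (θ : AGARCHParam p q) : Polynomial ℂ :=
  ∑ i ∈ Finset.range p, Polynomial.C (θ.alphaN i : ℂ) * Polynomial.X ^ i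

/-- The polynomial `b(z)`. -/
def maPolynomial (θ : AGARCHParam p q) : Polynomial ℂ :=
  1 - ∑ j ∈ Finset.range q, Polynomial.C (θ.betaN j : ℂ) * Polynomial.X ^ (j + 1)

theorem coeff_arPolynomial (θ : AGARCHParam p q) (k : ℕ) :
    θ.arPolynomial.coeff k = θ.alphaN k := by
  rw [arPolynomial, Polynomial.finsetSum_coeff]
  simp only [Polynomial.coeff_C_mul_X_pow]
  rw [Finset.sum_ite_eq]
  split_ifs with h
  · rfl
  · rw [alphaN_of_le θ (by simpa using h), Complex.ofReal_zero]

theorem coeff_maPolynomial_zero (θ : AGARCHParam p q) : θ.maPolynomial.coeff 0 = 1 := by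
  rw [maPolynomial, Polynomial.coeff_sub, Polynomial.finsetSum_coeff]
  simp

theorem coeff_maPolynomial_succ (θ : AGARCHParam p q) (k : ℕ) :
    θ.maPolynomial.coeff (k + 1) = -θ.betaN k := by
  rw [maPolynomial, Polynomial.coeff_sub, Polynomial.finsetSum_coeff]
  simp only [Polynomial.coeff_C_mul_X_pow, add_left_inj]
  rw [Finset.sum_ite_eq, Polynomial.coeff_one, if_neg (Nat.succ_ne_zero k), zero_sub]
  split_ifs with h
  · rfl
  · rw [betaN_of_le θ (by simpa using h), Complex.ofReal_zero]

theorem coe_arPolynomial (θ : AGARCHParam p q) :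
    (θ.arPolynomial : PowerSeries ℂ) =
      θ.maPolynomial * PowerSeries.mk fun k => (θ.archCoeff k : ℂ) := by
  ext k
  rw [Polynomial.coeff_coe, coeff_arPolynomial, PowerSeries.coeff_mul]
  simp only [Polynomial.coeff_coe, PowerSeries.coeff_mk]
  rw [Finset.Nat.sum_antidiagonal_eq_sum_range_succ_mk, Finset.sum_range_succ']
  simp only [coeff_maPolynomial_zero, coeff_maPolynomial_succ, Nat.sub_zero, one_mul]
  have hreflect : ∑ u ∈ Finset.range k, θ.betaN (k - 1 - u) * θ.archCoeff u =
      ∑ j ∈ Finset.range k, θ.betaN j * θ.archCoeff (k - (j + 1)) := by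
    rw [← Finset.sum_range_reflect]
    refine Finset.sum_congr rfl fun j hj => ?_
    have hjk := Finset.mem_range.1 hj
    rw [show k - 1 - (k - 1 - j) = j by omega, show k - 1 - j = k - (j + 1) by omega]
  rw [archCoeff_eq_add_sum θ k, hreflect]
  push_cast
  simp only [neg_mul, Finset.sum_neg_distrib]
  ring

theorem aPoly_eq (θ : AGARCHParam p q) (z : ℂ) : θ.aPoly z = z * θ.arPolynomial.eval z := by
  rw [aPoly, arPolynomial, Polynomial.eval_finsetSum, Finset.mul_sum, Finset.sum_range]
  refine Finset.sum_congr rfl fun i _ => ?_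
  simp only [alphaN_fin, Polynomial.eval_mul, Polynomial.eval_C, Polynomial.eval_pow,
    Polynomial.eval_X]
  ring

theorem bPoly_eq (θ : AGARCHParam p q) (z : ℂ) : θ.bPoly z = θ.maPolynomial.eval z := by
  rw [bPoly, maPolynomial, Polynomial.eval_sub, Polynomial.eval_finsetSum, Finset.sum_range,
    Polynomial.eval_one]
  simp only [betaN_fin, Polynomial.eval_mul, Polynomial.eval_C, Polynomial.eval_pow,
    Polynomial.eval_X]

theorem isCoprime_polynomials {θ : AGARCHParam p q}
    (hcoprime : ¬ ∃ z : ℂ, θ.aPoly z = 0 ∧ θ.bPoly z = 0) :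
    IsCoprime θ.maPolynomial θ.arPolynomial := by
  rw [Polynomial.isCoprime_iff_aeval_ne_zero_of_isAlgClosed ℂ ℂ]
  intro z
  by_contra! hz
  simp only [Polynomial.coe_aeval_eq_eval] at hz
  exact hcoprime ⟨z, by rw [aPoly_eq, hz.2, mul_zero], by rw [bPoly_eq, hz.1]⟩

theorem natDegree_arPolynomial_le (θ : AGARCHParam p q) : θ.arPolynomial.natDegree ≤ p - 1 := by
  refine Polynomial.natDegree_le_iff_coeff_eq_zero.2 fun k hk => ?_
  rw [coeff_arPolynomial, alphaN_of_le θ (by omega), Complex.ofReal_zero]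

theorem natDegree_maPolynomial_le (θ : AGARCHParam p q) : θ.maPolynomial.natDegree ≤ q := by
  refine Polynomial.natDegree_le_iff_coeff_eq_zero.2 fun k hk => ?_
  obtain ⟨k, rfl⟩ : ∃ j, k = j + 1 := ⟨k - 1, by omega⟩
  rw [coeff_maPolynomial_succ, betaN_of_le θ (by omega), Complex.ofReal_zero, neg_zero]

theorem maPolynomial_ne_zero (θ : AGARCHParam p q) : θ.maPolynomial ≠ 0 := by
  intro h
  have := θ.coeff_maPolynomial_zero
  simp [h] at this

theorem exists_eq_mul_of_archCoeff_eq {θ₀ θ : AGARCHParam p q}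
    (hcoprime : ¬ ∃ z : ℂ, θ₀.aPoly z = 0 ∧ θ₀.bPoly z = 0)
    (h : ∀ k, θ.archCoeff k = θ₀.archCoeff k) : ∃ E : Polynomial ℂ,
      θ.arPolynomial = θ₀.arPolynomial * E ∧ θ.maPolynomial = θ₀.maPolynomial * E := by
  have hmul : θ.arPolynomial * θ₀.maPolynomial = θ₀.arPolynomial * θ.maPolynomial := by
    apply Polynomial.coe_injective (R := ℂ)
    rw [Polynomial.coe_mul, Polynomial.coe_mul, coe_arPolynomial, coe_arPolynomial]
    simp only [h]
    ring
  obtain ⟨E, hE⟩ : θ₀.maPolynomial ∣ θ.maPolynomial :=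
    (isCoprime_polynomials hcoprime).dvd_of_dvd_mul_left ⟨θ.arPolynomial, by rw [← hmul, mul_comm]⟩
  refine ⟨E, mul_right_cancel₀ θ₀.maPolynomial_ne_zero ?_, hE⟩
  rw [hmul, hE]
  ring

theorem natDegree_eq_zero_of_eq_mul {θ₀ θ : AGARCHParam p q}
    (hlast : q = 0 ∨ (∃ i : Fin p, (i : ℕ) + 1 = p ∧ θ₀.alpha i ≠ 0) ∨
      (∃ j : Fin q, (j : ℕ) + 1 = q ∧ θ₀.beta j ≠ 0)) {E : Polynomial ℂ}
    (har : θ.arPolynomial = θ₀.arPolynomial * E) (hma : θ.maPolynomial = θ₀.maPolynomial * E) :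
    E.natDegree = 0 := by
  have hE : E ≠ 0 := right_ne_zero_of_mul (hma ▸ θ.maPolynomial_ne_zero)
  have hma_deg := Polynomial.natDegree_mul θ₀.maPolynomial_ne_zero hE
  rw [← hma] at hma_deg
  have hma_le := θ.natDegree_maPolynomial_le
  rcases hlast with hq | ⟨i, hi, hαi⟩ | ⟨j, hj, hβj⟩
  · omega
  · have hcoeff : θ₀.arPolynomial.coeff i ≠ 0 := by
      rw [coeff_arPolynomial, alphaN_fin]
      exact_mod_cast hαi
    have hne : θ₀.arPolynomial ≠ 0 := fun hzero => hcoeff (by rw [hzero, Polynomial.coeff_zero])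
    have har_deg := Polynomial.natDegree_mul hne hE
    rw [← har] at har_deg
    have har_le := θ.natDegree_arPolynomial_le
    have har_ge := Polynomial.le_natDegree_of_ne_zero hcoeff
    omega
  · have hcoeff : θ₀.maPolynomial.coeff (j + 1) ≠ 0 := by
      rw [coeff_maPolynomial_succ, betaN_fin, neg_ne_zero]
      exact_mod_cast hβj
    have hma_ge := Polynomial.le_natDegree_of_ne_zero hcoeff
    omega

theorem eq_of_archCoeff_eq {θ₀ θ : AGARCHParam p q}
    (hlast : q = 0 ∨ (∃ i : Fin p, (i : ℕ) + 1 = p ∧ θ₀.alpha i ≠ 0) ∨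
      (∃ j : Fin q, (j : ℕ) + 1 = q ∧ θ₀.beta j ≠ 0))
    (hcoprime : ¬ ∃ z : ℂ, θ₀.aPoly z = 0 ∧ θ₀.bPoly z = 0)
    (h : ∀ k, θ.archCoeff k = θ₀.archCoeff k) :
    (∀ k, θ.alphaN k = θ₀.alphaN k) ∧ ∀ k, θ.betaN k = θ₀.betaN k := by
  obtain ⟨E, har, hma⟩ := exists_eq_mul_of_archCoeff_eq hcoprime h
  obtain ⟨e, rfl⟩ := Polynomial.natDegree_eq_zero.1 (natDegree_eq_zero_of_eq_mul hlast har hma)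
  obtain rfl : 1 = e := by
    simpa only [Polynomial.coeff_mul_C, coeff_maPolynomial_zero, one_mul] using
      congrArg (fun P => Polynomial.coeff P 0) hma
  rw [Polynomial.C_1, mul_one] at har hma
  refine ⟨fun k => ?_, fun k => ?_⟩
  · rw [← Complex.ofReal_inj, ← coeff_arPolynomial, har, coeff_arPolynomial]
  · rw [← neg_inj, ← Complex.ofReal_inj, Complex.ofReal_neg, ← coeff_maPolynomial_succ, hma,
      coeff_maPolynomial_succ, Complex.ofReal_neg]

theorem asymSq_one (γ : ℝ) : asymSq γ 1 = (1 - γ) ^ 2 := by simp [asymSq]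

theorem asymSq_neg_one (γ : ℝ) : asymSq γ (-1) = (1 + γ) ^ 2 := by simp [asymSq]

/-- The difference of the responses of `statVol`, for two parameters, to the observation with
lag `k + 1`. -/
def impactDiff (θ θ₀ : AGARCHParam p q) (k : ℕ) (x : ℝ) : ℝ :=
  θ.archCoeff k * asymSq θ.gamma x - θ₀.archCoeff k * asymSq θ₀.gamma x

theorem measurable_impactDiff (θ θ₀ : AGARCHParam p q) (k : ℕ) : Measurable (impactDiff θ θ₀ k) :=
  (measurable_const.mul (measurable_asymSq _)).sub (measurable_const.mul (measurable_asymSq _))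

theorem impactDiff_mul (θ θ₀ : AGARCHParam p q) (k : ℕ) {r : ℝ} (hr : 0 ≤ r) (z : ℝ) :
    impactDiff θ θ₀ k (r * z) = impactDiff θ θ₀ k z * r ^ 2 := by
  simp only [impactDiff, asymSq_mul _ hr]
  ring

theorem impactDiff_of_nonneg (θ θ₀ : AGARCHParam p q) (k : ℕ) {x : ℝ} (hx : 0 ≤ x) :
    impactDiff θ θ₀ k x = impactDiff θ θ₀ k 1 * x ^ 2 := by
  rw [← impactDiff_mul θ θ₀ k hx, mul_one]

theorem impactDiff_of_nonpos (θ θ₀ : AGARCHParam p q) (k : ℕ) {x : ℝ} (hx : x ≤ 0) :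
    impactDiff θ θ₀ k x = impactDiff θ θ₀ k (-1) * x ^ 2 := by
  rw [← neg_sq, ← impactDiff_mul θ θ₀ k (neg_nonneg.2 hx), neg_mul_neg, mul_one]

theorem impactDiff_eq_zero_of_ae_eq_const {Ω : Type*} [MeasurableSpace Ω] {μ : Measure Ω}
    {f : Ω → ℝ} (hf : Integrable f μ) (hmean : ∫ ω, f ω ∂μ = 0)
    (hnd : ¬ ∃ a b : ℝ, ∀ᵐ ω ∂μ, f ω = a ∨ f ω = b) {θ θ₀ : AGARCHParam p q} {k : ℕ} {c : ℝ}
    (h : ∀ᵐ ω ∂μ, impactDiff θ θ₀ k (f ω) = c) (x : ℝ) : impactDiff θ θ₀ k x = 0 := by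
  obtain ⟨hone, hneg_one⟩ := eq_zero_of_ae_piecewise_eq_const hf hmean hnd (h.mono fun ω hω =>
    ⟨fun hle => (impactDiff_of_nonneg θ θ₀ k hle).symm.trans hω,
      fun hle => (impactDiff_of_nonpos θ θ₀ k hle).symm.trans hω⟩)
  rcases le_total 0 x with hx | hx
  · rw [impactDiff_of_nonneg θ θ₀ k hx, hone, zero_mul]
  · rw [impactDiff_of_nonpos θ θ₀ k hx, hneg_one, zero_mul]

theorem UnifBounds.hasSum_impactDiff {K : Set (AGARCHParam p q)} {a A ρ : ℝ}
    (h : UnifBounds K a A ρ) {θ θ₀ : AGARCHParam p q} (hθ : θ ∈ K) (hθ₀ : θ₀ ∈ K) {x : ℤ → ℝ}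
    (hx : TemperedPath ρ x) (t : ℤ) : HasSum (fun k : ℕ => impactDiff θ θ₀ k (x (t - 1 - k)))
      ((θ.statVol x t - θ.volConst) - (θ₀.statVol x t - θ₀.volConst)) := by
  rw [statVol, statVol, add_sub_cancel_left, add_sub_cancel_left]
  exact (h.summable_archCoeff hθ hx t).hasSum.sub (h.summable_archCoeff hθ₀ hx t).hasSum

theorem archCoeff_eq_of_impactDiff_eq_zero {θ₀ θ : AGARCHParam p q} (hθ₀ : θ₀ ∈ space p q)
    (hθ : θ ∈ space p q) {k : ℕ} (h : ∀ x, impactDiff θ θ₀ k x = 0) :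
    θ.archCoeff k = θ₀.archCoeff k := by
  obtain ⟨hγ, hγ'⟩ := hθ.2.2.2
  obtain ⟨hγ₀, hγ₀'⟩ := hθ₀.2.2.2
  have hc := archCoeff_nonneg hθ k
  have hc₀ := archCoeff_nonneg hθ₀ k
  have hpos := congrArg Real.sqrt (sub_eq_zero.1 (h 1))
  have hneg := congrArg Real.sqrt (sub_eq_zero.1 (h (-1)))
  rw [asymSq_one, asymSq_one, Real.sqrt_mul hc, Real.sqrt_mul hc₀, Real.sqrt_sq (by linarith),
    Real.sqrt_sq (by linarith)] at hpos
  rw [asymSq_neg_one, asymSq_neg_one, Real.sqrt_mul hc, Real.sqrt_mul hc₀,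
    Real.sqrt_sq (by linarith), Real.sqrt_sq (by linarith)] at hneg
  exact (Real.sqrt_inj hc hc₀).1 (by linarith)

theorem gamma_eq_of_impactDiff_eq_zero {θ₀ θ : AGARCHParam p q} (hθ₀ : θ₀ ∈ space p q)
    (hθ : θ ∈ space p q) {k : ℕ} (hk : 0 < θ₀.archCoeff k) (h : ∀ x, impactDiff θ θ₀ k x = 0) :
    θ.gamma = θ₀.gamma := by
  have hone := sub_eq_zero.1 (h 1)
  rw [archCoeff_eq_of_impactDiff_eq_zero hθ₀ hθ h, asymSq_one, asymSq_one] at hone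
  exact sub_right_injective ((sq_eq_sq₀ (sub_nonneg.2 hθ.2.2.2.2) (sub_nonneg.2 hθ₀.2.2.2.2)).1
    (mul_left_cancel₀ hk.ne' hone))

theorem eq_of_impactDiff_eq_zero {θ₀ θ : AGARCHParam p q} (hθ₀ : θ₀ ∈ space p q)
    (hθ : θ ∈ space p q) (hα : ∃ i : Fin p, 0 < θ₀.alpha i)
    (hlast : q = 0 ∨ (∃ i : Fin p, (i : ℕ) + 1 = p ∧ θ₀.alpha i ≠ 0) ∨
      (∃ j : Fin q, (j : ℕ) + 1 = q ∧ θ₀.beta j ≠ 0))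
    (hcoprime : ¬ ∃ z : ℂ, θ₀.aPoly z = 0 ∧ θ₀.bPoly z = 0)
    (hconst : θ.volConst = θ₀.volConst) (h : ∀ k x, impactDiff θ θ₀ k x = 0) : θ = θ₀ := by
  obtain ⟨i, hi⟩ := hα
  have hγ : θ.gamma = θ₀.gamma := gamma_eq_of_impactDiff_eq_zero hθ₀ hθ
    ((θ₀.alphaN_fin i ▸ hi).trans_le (alphaN_le_archCoeff hθ₀ i)) (h i)
  obtain ⟨hα, hβ⟩ := eq_of_archCoeff_eq hlast hcoprime
    fun k => archCoeff_eq_of_impactDiff_eq_zero hθ₀ hθ (h k)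
  have hα₀ : θ.alphaZero = θ₀.alphaZero := by
    simp only [volConst, hβ] at hconst
    exact (div_left_inj' (sub_pos.2 (sum_betaN_lt_one hθ₀)).ne').1 hconst
  refine Prod.ext hα₀ (Prod.ext (funext fun i => ?_) (Prod.ext (funext fun j => ?_) hγ))
  · exact (θ.alphaN_fin i).symm.trans ((hα i).trans (θ₀.alphaN_fin i))
  · exact (θ.betaN_fin j).symm.trans ((hβ j).trans (θ₀.betaN_fin j))

end AGARCHParam

namespace IsStationaryAGARCH

open AGARCHParam

variable {Ω : Type*} [MeasurableSpace Ω] {μ : Measure Ω} {p q : ℕ}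
  {θ₀ : AGARCHParam p q} {Z X σ : ℤ → Ω → ℝ}

theorem ae_vol_ne_zero (h : IsStationaryAGARCH μ θ₀ Z X σ) (hθ₀ : θ₀ ∈ space p q) (t : ℤ) :
    ∀ᵐ ω ∂μ, σ t ω ≠ 0 := by
  filter_upwards [h.ae_isPath] with ω hω
  exact pow_ne_zero_iff two_ne_zero |>.1 (hθ₀.1.trans_le (hω.alphaZero_le hθ₀ t)).ne'

variable [IsProbabilityMeasure μ]

theorem exists_ae_eq_const (h : IsStationaryAGARCH μ θ₀ Z X σ) {t : ℤ}
    (hσ : ∀ᵐ ω ∂μ, σ t ω ≠ 0) {e : ℝ → ℝ} (he : Measurable e) {R : Ω → ℝ}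
    (hR : Measurable[noisePast Z (t - 1)] R)
    (heq : ∀ᵐ ω ∂μ, e (Z t ω) * σ t ω ^ 2 = R ω) : ∃ c, ∀ᵐ ω ∂μ, e (Z 0 ω) = c := by
  obtain ⟨s, hsm, hs⟩ := h.vol_adapted t
  have hmeas : Measurable[noisePast Z (t - 1)] fun ω => R ω / s ω ^ 2 :=
    hR.div (hsm.pow_const 2)
  -- `e (Z t)` is a function of the past, of which it is independent.
  have hind : IndepFun (fun ω => e (Z t ω)) (fun ω => e (Z t ω)) μ := by
    refine h.indepFun_of_measurable (t := t - 1)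
      (he.comp (measurable_noiseFuture (by omega))) hmeas ?_
    filter_upwards [hs, hσ, heq] with ω hsω hσω hRω
    rw [← hsω, ← hRω, mul_div_cancel_right₀ _ (pow_ne_zero 2 hσω)]
  obtain ⟨c, hc⟩ := exists_ae_eq_const_of_indepFun_self (he.comp (h.noise.measurable t)) hind
  exact ⟨c, (h.noise.identDistrib t).ae_snd (p := fun z => e z = c)
    (he (measurableSet_singleton c)) hc⟩

theorem exists_ae_eq_const_of_hasSum (h : IsStationaryAGARCH μ θ₀ Z X σ) {t : ℤ}
    (hσ : ∀ᵐ ω ∂μ, σ t ω ≠ 0) {D : ℕ → ℝ → ℝ} (hD : ∀ k, Measurable (D k))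
    (hmul : ∀ r z, 0 ≤ r → D 0 (r * z) = D 0 z * r ^ 2) {C : ℝ}
    (hsum : ∀ᵐ ω ∂μ, HasSum (fun k : ℕ => D k (X (t - k) ω)) C) :
    ∃ c, ∀ᵐ ω ∂μ, D 0 (Z 0 ω) = c := by
  choose f hfm hf using h.exists_noisePast_path
  refine h.exists_ae_eq_const hσ (hD 0)
    (R := fun ω => C - ∑' k : ℕ, D (k + 1) (f (t - (k + 1 : ℕ)) ω).1) ?_ ?_
  · have htail : Measurable fun w : ℕ → ℝ => C - ∑' k : ℕ, D (k + 1) (w k) :=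
      measurable_const.sub (Measurable.tsum fun k => (hD _).comp (measurable_pi_apply k))
    exact htail.comp (@measurable_pi_lambda _ _ _ (noisePast Z (t - 1)) _ _ fun k =>
      measurable_fst.comp ((hfm _).mono (noisePast_mono (by omega)) le_rfl))
  · filter_upwards [hsum, ae_all_iff.2 hf, h.obs_eq t, h.vol_nonneg t] with ω hsumω hfω hobs hvol
    have hX : ∀ s, X s ω = (f s ω).1 := fun s => congrArg Prod.fst (hfω s)
    rw [← hmul _ _ hvol, ← hobs, eq_sub_iff_add_eq, ← hsumω.tsum_eq,
      hsumω.summable.tsum_eq_zero_add, Nat.cast_zero, sub_zero]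
    simp only [hX]

theorem impactDiff_eq_zero (h : IsStationaryAGARCH μ θ₀ Z X σ) (hθ₀ : θ₀ ∈ space p q)
    (hZ : ¬ ∃ a b : ℝ, ∀ᵐ ω ∂μ, Z 0 ω = a ∨ Z 0 ω = b) {θ : AGARCHParam p q} {t : ℤ} {C : ℝ}
    (hsum : ∀ᵐ ω ∂μ, HasSum (fun k : ℕ => impactDiff θ θ₀ k (X (t - k) ω)) C) (k : ℕ) (x : ℝ) :
    impactDiff θ θ₀ k x = 0 := by
  induction k using Nat.strong_induction_on generalizing x with
  | _ k ih =>
    have htail : ∀ᵐ ω ∂μ, HasSum (fun i : ℕ => impactDiff θ θ₀ (i + k) (X (t - k - i) ω)) C := by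
      filter_upwards [hsum] with ω hω
      have hshift := (hasSum_nat_add_iff' k).2 hω
      rw [Finset.sum_eq_zero fun i hi => ih i (Finset.mem_range.1 hi) _, sub_zero] at hshift
      have hindex : ∀ i : ℕ, t - k - (i : ℤ) = t - ((i + k : ℕ) : ℤ) := fun i => by
        push_cast
        ring
      simpa only [hindex] using hshift
    obtain ⟨c, hc⟩ := h.exists_ae_eq_const_of_hasSum (h.ae_vol_ne_zero hθ₀ (t - k))
      (D := fun i => impactDiff θ θ₀ (i + k)) (fun i => measurable_impactDiff θ θ₀ _)
      (fun r z hr => impactDiff_mul θ θ₀ _ hr z) htail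
    rw [zero_add] at hc
    exact impactDiff_eq_zero_of_ae_eq_const (h.noise.memLp.integrable one_le_two) h.noise.mean hZ
      hc x

theorem eq_of_ae_statVol_eq (h : IsStationaryAGARCH μ θ₀ Z X σ) {K : Set (AGARCHParam p q)}
    {a A ρ : ℝ} (hK : UnifBounds K a A ρ) (hθ₀ : θ₀ ∈ K) {θ : AGARCHParam p q} (hθ : θ ∈ K)
    (hα : ∃ i : Fin p, 0 < θ₀.alpha i)
    (hlast : q = 0 ∨ (∃ i : Fin p, (i : ℕ) + 1 = p ∧ θ₀.alpha i ≠ 0) ∨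
      (∃ j : Fin q, (j : ℕ) + 1 = q ∧ θ₀.beta j ≠ 0))
    (hcoprime : ¬ ∃ z : ℂ, θ₀.aPoly z = 0 ∧ θ₀.bPoly z = 0)
    (hZ : ¬ ∃ a b : ℝ, ∀ᵐ ω ∂μ, Z 0 ω = a ∨ Z 0 ω = b)
    (heq : ∀ᵐ ω ∂μ, θ.statVol (fun s => X s ω) 0 = θ₀.statVol (fun s => X s ω) 0) :
    θ = θ₀ := by
  have hsum : ∀ᵐ ω ∂μ, HasSum (fun k : ℕ => impactDiff θ θ₀ k (X (0 - 1 - k) ω))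
      (θ₀.volConst - θ.volConst) := by
    filter_upwards [h.ae_temperedPath (hK.subset hθ₀) (hα.elim fun i _ => i.pos) hK.rho_pos
      hK.rho_lt_one, heq] with ω htemp hω
    simpa only [hω, sub_sub_sub_cancel_left] using hK.hasSum_impactDiff hθ hθ₀ htemp 0
  have hzero := h.impactDiff_eq_zero (hK.subset hθ₀) hZ hsum
  obtain ⟨ω, hω⟩ := hsum.exists
  simp only [hzero] at hω
  exact eq_of_impactDiff_eq_zero (hK.subset hθ₀) (hK.subset hθ) hα hlast hcoprime
    (sub_eq_zero.1 (hω.unique hasSum_zero)).symm hzero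

end IsStationaryAGARCH

/-! ### Separation of the limiting criterion -/

/-- The loss `log u + y / u` of the variance `u` at the squared observation `y`, shifted so that it
is nonnegative for `a ≤ u`. -/
def scaledLoss (a u y : ℝ) : ℝ := Real.log (u / a) + y / u

theorem scaledLoss_eq {a u : ℝ} (ha : 0 < a) (hu : 0 < u) (y : ℝ) :
    scaledLoss a u y = y / u + Real.log u - Real.log a := by
  rw [scaledLoss, Real.log_div hu.ne' ha.ne']
  ring

theorem log_div_nonneg {a u : ℝ} (ha : 0 < a) (hu : a ≤ u) : 0 ≤ Real.log (u / a) :=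
  Real.log_nonneg ((one_le_div ha).2 hu)

theorem scaledLoss_nonneg {a u y : ℝ} (ha : 0 < a) (hu : a ≤ u) (hy : 0 ≤ y) :
    0 ≤ scaledLoss a u y :=
  add_nonneg (log_div_nonneg ha hu) (div_nonneg hy (ha.le.trans hu))

theorem scaledLoss_self_lt {a h u : ℝ} (ha : 0 < a) (hh : 0 < h) (hu : 0 < u) (hne : u ≠ h) :
    scaledLoss a h h < scaledLoss a u h := by
  have hlog := Real.log_lt_sub_one_of_pos (div_pos hh hu)
    (fun heq => hne ((div_eq_one_iff_eq hu.ne').1 heq).symm)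
  rw [Real.log_div hh.ne' hu.ne'] at hlog
  rw [scaledLoss_eq ha hh, scaledLoss_eq ha hu, div_self hh.ne']
  linarith

theorem scaledLoss_self_le {a h u : ℝ} (ha : 0 < a) (hh : 0 < h) (hu : 0 < u) :
    scaledLoss a h h ≤ scaledLoss a u h := by
  rcases eq_or_ne u h with rfl | hne
  exacts [le_rfl, (scaledLoss_self_lt ha hh hu hne).le]

/-- A lower bound of `scaledLoss a u y` over `u ≥ a` with `|u - h| ≤ e`. -/
def lossFloor (a h e y : ℝ) : ℝ := Real.log (max (h - e) a / a) + y / (h + e)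

theorem lossFloor_nonneg {a h e y : ℝ} (ha : 0 < a) (hh : a ≤ h) (he : 0 ≤ e) (hy : 0 ≤ y) :
    0 ≤ lossFloor a h e y :=
  add_nonneg (log_div_nonneg ha (le_max_right _ _)) (div_nonneg hy (by linarith))

theorem lossFloor_le {a h e y u : ℝ} (ha : 0 < a) (hu : a ≤ u) (hy : 0 ≤ y)
    (hd : |u - h| ≤ e) : lossFloor a h e y ≤ scaledLoss a u y := by
  obtain ⟨hlower, hupper⟩ := abs_le.1 hd
  refine add_le_add (Real.log_le_log ?_ ?_) ?_
  · exact div_pos (ha.trans_le (le_max_right _ _)) ha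
  · gcongr
    exact max_le (by linarith) hu
  · exact div_le_div_of_nonneg_left hy (ha.trans_le hu) (by linarith)

theorem lossFloor_zero {a h : ℝ} (hh : a ≤ h) (y : ℝ) :
    lossFloor a h 0 y = scaledLoss a h y := by
  rw [lossFloor, sub_zero, add_zero, max_eq_left hh, scaledLoss]

theorem continuousAt_lossFloor {a h : ℝ} (ha : 0 < a) (hh : a ≤ h) (y : ℝ) :
    ContinuousAt (fun e => lossFloor a h e y) 0 := by
  have hmax : max (h - 0) a / a ≠ 0 := (div_pos (ha.trans_le (le_max_right _ _)) ha).ne'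
  have hadd : h + 0 ≠ 0 := by linarith
  unfold lossFloor
  refine ContinuousAt.add (ContinuousAt.log ?_ hmax) (ContinuousAt.div continuousAt_const ?_ hadd)
  · exact Continuous.continuousAt (by fun_prop)
  · exact Continuous.continuousAt (by fun_prop)

theorem tendsto_min_lossFloor {a h : ℝ} (ha : 0 < a) (hh : a ≤ h) (e y : ℝ) :
    Tendsto (fun j : ℕ => min (lossFloor a h (1 / ((j : ℝ) + 1) * e) y) j) atTop
      (𝓝 (scaledLoss a h y)) := by
  have hradius : Tendsto (fun j : ℕ => 1 / ((j : ℝ) + 1) * e) atTop (𝓝 0) := by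
    simpa using (tendsto_one_div_add_atTop_nhds_zero_nat (𝕜 := ℝ)).mul_const e
  have hfloor := (continuousAt_lossFloor ha hh y).tendsto.comp hradius
  rw [lossFloor_zero hh] at hfloor
  refine hfloor.congr' ?_
  filter_upwards [hfloor.eventually_le_const (lt_add_one _),
    tendsto_natCast_atTop_atTop.eventually_ge_atTop (scaledLoss a h y + 1)] with j hle hj
  exact (min_eq_left (hle.trans hj)).symm

section Measurability

variable {Ω : Type*} [MeasurableSpace Ω]

theorem measurable_scaledLoss {u y : Ω → ℝ} (a : ℝ) (hu : Measurable u) (hy : Measurable y) :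
    Measurable fun ω => scaledLoss a (u ω) (y ω) :=
  (hu.div_const a).log.add (hy.div hu)

theorem measurable_lossFloor {h e y : Ω → ℝ} (a : ℝ) (hh : Measurable h) (he : Measurable e)
    (hy : Measurable y) : Measurable fun ω => lossFloor a (h ω) (e ω) (y ω) :=
  (((hh.sub he).max measurable_const).div_const a).log.add (hy.div (hh.add he))

theorem exists_lt_lintegral_of_tendsto {μ : Measure Ω} {G : ℕ → Ω → ENNReal} {g : Ω → ENNReal}
    (hG : ∀ j, Measurable (G j)) (hlim : ∀ ω, Tendsto (fun j => G j ω) atTop (𝓝 (g ω)))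
    {c : ENNReal} (hc : c < ∫⁻ ω, g ω ∂μ) : ∃ j, c < ∫⁻ ω, G j ω ∂μ := by
  have hfatou : ∫⁻ ω, g ω ∂μ ≤ liminf (fun j => ∫⁻ ω, G j ω ∂μ) atTop :=
    (lintegral_congr fun ω => (hlim ω).liminf_eq.symm).trans_le (lintegral_liminf_le hG)
  exact (eventually_lt_of_lt_liminf (hc.trans_le hfatou)).exists

theorem exists_integral_scaledLoss_sub_lossFloor_neg {μ : Measure Ω} [IsFiniteMeasure μ]
    {s h y E : Ω → ℝ} (hsm : Measurable s) (hhm : Measurable h) (hym : Measurable y)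
    (hEm : Measurable E) {a : ℝ} (ha : 0 < a) (hs : ∀ ω, a ≤ s ω) (hh : ∀ ω, a ≤ h ω)
    (hy : ∀ ω, 0 ≤ y ω) (hE : ∀ ω, 0 ≤ E ω)
    (hlt : ∫⁻ ω, ENNReal.ofReal (scaledLoss a (s ω) (y ω)) ∂μ <
      ∫⁻ ω, ENNReal.ofReal (scaledLoss a (h ω) (y ω)) ∂μ) :
    ∃ η : ℝ, 0 < η ∧ ∃ J : ℝ,
      Integrable (fun ω => scaledLoss a (s ω) (y ω) -
        min (lossFloor a (h ω) (η * E ω) (y ω)) J) μ ∧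
      ∫ ω, (scaledLoss a (s ω) (y ω) - min (lossFloor a (h ω) (η * E ω) (y ω)) J) ∂μ < 0 := by
  set G : ℕ → Ω → ℝ := fun j ω => min (lossFloor a (h ω) (1 / ((j : ℝ) + 1) * E ω) (y ω)) j
  have hGm : ∀ j, Measurable (G j) := fun j =>
    (measurable_lossFloor a hhm (hEm.const_mul _) hym).min measurable_const
  obtain ⟨j, hj⟩ := exists_lt_lintegral_of_tendsto (fun j => (hGm j).ennreal_ofReal)
    (fun ω => (ENNReal.continuous_ofReal.tendsto _).comp
      (tendsto_min_lossFloor ha (hh ω) (E ω) (y ω))) hlt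
  have hloss : ∀ ω, 0 ≤ scaledLoss a (s ω) (y ω) := fun ω => scaledLoss_nonneg ha (hs ω) (hy ω)
  have hlossi : Integrable (fun ω => scaledLoss a (s ω) (y ω)) μ :=
    (lintegral_ofReal_ne_top_iff_integrable
      (measurable_scaledLoss a hsm hym).aestronglyMeasurable (ae_of_all _ hloss)).1 hlt.ne_top
  have hGnonneg : ∀ ω, 0 ≤ G j ω := fun ω => le_min
    (lossFloor_nonneg ha (hh ω) (mul_nonneg (by positivity) (hE ω)) (hy ω)) (Nat.cast_nonneg j)
  have hGi : Integrable (G j) μ :=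
    Integrable.of_bound (hGm j).aestronglyMeasurable (j : ℝ) (ae_of_all _ fun ω =>
      (Real.norm_of_nonneg (hGnonneg ω)).trans_le (min_le_right _ _))
  refine ⟨1 / ((j : ℝ) + 1), by positivity, j, hlossi.sub hGi, ?_⟩
  rw [← ofReal_integral_eq_lintegral_ofReal hlossi (ae_of_all _ hloss),
    ← ofReal_integral_eq_lintegral_ofReal hGi (ae_of_all _ hGnonneg),
    ENNReal.ofReal_lt_ofReal_iff_of_nonneg (integral_nonneg hloss)] at hj
  exact (integral_sub hlossi hGi).trans_lt (sub_neg.2 hj)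

end Measurability

namespace AGARCHParam

variable {p q : ℕ}

theorem statVol_add (θ : AGARCHParam p q) (x : ℤ → ℝ) (s t : ℤ) :
    θ.statVol (fun u => x (u + t)) s = θ.statVol x (s + t) := by
  unfold statVol
  congr 1
  refine tsum_congr fun k => ?_
  beta_reduce
  rw [show s - 1 - (k : ℤ) + t = s + t - 1 - k by ring]

theorem pathDom_add (ρ : ℝ) (x : ℤ → ℝ) (s t : ℤ) :
    pathDom ρ (fun u => x (u + t)) s = pathDom ρ x (s + t) := by
  unfold pathDom
  refine tsum_congr fun k => ?_
  beta_reduce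
  rw [show s - 1 - (k : ℤ) + t = s + t - 1 - k by ring]

theorem pathDom_nonneg {ρ : ℝ} (hρ : 0 ≤ ρ) (x : ℤ → ℝ) (t : ℤ) : 0 ≤ pathDom ρ x t :=
  tsum_nonneg fun k => by positivity

/-- An upper bound of the contribution of time zero to the difference of the losses at `θ₀` and at
`θ`, uniform over `θ` near `θ₁`; the loss at `θ` is truncated at `J`. -/
def lossGap (θ₀ θ₁ : AGARCHParam p q) (a ρ η J : ℝ) (x : ℤ → ℝ) : ℝ :=
  scaledLoss a (θ₀.statVol x 0) (x 0 ^ 2) -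
    min (lossFloor a (θ₁.statVol x 0) (η * pathDom ρ x 0) (x 0 ^ 2)) J

theorem measurable_lossGap (θ₀ θ₁ : AGARCHParam p q) (a ρ η J : ℝ) :
    Measurable (lossGap θ₀ θ₁ a ρ η J) := by
  have hcoord : ∀ s : ℤ, Measurable fun x : ℤ → ℝ => x s := measurable_pi_apply
  have hvol : ∀ θ : AGARCHParam p q, Measurable fun x : ℤ → ℝ => θ.statVol x 0 := fun θ =>
    measurable_statVol (X := fun s (x : ℤ → ℝ) => x s) θ fun k => hcoord _
  have hdom : Measurable fun x : ℤ → ℝ => pathDom ρ x 0 :=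
    measurable_pathDom (X := fun s (x : ℤ → ℝ) => x s) ρ fun k => hcoord _
  have hsq := (hcoord 0).pow_const 2
  exact (measurable_scaledLoss a (hvol θ₀) hsq).sub
    ((measurable_lossFloor a (hvol θ₁) (hdom.const_mul η) hsq).min measurable_const)

theorem lossGap_shift (θ₀ θ₁ : AGARCHParam p q) (a ρ η J : ℝ) (x : ℤ → ℝ) (t : ℤ) :
    lossGap θ₀ θ₁ a ρ η J (fun u => x (u + t)) = scaledLoss a (θ₀.statVol x t) (x t ^ 2) -
      min (lossFloor a (θ₁.statVol x t) (η * pathDom ρ x t) (x t ^ 2)) J := by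
  rw [lossGap, statVol_add, statVol_add, pathDom_add, zero_add]

namespace UnifBounds

variable {K : Set (AGARCHParam p q)} {a A ρ ρ' η : ℝ} {θ₀ θ₁ θ : AGARCHParam p q}

theorem sub_le_lossGap (h : UnifBounds K a A ρ) (hθ₀ : θ₀ ∈ K) (hθ : θ ∈ K) (J : ℝ)
    {x : ℤ → ℝ} {t : ℤ} (hd : |θ.statVol x t - θ₁.statVol x t| ≤ η * pathDom ρ' x t) :
    (x t ^ 2 / θ₀.statVol x t + Real.log (θ₀.statVol x t)) -
      (x t ^ 2 / θ.statVol x t + Real.log (θ.statVol x t)) ≤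
      lossGap θ₀ θ₁ a ρ' η J (fun u => x (u + t)) := by
  have hfloor := (min_le_left _ J).trans
    (lossFloor_le h.a_pos (h.le_statVol hθ x t) (sq_nonneg (x t)) hd)
  rw [scaledLoss_eq h.a_pos (h.statVol_pos hθ x t)] at hfloor
  rw [lossGap_shift, scaledLoss_eq h.a_pos (h.statVol_pos hθ₀ x t)]
  linarith

theorem statLoss_sub_le_sum_lossGap (h : UnifBounds K a A ρ) (hθ₀ : θ₀ ∈ K) (hθ : θ ∈ K) (J : ℝ)
    {x : ℤ → ℝ} (hd : ∀ t, |θ.statVol x t - θ₁.statVol x t| ≤ η * pathDom ρ' x t) (n : ℕ) :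
    θ₀.statLoss x n - θ.statLoss x n ≤
      ∑ k ∈ Finset.range n, lossGap θ₀ θ₁ a ρ' η J (fun u => x (u + (k + 1))) := by
  rw [statLoss, statLoss, ← Finset.sum_sub_distrib]
  exact Finset.sum_le_sum fun k _ => h.sub_le_lossGap hθ₀ hθ J (hd _)

end UnifBounds

end AGARCHParam

namespace IsStationaryAGARCH

open AGARCHParam

variable {Ω : Type*} [MeasurableSpace Ω] {μ : Measure Ω} {p q : ℕ}
  {θ₀ : AGARCHParam p q} {Z X σ : ℤ → Ω → ℝ} {K : Set (AGARCHParam p q)} {a A ρ : ℝ}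

theorem measurable_statVol_obs (h : IsStationaryAGARCH μ θ₀ Z X σ) (θ : AGARCHParam p q) (t : ℤ) :
    Measurable fun ω => θ.statVol (fun s => X s ω) t :=
  measurable_statVol θ fun _ => h.measurable_obs _

theorem lintegral_sq_noise (h : IsStationaryAGARCH μ θ₀ Z X σ) :
    ∫⁻ ω, ENNReal.ofReal (Z 0 ω ^ 2) ∂μ = 1 := by
  rw [← ofReal_integral_eq_lintegral_ofReal (h.integrable_sq_noise 0)
    (ae_of_all _ fun ω => sq_nonneg _), h.noise.secondMoment, ENNReal.ofReal_one]

theorem indepFun_noise_statVol_div (h : IsStationaryAGARCH μ θ₀ Z X σ) (θ θ' : AGARCHParam p q) :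
    IndepFun (Z 0)
      (fun ω => θ.statVol (fun s => X s ω) 0 / θ'.statVol (fun s => X s ω) 0) μ := by
  obtain ⟨g, hgm, hg⟩ := h.exists_noisePast_statVol θ (s := 0) (t := -1) (by omega)
  obtain ⟨g', hgm', hg'⟩ := h.exists_noisePast_statVol θ' (s := 0) (t := -1) (by omega)
  exact h.indepFun_of_measurable (measurable_noiseFuture (by omega)) (hgm.div hgm') (hg.div hg')

variable [IsProbabilityMeasure μ]

theorem lintegral_sq_obs_div_statVol (h : IsStationaryAGARCH μ θ₀ Z X σ)
    (hK : UnifBounds K a A ρ) (hθ₀ : θ₀ ∈ K) (hp : 0 < p) (θ : AGARCHParam p q) :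
    ∫⁻ ω, ENNReal.ofReal (X 0 ω ^ 2 / θ.statVol (fun s => X s ω) 0) ∂μ =
      ∫⁻ ω, ENNReal.ofReal (θ₀.statVol (fun s => X s ω) 0 / θ.statVol (fun s => X s ω) 0) ∂μ := by
  have hsq : Measurable fun x : ℝ => ENNReal.ofReal (x ^ 2) := by fun_prop
  have hratio := (h.measurable_statVol_obs θ₀ 0).div (h.measurable_statVol_obs θ 0)
  have hmul := lintegral_mul_eq_lintegral_mul_lintegral_of_indepFun''
    (hsq.comp (h.noise.measurable 0)).aemeasurable hratio.ennreal_ofReal.aemeasurable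
    ((h.indepFun_noise_statVol_div θ₀ θ).comp hsq ENNReal.measurable_ofReal)
  simp only [Function.comp_apply, h.lintegral_sq_noise, one_mul, Pi.div_apply] at hmul
  rw [← hmul]
  refine lintegral_congr_ae ?_
  filter_upwards [h.obs_eq 0, h.ae_sq_vol_eq_statVol hK hθ₀ hp] with ω hobs hvol
  rw [← ENNReal.ofReal_mul (sq_nonneg _), hobs, ← hvol 0]
  congr 1
  ring

theorem lintegral_log_statVol_ne_top (h : IsStationaryAGARCH μ θ₀ Z X σ)
    (hK : UnifBounds K a A ρ) (hθ₀ : θ₀ ∈ K) (hp : 0 < p) :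
    ∫⁻ ω, ENNReal.ofReal (Real.log (θ₀.statVol (fun s => X s ω) 0 / a)) ∂μ ≠ ⊤ := by
  obtain ⟨κ, hκ0, -, hσ⟩ := h.exists_lintegral_vol_rpow_ne_top (hK.subset hθ₀) hp
  have ha := hK.a_pos
  refine ne_top_of_le_ne_top (b := ∫⁻ ω, ENNReal.ofReal ((a ^ κ)⁻¹ / κ) *
    ENNReal.ofReal (σ 0 ω ^ 2) ^ κ ∂μ) ?_ (lintegral_mono_ae ?_)
  · rw [lintegral_const_mul' _ _ ENNReal.ofReal_ne_top]
    exact ENNReal.mul_ne_top ENNReal.ofReal_ne_top hσ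
  · filter_upwards [h.ae_sq_vol_eq_statVol hK hθ₀ hp] with ω hω
    rw [← hω 0, ENNReal.ofReal_rpow_of_nonneg (sq_nonneg _) hκ0.le,
      ← ENNReal.ofReal_mul (by positivity)]
    refine ENNReal.ofReal_le_ofReal ?_
    refine (Real.log_le_rpow_div (by positivity) hκ0).trans_eq ?_
    rw [Real.div_rpow (sq_nonneg _) ha.le]
    field_simp

theorem lintegral_scaledLoss_sq_obs (h : IsStationaryAGARCH μ θ₀ Z X σ)
    (hK : UnifBounds K a A ρ) (hθ₀ : θ₀ ∈ K) (hp : 0 < p) {θ : AGARCHParam p q} (hθ : θ ∈ K) :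
    ∫⁻ ω, ENNReal.ofReal (scaledLoss a (θ.statVol (fun s => X s ω) 0) (X 0 ω ^ 2)) ∂μ =
      ∫⁻ ω, ENNReal.ofReal
        (scaledLoss a (θ.statVol (fun s => X s ω) 0) (θ₀.statVol (fun s => X s ω) 0)) ∂μ := by
  have hlog : ∀ ω, 0 ≤ Real.log (θ.statVol (fun s => X s ω) 0 / a) := fun ω =>
    log_div_nonneg hK.a_pos (hK.le_statVol hθ _ _)
  have hlogm : Measurable fun ω =>
      ENNReal.ofReal (Real.log (θ.statVol (fun s => X s ω) 0 / a)) :=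
    ((h.measurable_statVol_obs θ 0).div_const a).log.ennreal_ofReal
  have hsplit : ∀ {y : Ω → ℝ}, (∀ ω, 0 ≤ y ω) →
      ∫⁻ ω, ENNReal.ofReal (scaledLoss a (θ.statVol (fun s => X s ω) 0) (y ω)) ∂μ =
        ∫⁻ ω, ENNReal.ofReal (Real.log (θ.statVol (fun s => X s ω) 0 / a)) ∂μ +
          ∫⁻ ω, ENNReal.ofReal (y ω / θ.statVol (fun s => X s ω) 0) ∂μ := fun {y} hy => by
    rw [← lintegral_add_left hlogm]
    exact lintegral_congr fun ω =>
      ENNReal.ofReal_add (hlog ω) (div_nonneg (hy ω) (hK.statVol_pos hθ _ _).le)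
  rw [hsplit fun ω => sq_nonneg _, hsplit fun ω => (hK.statVol_pos hθ₀ _ _).le,
    h.lintegral_sq_obs_div_statVol hK hθ₀ hp θ]

theorem lintegral_scaledLoss_ne_top (h : IsStationaryAGARCH μ θ₀ Z X σ)
    (hK : UnifBounds K a A ρ) (hθ₀ : θ₀ ∈ K) (hp : 0 < p) :
    ∫⁻ ω, ENNReal.ofReal
      (scaledLoss a (θ₀.statVol (fun s => X s ω) 0) (θ₀.statVol (fun s => X s ω) 0)) ∂μ ≠ ⊤ := by
  have hadd : ∀ ω, ENNReal.ofReal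
      (scaledLoss a (θ₀.statVol (fun s => X s ω) 0) (θ₀.statVol (fun s => X s ω) 0)) =
      ENNReal.ofReal (Real.log (θ₀.statVol (fun s => X s ω) 0 / a)) + 1 := fun ω => by
    rw [scaledLoss, div_self (hK.statVol_pos hθ₀ _ _).ne', ENNReal.ofReal_add
      (log_div_nonneg hK.a_pos (hK.le_statVol hθ₀ _ _)) zero_le_one, ENNReal.ofReal_one]
  simp only [hadd]
  rw [lintegral_add_right _ measurable_const, lintegral_const, measure_univ, mul_one]
  exact ENNReal.add_ne_top.2 ⟨h.lintegral_log_statVol_ne_top hK hθ₀ hp, ENNReal.one_ne_top⟩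

theorem lintegral_scaledLoss_lt (h : IsStationaryAGARCH μ θ₀ Z X σ)
    (hK : UnifBounds K a A ρ) (hθ₀ : θ₀ ∈ K) (hp : 0 < p) {θ : AGARCHParam p q} (hθ : θ ∈ K)
    (hne : ¬ ∀ᵐ ω ∂μ, θ.statVol (fun s => X s ω) 0 = θ₀.statVol (fun s => X s ω) 0) :
    ∫⁻ ω, ENNReal.ofReal (scaledLoss a (θ₀.statVol (fun s => X s ω) 0) (X 0 ω ^ 2)) ∂μ <
      ∫⁻ ω, ENNReal.ofReal (scaledLoss a (θ.statVol (fun s => X s ω) 0) (X 0 ω ^ 2)) ∂μ := by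
  have hpos : ∀ {θ}, θ ∈ K → ∀ ω, 0 < θ.statVol (fun s => X s ω) 0 := fun hθ ω =>
    hK.statVol_pos hθ _ _
  rw [h.lintegral_scaledLoss_sq_obs hK hθ₀ hp hθ₀, h.lintegral_scaledLoss_sq_obs hK hθ₀ hp hθ]
  refine lintegral_strict_mono_of_ae_le_of_frequently_ae_lt (measurable_scaledLoss a
    (h.measurable_statVol_obs θ 0) (h.measurable_statVol_obs θ₀ 0)).ennreal_ofReal.aemeasurable
    (h.lintegral_scaledLoss_ne_top hK hθ₀ hp) (ae_of_all _ fun ω => ENNReal.ofReal_le_ofReal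
      (scaledLoss_self_le hK.a_pos (hpos hθ₀ ω) (hpos hθ ω))) ?_
  refine (not_eventually.1 hne).mono fun ω hω => ne_of_lt ?_
  refine (ENNReal.ofReal_lt_ofReal_iff_of_nonneg (scaledLoss_nonneg hK.a_pos
    (hK.le_statVol hθ₀ _ _) (hpos hθ₀ ω).le)).2 ?_
  exact scaledLoss_self_lt hK.a_pos (hpos hθ₀ ω) (hpos hθ ω) hω

theorem ae_tendsto_sum_atBot (h : IsStationaryAGARCH μ θ₀ Z X σ) {f : (ℤ → ℝ × ℝ) → ℝ}
    (hfm : Measurable f) (hf : Integrable (fun ω => f fun t => (X t ω, σ t ω)) μ)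
    (hneg : ∫ ω, f (fun t => (X t ω, σ t ω)) ∂μ < 0) :
    ∀ᵐ ω ∂μ, Tendsto (fun n : ℕ =>
      ∑ k ∈ Finset.range n, f (pathShift k fun t => (X t ω, σ t ω))) atTop atBot := by
  set I := ∫ ω, f (fun t => (X t ω, σ t ω)) ∂μ
  have hbdd := h.ae_bddAbove_sum (f := fun w => f w - I / 2) (hfm.sub_const _)
    (hf.sub (integrable_const _)) (by
      rw [integral_sub hf (integrable_const _), integral_const, probReal_univ, one_smul]
      linarith)
  filter_upwards [hbdd] with ω ⟨C, hC⟩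
  have hlinear : Tendsto (fun n : ℕ => C + (n : ℝ) * (I / 2)) atTop atBot :=
    tendsto_atBot_add_const_left _ _
      (tendsto_natCast_atTop_atTop.atTop_mul_const_of_neg (by linarith))
  refine tendsto_atBot_mono (fun n => ?_) hlinear
  have hCn := hC n
  rw [Finset.sum_sub_distrib, Finset.sum_const, Finset.card_range, nsmul_eq_mul] at hCn
  linarith

theorem exists_ae_tendsto_sum_lossGap (h : IsStationaryAGARCH μ θ₀ Z X σ)
    (hK : UnifBounds K a A ρ) (hθ₀ : θ₀ ∈ K) (hp : 0 < p) {θ₁ : AGARCHParam p q} (hθ₁ : θ₁ ∈ K)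
    (hne : ¬ ∀ᵐ ω ∂μ, θ₁.statVol (fun s => X s ω) 0 = θ₀.statVol (fun s => X s ω) 0)
    {ρ' : ℝ} (hρ' : 0 ≤ ρ') :
    ∃ η : ℝ, 0 < η ∧ ∃ J : ℝ, ∀ᵐ ω ∂μ, Tendsto (fun n : ℕ => ∑ k ∈ Finset.range n,
      lossGap θ₀ θ₁ a ρ' η J (fun u => X (u + (k + 1)) ω)) atTop atBot := by
  obtain ⟨η, hη, J, hint, hneg⟩ := exists_integral_scaledLoss_sub_lossFloor_neg
    (h.measurable_statVol_obs θ₀ 0) (h.measurable_statVol_obs θ₁ 0)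
    ((h.measurable_obs 0).pow_const 2) (measurable_pathDom ρ' fun k => h.measurable_obs _)
    hK.a_pos (fun ω => hK.le_statVol hθ₀ _ _) (fun ω => hK.le_statVol hθ₁ _ _)
    (fun ω => sq_nonneg _) (fun ω => pathDom_nonneg hρ' _ _)
    (h.lintegral_scaledLoss_lt hK hθ₀ hp hθ₁ hne)
  refine ⟨η, hη, J, ?_⟩
  set f : (ℤ → ℝ × ℝ) → ℝ := fun w => lossGap θ₀ θ₁ a ρ' η J fun s => (w s).1
  have hfm : Measurable f := (measurable_lossGap θ₀ θ₁ a ρ' η J).comp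
    (measurable_pi_lambda _ fun s => measurable_fst.comp (measurable_pi_apply s))
  have hshift := h.identDistrib_pathShift hfm 1
  filter_upwards [h.ae_tendsto_sum_atBot (hfm.comp (measurable_pathShift 1))
    (hshift.integrable_iff.2 hint) (hshift.integral_eq.trans_lt hneg)] with ω hω
  refine hω.congr fun n => Finset.sum_congr rfl fun k _ => ?_
  refine congrArg (lossGap θ₀ θ₁ a ρ' η J) (funext fun u => ?_)
  simp only [pathShift, add_assoc, add_comm (1 : ℤ)]

theorem exists_nhdsWithin_logLik_lt (h : IsStationaryAGARCH μ θ₀ Z X σ)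
    (hK : UnifBounds K a A ρ) (hθ₀ : θ₀ ∈ K) (hp : 0 < p) {ς : Fin q → ℝ} (hς : ∀ j, 0 ≤ ς j)
    {θ₁ : AGARCHParam p q} (hθ₁ : θ₁ ∈ K)
    (hne : ¬ ∀ᵐ ω ∂μ, θ₁.statVol (fun s => X s ω) 0 = θ₀.statVol (fun s => X s ω) 0) :
    ∃ V ∈ 𝓝[K] θ₁, ∀ᵐ ω ∂μ, ∀ᶠ n in atTop, ∀ θ ∈ V, θ ∈ K →
      logLik ς (fun t => X t ω) n θ < logLik ς (fun t => X t ω) n θ₀ := by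
  obtain ⟨ρ', hρ', hρ'1⟩ := exists_between hK.rho_lt_one
  have hρ'0 := hK.rho_pos.trans hρ'
  obtain ⟨η, hη, J, hgap⟩ := h.exists_ae_tendsto_sum_lossGap hK hθ₀ hp hθ₁ hne hρ'0.le
  refine ⟨_, hK.eventually_abs_statVol_sub_le hρ' hθ₁ hη, ?_⟩
  filter_upwards [hgap, h.ae_temperedPath (hK.subset hθ₀) hp hρ'0 hρ'1,
    h.ae_summable_obs (hK.subset hθ₀) hp hK.rho_pos hK.rho_lt_one fun k => k + 1]
    with ω hgapω htemp hfwd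
  obtain ⟨C, hC⟩ := hK.exists_abs_logLik_add_statLoss_le hς (htemp.mono hK.rho_pos.le hρ'.le) hfwd
  filter_upwards [hgapω.eventually_lt_atBot (-(2 * C))] with n hn θ hθV hθ
  have hdiff := hK.statLoss_sub_le_sum_lossGap hθ₀ hθ J (hθV _ htemp) n
  have hupper := (abs_le.1 (hC θ hθ n)).2
  have hlower := (abs_le.1 (hC θ₀ hθ₀ n)).1
  linarith

theorem ae_eventually_logLik_lt (h : IsStationaryAGARCH μ θ₀ Z X σ) (hKc : IsCompact K)
    (hK : UnifBounds K a A ρ) (hθ₀ : θ₀ ∈ K) (hp : 0 < p) {ς : Fin q → ℝ} (hς : ∀ j, 0 ≤ ς j)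
    (hident : ∀ θ ∈ K, (∀ᵐ ω ∂μ, θ.statVol (fun s => X s ω) 0 = θ₀.statVol (fun s => X s ω) 0) →
      θ = θ₀) {U : Set (AGARCHParam p q)} (hU : IsOpen U) (hU₀ : θ₀ ∈ U) :
    ∀ᵐ ω ∂μ, ∀ᶠ n in atTop, ∀ θ ∈ K \ U,
      logLik ς (fun t => X t ω) n θ < logLik ς (fun t => X t ω) n θ₀ := by
  suffices hcover : ∀ᵐ ω ∂μ, ∀ᶠ n in atTop, ∀ θ ∈ K \ U, θ ∈ K →
      logLik ς (fun t => X t ω) n θ < logLik ς (fun t => X t ω) n θ₀ by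
    filter_upwards [hcover] with ω hω
    exact hω.mono fun n hn θ hθ => hn θ hθ hθ.1
  refine (hKc.diff hU).induction_on (p := fun S => ∀ᵐ ω ∂μ, ∀ᶠ n in atTop, ∀ θ ∈ S, θ ∈ K →
    logLik ς (fun t => X t ω) n θ < logLik ς (fun t => X t ω) n θ₀) ?_ ?_ ?_ ?_
  · exact ae_of_all _ fun ω => Eventually.of_forall fun n θ hθ => absurd hθ (Set.notMem_empty θ)
  · intro S T hST hT
    filter_upwards [hT] with ω hω
    exact hω.mono fun n hn θ hθ => hn θ (hST hθ)
  · intro S T hS hT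
    filter_upwards [hS, hT] with ω hSω hTω
    filter_upwards [hSω, hTω] with n hSn hTn θ hθ hθK
    exact hθ.elim (fun hθS => hSn θ hθS hθK) fun hθT => hTn θ hθT hθK
  · intro θ₁ hθ₁
    obtain ⟨V, hV, hlt⟩ := h.exists_nhdsWithin_logLik_lt hK hθ₀ hp hς hθ₁.1
      fun heq => hθ₁.2 (hident θ₁ hθ₁.1 heq ▸ hU₀)
    exact ⟨V, nhdsWithin_mono _ Set.sdiff_subset hV, hlt⟩

end IsStationaryAGARCH

theorem tendsto_of_eventually_isMaxOn {α : Type*} [PseudoMetricSpace α] {K : Set α}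
    {L : ℕ → α → ℝ} {x₀ : α} {x : ℕ → α} (hx₀ : x₀ ∈ K)
    (hsep : ∀ m : ℕ, ∀ᶠ n in atTop, ∀ y ∈ K \ Metric.ball x₀ (1 / (m + 1)), L n y < L n x₀)
    (hmax : ∀ᶠ n in atTop, x n ∈ K ∧ IsMaxOn (L n) K (x n)) : Tendsto x atTop (𝓝 x₀) := by
  refine Metric.nhds_basis_ball_inv_nat_succ.tendsto_right_iff.2 fun m _ => ?_
  filter_upwards [hsep m, hmax] with n hlt ⟨hmem, hopt⟩
  by_contra hfar
  exact (hopt hx₀).not_gt (hlt _ ⟨hmem, hfar⟩)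

end

theorem theorem5p5 {Ω : Type*} [MeasurableSpace Ω] (μ : Measure Ω) [IsProbabilityMeasure μ]
    (p q : ℕ) (θ₀ : AGARCHParam p q) (Z X σ : ℤ → Ω → ℝ)
    (hX : IsStationaryAGARCH μ θ₀ Z X σ)
    -- some `α_i°`, `i = 1, …, p`, is positive
    (hα : ∃ i : Fin p, 0 < θ₀.alpha i)
    -- `(α_p°, β_q°) ≠ (0, 0)`
    (hlast : q = 0 ∨ (∃ i : Fin p, (i : ℕ) + 1 = p ∧ θ₀.alpha i ≠ 0) ∨
      (∃ j : Fin q, (j : ℕ) + 1 = q ∧ θ₀.beta j ≠ 0))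
    -- no common zeros
    (hcoprime : ¬ ∃ z : ℂ, θ₀.aPoly z = 0 ∧ θ₀.bPoly z = 0)
    -- the law of `Z_0` is not concentrated at two points
    (hZ : ¬ ∃ a b : ℝ, ∀ᵐ ω ∂μ, Z 0 ω = a ∨ Z 0 ω = b)
    (K : Set (AGARCHParam p q)) (hK : IsCompact K) (hKsub : K ⊆ AGARCHParam.space p q)
    (hθ₀ : θ₀ ∈ K)
    -- the initial value of the volatility recursion
    (ς : Fin q → ℝ) (hς : ∀ j, 0 ≤ ς j) :
    (∀ n ω, ∃ θ, AGARCHParam.IsQMLE K ς (fun t => X t ω) n θ) ∧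
    ∀ θhat : ℕ → Ω → AGARCHParam p q,
      (∀ n ≥ 1, ∀ᵐ ω ∂μ, AGARCHParam.IsQMLE K ς (fun t => X t ω) n (θhat n ω)) →
      ∀ᵐ ω ∂μ, Tendsto (fun n => θhat n ω) atTop (𝓝 θ₀) := by
  obtain ⟨a, A, ρ, hKb⟩ := AGARCHParam.exists_unifBounds hK ⟨θ₀, hθ₀⟩ hKsub
  refine ⟨fun n ω => AGARCHParam.exists_isQMLE hK ⟨θ₀, hθ₀⟩ hKsub hς _ n, fun θhat hmax => ?_⟩
  have hsep := ae_all_iff.2 fun m : ℕ =>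
    hX.ae_eventually_logLik_lt hK hKb hθ₀ hα.choose.pos hς
      (fun θ hθ heq => hX.eq_of_ae_statVol_eq hKb hθ₀ hθ hα hlast hcoprime hZ heq)
      (Metric.isOpen_ball (x := θ₀) (ε := 1 / ((m : ℝ) + 1)))
      (Metric.mem_ball_self (by positivity))
  have hqmle := ae_all_iff.2 fun n : ℕ => ae_all_iff.2 fun hn : 1 ≤ n => hmax n hn
  filter_upwards [hsep, hqmle] with ω hsepω hqmleω
  exact tendsto_of_eventually_isMaxOn hθ₀ hsepω ((eventually_ge_atTop 1).mono hqmleω)
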